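/- Let $V$ be a compact complex affine manifold of dimension $n$ (all transition maps between its charts are affine and holomorphic), and let $\omega_0=\sqrt{-1}\,b_{\alpha\bar\beta}\,dz^\alpha\wedge d\bar z^\beta$ be a Kähler metric on $V$ whose coefficients are constant in every affine chart. Let $S=S_{\alpha\beta}\,dz^\alpha\otimes dz^\beta$ be a symmetric tensor whose coefficients are constant in every affine chart. For a real function $\varphi\in C^2(V)$ write, in a chart, $A=(b_{\alpha\bar\beta}+\varphi_{\alpha\bar\beta})$, $B=(\varphi_{\alpha\beta})$ and, where $A$ is invertible, $K_S=(B-S)\,\overline{A^{-1}}\;\overline{(B-S)}\,A^{-1}$. The function $\varphi$ is called strictly $(S,\omega_0)$-convex if $\omega_0+\sqrt{-1}\,\partial\bar\partial\varphi>0$ and the maximal eigenvalue $M_S$ of $K_S$ (whose eigenvalues are real, non-negative and independent of the chart) is smaller than $1$ at every point of $V$. Let $\mathcal R\subset\mathbb C$ be a bounded domain with smooth boundary, let $\Omega_0$ be the pull-back of $\omega_0$ to $\mathcal R\times V$, and let $\epsilon>0$. For a real function $F$ on $\partial\mathcal R\times V$, a solution of the perturbed problem with boundary value $F$ is a real function $\Phi$,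 continuous on $\overline{\mathcal R}\times V$ and of class $C^4$ in $\mathcal R\times V$, with $$(\Omega_0+\sqrt{-1}\,\partial\bar\partial\Phi)^{n+1}=\epsilon\,\sqrt{-1}\,d\tau\wedge d\bar\tau\wedge\Omega_0\wedge(\Omega_0+\sqrt{-1}\,\partial\bar\partial\Phi)^{n-1}\quad\text{and}\quad \Omega_0+\sqrt{-1}\,\partial\bar\partial\Phi>0\quad\text{in }\mathcal R\times V,$$ and $\Phi=F$ on $\partial\mathcal R\times V$. Let $F\in C^2(\partial\mathcal R\times V)$ be such that $F(\tau,\cdot)$ is strictly $(S,\omega_0)$-convex for every $\tau\in\partial\mathcal R$. Assume that for every $\sigma\in[0,1]$ the perturbed problem with boundary value $\sigma F$ (and the same $\epsilon$) has a solution $\Phi^\sigma\in C^4(\overline{\mathcal R}\times V)$ such that $\sigma\mapsto\Phi^\sigma$, $\sigma\in[0,1]$, is continuous in the $C^2$ topology of $\overline{\mathcal R}\times V$. Then every solution $\Phi$ of the perturbed problem with boundary value $F$ has the property that $\Phi(\tau,\cdot)$ is strictly $(S,\omega_0)$-convex for every $\tau\in\overline{\mathcal R}$; in particular the maximal eigenvalue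 $M_S$ of $K_S$, computed for $\varphi=\Phi(\tau,\cdot)$, is smaller than $1$ at every point of $\overline{\mathcal R}\times V$. -/

import Mathlib

open Set Filter Topology
open scoped ComplexOrder

noncomputable section

/-! ### Wirtinger derivatives -/

/-- The derivative `∂_v f = (1/2) (D_v f - i D_{iv} f)` of a complex valued function; for the
`j`-th coordinate vector `v` this is `∂f/∂z^j`. -/
def dz {E : Type*} [NormedAddCommGroup E] [NormedSpace ℝ E] [NormedSpace ℂ E]
    (f : E → ℂ) (v : E) (p : E) : ℂ :=
  (1 / 2) * (fderiv ℝ f p v - Complex.I * fderiv ℝ f p (Complex.I • v))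

/-- The derivative `(1/2) (D_v f + i D_{iv} f)`; for the `j`-th coordinate vector `v` this is the
derivative of `f` with respect to the conjugate of `z^j`. -/
def dzbar {E : Type*} [NormedAddCommGroup E] [NormedSpace ℝ E] [NormedSpace ℂ E]
    (f : E → ℂ) (v : E) (p : E) : ℂ :=
  (1 / 2) * (fderiv ℝ f p v + Complex.I * fderiv ℝ f p (Complex.I • v))

/-! ### Complex affine manifolds and constant tensors -/

/-- Every transition map between charts of the atlas is (locally) a complex affine map. -/
def IsComplexAffine (n : ℕ) (V : Type*) [TopologicalSpace V] [ChartedSpace (Fin n → ℂ) V] : Prop :=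
  ∀ e ∈ atlas (Fin n → ℂ) V, ∀ e' ∈ atlas (Fin n → ℂ) V,
    ∀ z ∈ (e.symm.trans e').source,
      ∃ a : (Fin n → ℂ) →ᵃ[ℂ] (Fin n → ℂ), (fun w => e' (e.symm w)) =ᶠ[𝓝 z] a

/-- The Jacobian matrix `(∂w^γ/∂z^α)` (row `γ`, column `α`) of the change of coordinates from the
chart `e` (coordinates `z`) to the chart `e'` (coordinates `w`) at the point `x`. -/
def transitionJacobian {n : ℕ} {V : Type*} [TopologicalSpace V]
    (e e' : OpenPartialHomeomorph V (Fin n → ℂ)) (x : V) : Matrix (Fin n) (Fin n) ℂ :=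
  Matrix.of fun γ α => fderiv ℂ (fun w => e' (e.symm w)) (e x) (Pi.single α 1) γ

/-- A Kähler metric `ω₀ = i b_{αβ̄} dz^α ∧ dz̄^β` with constant coefficients in every chart. -/
structure ConstantMetric (n : ℕ) (V : Type*) [TopologicalSpace V]
    [ChartedSpace (Fin n → ℂ) V] where
  /-- the matrix `(b_{αβ̄})` in each chart -/
  coeff : OpenPartialHomeomorph V (Fin n → ℂ) → Matrix (Fin n) (Fin n) ℂ
  posDef : ∀ e ∈ atlas (Fin n → ℂ) V, (coeff e).PosDef
  compatible : ∀ e ∈ atlas (Fin n → ℂ) V, ∀ e' ∈ atlas (Fin n → ℂ) V,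
    ∀ x ∈ e.source ∩ e'.source,
      coeff e = (transitionJacobian e e' x).transpose * coeff e' *
        (transitionJacobian e e' x).map (starRingEnd ℂ)

/-- A symmetric tensor `S = S_{αβ} dz^α ⊗ dz^β` with constant coefficients in every chart. -/
structure ConstantTensor (n : ℕ) (V : Type*) [TopologicalSpace V]
    [ChartedSpace (Fin n → ℂ) V] where
  /-- the matrix `(S_{αβ})` in each chart -/
  coeff : OpenPartialHomeomorph V (Fin n → ℂ) → Matrix (Fin n) (Fin n) ℂ
  symmetric : ∀ e ∈ atlas (Fin n → ℂ) V, (coeff e).IsSymm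
  compatible : ∀ e ∈ atlas (Fin n → ℂ) V, ∀ e' ∈ atlas (Fin n → ℂ) V,
    ∀ x ∈ e.source ∩ e'.source,
      coeff e = (transitionJacobian e e' x).transpose * coeff e' * transitionJacobian e e' x

/-! ### Strict convexity of functions on `V` -/

section Convexity

variable {n : ℕ} {V : Type*} [TopologicalSpace V] [ChartedSpace (Fin n → ℂ) V]

/-- `A = (φ_{αβ̄} + b_{αβ̄})` in the chart `e` at the point with coordinates `z`. -/
def matrixA (ω : ConstantMetric n V) (φ : V → ℝ) (e : OpenPartialHomeomorph V (Fin n → ℂ))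
    (z : Fin n → ℂ) : Matrix (Fin n) (Fin n) ℂ :=
  ω.coeff e + Matrix.of fun α β =>
    dz (dzbar (fun w => ((φ (e.symm w) : ℝ) : ℂ)) (Pi.single β 1)) (Pi.single α 1) z

/-- `B = (φ_{αβ})` in the chart `e` at the point with coordinates `z`. -/
def matrixB (φ : V → ℝ) (e : OpenPartialHomeomorph V (Fin n → ℂ))
    (z : Fin n → ℂ) : Matrix (Fin n) (Fin n) ℂ :=
  Matrix.of fun α β =>
    dz (dz (fun w => ((φ (e.symm w) : ℝ) : ℂ)) (Pi.single β 1)) (Pi.single α 1) z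

/-- `K_S = (B - S) conj(A⁻¹) conj(B - S) A⁻¹` in the chart `e` at the point with
coordinates `z`. -/
def matrixK (ω : ConstantMetric n V) (S : ConstantTensor n V) (φ : V → ℝ)
    (e : OpenPartialHomeomorph V (Fin n → ℂ)) (z : Fin n → ℂ) : Matrix (Fin n) (Fin n) ℂ :=
  (matrixB φ e z - S.coeff e) * ((matrixA ω φ e z)⁻¹).map (starRingEnd ℂ) *
    (matrixB φ e z - S.coeff e).map (starRingEnd ℂ) * (matrixA ω φ e z)⁻¹

/-- The maximal eigenvalue of a square matrix with real eigenvalues. -/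
def maxEigenvalue (K : Matrix (Fin n) (Fin n) ℂ) : ℝ :=
  sSup (Complex.re '' spectrum ℂ K)

/-- `M_S` at the point `x`: the maximal eigenvalue of `K_S`. It does not depend on the chart, so
that the preferred chart at `x` is used. -/
def maxEigenvalueK (ω : ConstantMetric n V) (S : ConstantTensor n V) (φ : V → ℝ) (x : V) : ℝ :=
  maxEigenvalue (matrixK ω S φ (chartAt (Fin n → ℂ) x) (chartAt (Fin n → ℂ) x x))

/-- `φ` is a `C²` function on `V` which is strictly `(S, ω₀)`-convex: `ω₀ + i∂∂̄φ > 0` and the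
maximal eigenvalue of `K_S` is smaller than `1`, at every point and in every chart. -/
structure StrictlySOmegaConvex (ω : ConstantMetric n V) (S : ConstantTensor n V)
    (φ : V → ℝ) : Prop where
  contDiff : ∀ e ∈ atlas (Fin n → ℂ) V, ContDiffOn ℝ 2 (fun z => φ (e.symm z)) e.target
  posDef : ∀ e ∈ atlas (Fin n → ℂ) V, ∀ z ∈ e.target, (matrixA ω φ e z).PosDef
  eigenvalue_lt : ∀ e ∈ atlas (Fin n → ℂ) V, ∀ z ∈ e.target,
    maxEigenvalue (matrixK ω S φ e z) < 1

end Convexity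

/-! ### The perturbed Monge-Ampère problem -/

/-- A bounded domain in `ℂ` with smooth boundary. -/
structure IsSmoothBoundedDomain (R : Set ℂ) : Prop where
  isOpen : IsOpen R
  isConnected : IsConnected R
  isBounded : Bornology.IsBounded R
  /-- near each boundary point, `R` is the negativity set of a smooth function with
  non-vanishing differential -/
  smoothBoundary : ∀ p ∈ frontier R, ∃ U : Set ℂ, IsOpen U ∧ p ∈ U ∧ ∃ ρ : ℂ → ℝ,
    ContDiffOn ℝ (⊤ : ℕ∞) ρ U ∧ ρ p = 0 ∧ (∀ q ∈ U, fderiv ℝ ρ q ≠ 0) ∧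
      R ∩ U = {q ∈ U | ρ q < 0}

/-- The coordinate vectors of `ℂ × ℂⁿ`; index `0` is the direction of `τ`. -/
def productFrame (n : ℕ) (i : Fin (n + 1)) : ℂ × (Fin n → ℂ) :=
  Fin.cases (1, 0) (fun α => (0, Pi.single α 1)) i

/-- The coefficient matrix of the pull-back `Ω₀` of `ω₀` to the product; index `0` is the
direction of `τ`. -/
def pullbackCoeff {n : ℕ} (b : Matrix (Fin n) (Fin n) ℂ) : Matrix (Fin (n + 1)) (Fin (n + 1)) ℂ :=
  Matrix.of fun i j => Fin.cases 0 (fun α => Fin.cases 0 (fun β => b α β) j) i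

/-- The wedge product of the `m` forms `i ∑_{j,k} (H l)_{jk} dz^j ∧ dz̄^k`, `l < m`, of type `(1,1)`
on `ℂᵐ` is the top degree form `∏_l (i dz^l ∧ dz̄^l)` multiplied by this coefficient: forms of
degree `2` commute, and permuting the `dz^j` and the `dz̄^k` produces the signs. -/
def wedgeCoeff {m : ℕ} (H : Fin m → Matrix (Fin m) (Fin m) ℂ) : ℂ :=
  ∑ s : Equiv.Perm (Fin m), ∑ t : Equiv.Perm (Fin m),
    ((Equiv.Perm.sign s : ℤ) : ℂ) * ((Equiv.Perm.sign t : ℤ) : ℂ) * ∏ l, H l (s l) (t l)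

section Problem

variable {n : ℕ} {V : Type*} [TopologicalSpace V] [ChartedSpace (Fin n → ℂ) V]

/-- A function on `ℂ × V` in the coordinates `(τ, z)` given by a chart of `V`. -/
def inChart (Φ : ℂ → V → ℝ) (e : OpenPartialHomeomorph V (Fin n → ℂ)) :
    ℂ × (Fin n → ℂ) → ℝ :=
  fun p => Φ p.1 (e.symm p.2)

/-- The coefficient matrix of `Ω₀ + i∂∂̄Φ` in the coordinates `(τ, z)`. -/
def fullMatrix (ω : ConstantMetric n V) (Φ : ℂ → V → ℝ)
    (e : OpenPartialHomeomorph V (Fin n → ℂ)) (p : ℂ × (Fin n → ℂ)) :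
    Matrix (Fin (n + 1)) (Fin (n + 1)) ℂ :=
  pullbackCoeff (ω.coeff e) + Matrix.of fun i j =>
    dz (dzbar (fun q => ((inChart Φ e q : ℝ) : ℂ)) (productFrame n j)) (productFrame n i) p

/-- `Φ` is a solution, of class `C⁴` in `R × V` and continuous up to the boundary, of
`(Ω₀ + i∂∂̄Φ)^{n+1} = ε i dτ ∧ dτ̄ ∧ Ω₀ ∧ (Ω₀ + i∂∂̄Φ)^{n-1}` and `Ω₀ + i∂∂̄Φ > 0` in `R × V`,
`Φ = F` on `∂R × V`. -/
structure IsPerturbedSolution (R : Set ℂ) (ω : ConstantMetric n V) (ε : ℝ)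
    (F Φ : ℂ → V → ℝ) : Prop where
  contDiff : ∀ e ∈ atlas (Fin n → ℂ) V, ContDiffOn ℝ 4 (inChart Φ e) (R ×ˢ e.target)
  continuous : ContinuousOn (fun p : ℂ × V => Φ p.1 p.2) (closure R ×ˢ univ)
  posDef : ∀ e ∈ atlas (Fin n → ℂ) V, ∀ p ∈ R ×ˢ e.target, (fullMatrix ω Φ e p).PosDef
  equation : ∀ e ∈ atlas (Fin n → ℂ) V, ∀ p ∈ R ×ˢ e.target,
    wedgeCoeff (fun _ : Fin (n + 1) => fullMatrix ω Φ e p) =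
      (ε : ℂ) * wedgeCoeff (fun l : Fin (n + 1) =>
        if l.val = 0 then Matrix.single 0 0 1
        else if l.val = 1 then pullbackCoeff (ω.coeff e)
        else fullMatrix ω Φ e p)
  boundary : ∀ τ ∈ frontier R, ∀ x, Φ τ x = F τ x

/-- The continuity path: for every `σ ∈ [0,1]` the function `Ψ σ` is a solution with boundary
value `σF`, of class `C⁴` on `closure R × V`, and `σ ↦ Ψ σ` is continuous in the `C²` topology,
that is, in every chart all derivatives of order at most `2` depend continuously on `σ`,
uniformly on compact sets. -/
structure IsContinuityPath (R : Set ℂ) (ω : ConstantMetric n V) (ε : ℝ)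
    (F : ℂ → V → ℝ) (Ψ : ℝ → ℂ → V → ℝ) : Prop where
  solution : ∀ σ ∈ Icc (0 : ℝ) 1, IsPerturbedSolution R ω ε (fun τ x => σ * F τ x) (Ψ σ)
  contDiff : ∀ σ ∈ Icc (0 : ℝ) 1, ∀ e ∈ atlas (Fin n → ℂ) V,
    ContDiffOn ℝ 4 (inChart (Ψ σ) e) (closure R ×ˢ e.target)
  continuous : ∀ σ₀ ∈ Icc (0 : ℝ) 1, ∀ e ∈ atlas (Fin n → ℂ) V, ∀ C ⊆ e.target, IsCompact C →
    ∀ k : ℕ, k ≤ 2 →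
      TendstoUniformlyOn
        (fun σ p => iteratedFDerivWithin ℝ k (inChart (Ψ σ) e) (closure R ×ˢ e.target) p)
        (iteratedFDerivWithin ℝ k (inChart (Ψ σ₀) e) (closure R ×ˢ e.target))
        (𝓝[Icc (0 : ℝ) 1] σ₀) (closure R ×ˢ C)

end Problem

end

/-! Strict `(S, ω₀)`-convexity of `φ` amounts to positivity of a real quadratic form, `convexForm`:
b(ξ,ξ̄) - Re S(ξ,ξ) + D²φ(ξ,ξ)/2 (`strictlySOmegaConvex_iff`). It is affine in D²φ, and its
remaining coefficients are constant in each chart. The task is to bound it below on closure R × V by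
its values on the boundary.

The equation has a variational form. Let G be the matrix of Ω₀ + i∂∂̄Φ and A its block along V. The
equation reads det G / det A = r tr(b A⁻¹) with a constant r > 0. The left side is the minimum of G
on vectors (1, a), and -tr(b A⁻¹) is the minimum of a sum of quadratic functions built from A. So a
weighted sum of Levi forms with linear corrections has minimum 0 at every point
(`trialValue_of_equation`), and S does not enter it.

Minimum principle (`no_interior_min`): suppose `convexForm` on unit vectors, minus δ|τ|², has its
minimum at an interior point p in a direction ξ. Move p to p + sξ and let the optimal trial vectors
vary to first order in s. The weighted sum then exceeds its minimum by o(s²) only, so its second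
derivative at s = 0 cannot be positive. By symmetry of fourth derivatives
(`exists_hasSecondDerivAtZero_hess`) this second derivative is a sum of second derivatives of the
convexity form along the trial vectors, and these are nonnegative by minimality and strictly
positive in total because of δ. This is a contradiction.

The argument needs the minimum to be positive already, whence the continuity method in σ. At σ = 0
the solution is constant along V and the form is `constForm`, which is positive as soon as one
strictly convex function exists (`constForm_pos_of_strictlyConvex`). The boundary bound is uniform
in σ, so positivity propagates to σ = 1 (`IsContinuityPath.convexForm_pos`). The comparison
principle `IsPerturbedSolution.le` identifies any solution with the end of the path. -/

noncomputable section

/-! ### Second derivatives of functions of one variable -/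

/-- `g` is differentiable near `0`, and its derivative has derivative `c` at `0`. -/
def HasSecondDerivAtZero (g : ℝ → ℝ) (c : ℝ) : Prop :=
  ∃ g' : ℝ → ℝ, (∀ᶠ t in 𝓝 0, HasDerivAt g (g' t) t) ∧ HasDerivAt g' c 0

namespace HasSecondDerivAtZero

variable {g h : ℝ → ℝ} {c d : ℝ}

theorem add (hg : HasSecondDerivAtZero g c) (hh : HasSecondDerivAtZero h d) :
    HasSecondDerivAtZero (fun t => g t + h t) (c + d) := by
  obtain ⟨g', hg1, hg2⟩ := hg
  obtain ⟨h', hh1, hh2⟩ := hh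
  refine ⟨fun t => g' t + h' t, ?_, hg2.add hh2⟩
  filter_upwards [hg1, hh1] with t h1 h2 using h1.add h2

theorem const_mul (a : ℝ) (hg : HasSecondDerivAtZero g c) :
    HasSecondDerivAtZero (fun t => a * g t) (a * c) := by
  obtain ⟨g', hg1, hg2⟩ := hg
  refine ⟨fun t => a * g' t, ?_, hg2.const_mul a⟩
  filter_upwards [hg1] with t h1 using h1.const_mul a

theorem sub (hg : HasSecondDerivAtZero g c) (hh : HasSecondDerivAtZero h d) :
    HasSecondDerivAtZero (fun t => g t - h t) (c - d) := by
  simpa [sub_eq_add_neg] using hg.add (hh.const_mul (-1))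

theorem affine (a b : ℝ) : HasSecondDerivAtZero (fun t => a + t * b) 0 := by
  refine ⟨fun _ => b, Eventually.of_forall fun t => ?_, hasDerivAt_const _ _⟩
  simpa using ((hasDerivAt_id t).mul_const b).const_add a

theorem sq (a : ℝ) : HasSecondDerivAtZero (fun t => a * t ^ 2) (2 * a) := by
  refine ⟨fun t => 2 * a * t, Eventually.of_forall fun t => ?_, ?_⟩
  · have := (hasDerivAt_pow 2 t).const_mul a
    refine this.congr_deriv ?_
    push_cast
    ring
  · simpa using (hasDerivAt_id (0 : ℝ)).const_mul (2 * a)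

theorem sum {ι : Type*} (s : Finset ι) {g : ι → ℝ → ℝ} {c : ι → ℝ}
    (hg : ∀ i ∈ s, HasSecondDerivAtZero (g i) (c i)) :
    HasSecondDerivAtZero (fun t => ∑ i ∈ s, g i t) (∑ i ∈ s, c i) := by
  classical
  induction s using Finset.induction_on with
  | empty => simpa using affine 0 0
  | insert i s hi ih =>
    simp only [Finset.sum_insert hi]
    exact (hg i (Finset.mem_insert_self _ _)).add
      (ih fun j hj => hg j (Finset.mem_insert_of_mem hj))

/-- If `c < 0`, the second derivative test makes `0` a local maximum as well, so `g` is locally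
constant and `c = 0`. -/
theorem nonneg_of_isLocalMin (hg : HasSecondDerivAtZero g c) (hmin : IsLocalMin g 0) :
    0 ≤ c := by
  obtain ⟨g', hg1, hg2⟩ := hg
  by_contra! hc
  have hd : deriv g =ᶠ[𝓝 0] g' := hg1.mono fun t ht => ht.deriv
  have hdd : deriv (deriv g) 0 = c := by rw [hd.deriv_eq, hg2.deriv]
  have hmax : IsLocalMax g 0 :=
    isLocalMax_of_deriv_deriv_neg (hdd ▸ hc) hmin.deriv_eq_zero
      hg1.self_of_nhds.continuousAt
  have hconst : g =ᶠ[𝓝 0] fun _ => g 0 := by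
    filter_upwards [hmin, hmax] with t h1 h2 using le_antisymm h2 h1
  have h3 := hconst.deriv.deriv_eq
  simp [hdd] at h3
  exact hc.ne h3

end HasSecondDerivAtZero

/-! ### Second derivatives along lines of a Hessian evaluated at moving vectors. -/

section Quadratic

variable {E : Type*} [NormedAddCommGroup E] [NormedSpace ℝ E]

theorem hasDerivAt_bilin_line {T : ℝ → E →L[ℝ] E →L[ℝ] ℝ} {T' : E →L[ℝ] E →L[ℝ] ℝ} {t : ℝ}
    (hT : HasDerivAt T T' t) {x y : ℝ → E} {x' y' : E}
    (hx : HasDerivAt x x' t) (hy : HasDerivAt y y' t) :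
    HasDerivAt (fun t => T t (x t) (y t)) (T' (x t) (y t) + T t x' (y t) + T t (x t) y') t := by
  have h1 := (hT.clm_apply hx).clm_apply hy
  simpa using h1

theorem hasSecondDerivAtZero_quadratic {T T1 : ℝ → E →L[ℝ] E →L[ℝ] ℝ} {T2 : E →L[ℝ] E →L[ℝ] ℝ}
    (h1 : ∀ᶠ t in 𝓝 0, HasDerivAt T (T1 t) t) (h2 : HasDerivAt T1 T2 0) (x m : E) :
    HasSecondDerivAtZero (fun t => T t (x + t • m) (x + t • m))
      (T2 x x + 2 * (T1 0 m x + T1 0 x m) + 2 * T 0 m m) := by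
  have hx : ∀ t : ℝ, HasDerivAt (fun t : ℝ => x + t • m) m t := fun t => by
    simpa using ((hasDerivAt_id t).smul_const m).const_add x
  refine ⟨fun t => T1 t (x + t • m) (x + t • m) + T t m (x + t • m) + T t (x + t • m) m, ?_, ?_⟩
  · filter_upwards [h1] with t ht using hasDerivAt_bilin_line ht (hx t) (hx t)
  · have h3 := ((hasDerivAt_bilin_line h2 (hx 0) (hx 0)).add
      (hasDerivAt_bilin_line h1.self_of_nhds (hasDerivAt_const 0 m) (hx 0))).add
      (hasDerivAt_bilin_line h1.self_of_nhds (hx 0) (hasDerivAt_const 0 m))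
    refine h3.congr_deriv ?_
    simp
    ring

/-- The second derivative of a real function as a bilinear form. -/
def hess (f : E → ℝ) (p : E) : E →L[ℝ] E →L[ℝ] ℝ := fderiv ℝ (fderiv ℝ f) p

theorem ContDiffAt.hess {f : E → ℝ} {p : E} {m k : WithTop ℕ∞} (hf : ContDiffAt ℝ k f p)
    (hmk : m + 2 ≤ k) : ContDiffAt ℝ m (hess f) p := by
  have h1 : ContDiffAt ℝ (m + 1) (fderiv ℝ f) p :=
    hf.fderiv_right (by rw [add_assoc]; exact hmk)
  exact h1.fderiv_right le_rfl

theorem hess_symm {f : E → ℝ} {p : E} (hf : ContDiffAt ℝ 2 f p) (x y : E) :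
    hess f p x y = hess f p y x :=
  (hf.isSymmSndFDerivAt (by simp)).eq x y

theorem hasDerivAt_line_of_differentiableAt {F : Type*} [NormedAddCommGroup F] [NormedSpace ℝ F]
    {g : E → F} {p e : E} {t : ℝ} (hg : DifferentiableAt ℝ g (p + t • e)) :
    HasDerivAt (fun t : ℝ => g (p + t • e)) (fderiv ℝ g (p + t • e) e) t := by
  have hx : HasDerivAt (fun t : ℝ => p + t • e) e t := by
    simpa using ((hasDerivAt_id t).smul_const e).const_add p
  exact hg.hasFDerivAt.comp_hasDerivAt t hx

theorem tendsto_line (p e : E) : Tendsto (fun t : ℝ => p + t • e) (𝓝 0) (𝓝 p) := by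
  have : Continuous fun t : ℝ => p + t • e := by fun_prop
  simpa using this.tendsto 0

set_option synthInstance.maxHeartbeats 200000 in
set_option maxSynthPendingDepth 4 in
/-- The second derivative at `0` of `s ↦ D²f(p + sη)(e + sM, e + sM)` is unchanged when `e` and
`η` are exchanged: both equal `∂_s²∂_t²` of `f(p + te + sη + stM)` at the origin. -/
theorem exists_hasSecondDerivAtZero_hess {f : E → ℝ} {p : E} (hf : ContDiffAt ℝ 4 f p)
    (e η M : E) : ∃ c : ℝ,
      HasSecondDerivAtZero (fun s => hess f (p + s • η) (e + s • M) (e + s • M)) c ∧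
      HasSecondDerivAtZero (fun t => hess f (p + t • e) (η + t • M) (η + t • M)) c := by
  have hH : ContDiffAt ℝ 2 (hess f) p := hf.hess (by norm_num)
  have hH1 : ContDiffAt ℝ 1 (fderiv ℝ (hess f)) p := hH.fderiv_right (by norm_num)
  have hV : ContDiffAt ℝ 3 (fderiv ℝ f) p := hf.fderiv_right (by norm_num)
  have key : ∀ a b : E, HasSecondDerivAtZero
      (fun s => hess f (p + s • a) (b + s • M) (b + s • M))
      (fderiv ℝ (fderiv ℝ (hess f)) p a a b b +
        2 * (fderiv ℝ (hess f) p a M b + fderiv ℝ (hess f) p a b M) + 2 * hess f p M M) := by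
    intro a b
    have h1 : ∀ᶠ t in 𝓝 (0 : ℝ), HasDerivAt (fun t : ℝ => hess f (p + t • a))
        (fderiv ℝ (hess f) (p + t • a) a) t := by
      filter_upwards [(tendsto_line p a).eventually (hH.eventually (by simp))] with t ht
      exact hasDerivAt_line_of_differentiableAt (ht.differentiableAt (by simp))
    have h2 : HasDerivAt (fun t : ℝ => fderiv ℝ (hess f) (p + t • a) a)
        (fderiv ℝ (fderiv ℝ (hess f)) p a a) 0 := by
      have h3 : HasDerivAt (fun t : ℝ => fderiv ℝ (hess f) (p + t • a))
          (fderiv ℝ (fderiv ℝ (hess f)) (p + (0 : ℝ) • a) a) 0 :=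
        hasDerivAt_line_of_differentiableAt (by simpa using hH1.differentiableAt (by simp))
      simpa using h3.clm_apply (hasDerivAt_const 0 a)
    simpa using hasSecondDerivAtZero_quadratic h1 h2 b M
  -- symmetry of the third and fourth derivatives
  have s3 : ∀ᶠ q in 𝓝 p, ∀ x y z, fderiv ℝ (hess f) q x y z = fderiv ℝ (hess f) q y x z := by
    filter_upwards [hV.eventually (by simp)] with q hq x y z
    have := (hq.isSymmSndFDerivAt (by simp; norm_num)).eq x y
    exact congrArg (fun L : E →L[ℝ] ℝ => L z) this
  have s3' : ∀ᶠ q in 𝓝 p, ∀ x y z, fderiv ℝ (hess f) q x y z = fderiv ℝ (hess f) q x z y := by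
    filter_upwards [(hf.eventually (by simp)).eventually_nhds] with q hq x y z
    have hd : DifferentiableAt ℝ (hess f) q :=
      (hq.self_of_nhds.hess (m := 2) (by norm_num)).differentiableAt (by simp)
    have h1 : (fun r => hess f r y z) =ᶠ[𝓝 q] fun r => hess f r z y := by
      filter_upwards [hq] with r hr
      exact hess_symm (hr.of_le (by norm_num)) y z
    have h2 := congrArg (fun L : E →L[ℝ] ℝ => L x) h1.fderiv_eq
    simpa [fderiv_clm_apply, hd, hd.clm_apply] using h2
  have d4 : DifferentiableAt ℝ (fderiv ℝ (hess f)) p := hH1.differentiableAt (by simp)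
  have ev : ∀ w x y z, fderiv ℝ (fun r => fderiv ℝ (hess f) r x y z) p w =
      fderiv ℝ (fderiv ℝ (hess f)) p w x y z := by
    intro w x y z
    have h1 := ((d4.hasFDerivAt.clm_apply (hasFDerivAt_const x p)).clm_apply
      (hasFDerivAt_const y p)).clm_apply (hasFDerivAt_const z p)
    rw [h1.fderiv]
    simp
  have s4 : ∀ w x y z, fderiv ℝ (fderiv ℝ (hess f)) p w x y z =
      fderiv ℝ (fderiv ℝ (hess f)) p w y x z := by
    intro w x y z
    have h1 : (fun r => fderiv ℝ (hess f) r x y z) =ᶠ[𝓝 p] fun r => fderiv ℝ (hess f) r y x z := by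
      filter_upwards [s3] with r hr using hr x y z
    have h2 := congrArg (fun L : E →L[ℝ] ℝ => L w) h1.fderiv_eq
    rwa [ev, ev] at h2
  have s4' : ∀ w x y z, fderiv ℝ (fderiv ℝ (hess f)) p w x y z =
      fderiv ℝ (fderiv ℝ (hess f)) p w x z y := by
    intro w x y z
    have h1 : (fun r => fderiv ℝ (hess f) r x y z) =ᶠ[𝓝 p] fun r => fderiv ℝ (hess f) r x z y := by
      filter_upwards [s3'] with r hr using hr x y z
    have h2 := congrArg (fun L : E →L[ℝ] ℝ => L w) h1.fderiv_eq
    rwa [ev, ev] at h2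
  have s4'' : ∀ w x, fderiv ℝ (fderiv ℝ (hess f)) p w x = fderiv ℝ (fderiv ℝ (hess f)) p x w :=
    fun w x => (hH.isSymmSndFDerivAt (by simp)).eq w x
  -- The two expansions agree term by term: the fourth derivative at (η, η, e, e), the third at (η,
  -- e, M) and the second at (M, M) do not depend on the order of the arguments.
  refine ⟨_, key η e, ?_⟩
  convert key e η using 1
  have e3 := s3.self_of_nhds
  have e3' := s3'.self_of_nhds
  rw [e3 η e M, e3' η M e, e3 η e M, e3' e M η, s4 η η e e, s4' η e η e, s4'' η e, s4 e η e η]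

end Quadratic

end

noncomputable section

set_option synthInstance.maxHeartbeats 200000
set_option maxSynthPendingDepth 4

/-! ### Minimizers of quadratic functions depending on a parameter. -/

section Core

variable {E X : Type*} [NormedAddCommGroup E] [NormedSpace ℝ E]
  [NormedAddCommGroup X] [NormedSpace ℝ X] [FiniteDimensional ℝ X]

theorem exists_coercive (Q : X →L[ℝ] X →L[ℝ] ℝ) (hpos : ∀ x, x ≠ 0 → 0 < Q x x) :
    ∃ c > 0, ∀ x, c * ‖x‖ ^ 2 ≤ Q x x := by
  rcases subsingleton_or_nontrivial X with hX | hX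
  · exact ⟨1, one_pos, fun x => by simp [Subsingleton.elim x 0]⟩
  · have : ProperSpace X := FiniteDimensional.proper_real X
    obtain ⟨y, hy, hmin⟩ := (isCompact_sphere (0 : X) 1).exists_isMinOn
      (NormedSpace.sphere_nonempty.2 zero_le_one)
      (f := fun x => Q x x) (by fun_prop)
    have hy0 : y ≠ 0 := by
      rintro rfl
      simp at hy
    refine ⟨Q y y, hpos y hy0, fun x => ?_⟩
    rcases eq_or_ne x 0 with rfl | hx
    · simp
    have hn : ‖x‖ ≠ 0 := norm_ne_zero_iff.2 hx
    have h1 : (‖x‖⁻¹ • x) ∈ Metric.sphere (0 : X) 1 := by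
      simp [norm_smul, hn]
    have h2 := hmin h1
    simp only [mem_ofPred_eq, map_smul, smul_apply, smul_eq_mul] at h2
    have h3 := mul_le_mul_of_nonneg_right h2 (sq_nonneg ‖x‖)
    field_simp at h3
    exact h3

/-- The minimizer of a quadratic function depending differentiably on a parameter is
differentiable; the first order approximation of it is a minimizer up to `o(s²)`. -/
theorem exists_firstOrder_minimizer {Γ : ℝ → E →L[ℝ] E →L[ℝ] ℝ} {Γ1 : E →L[ℝ] E →L[ℝ] ℝ}
    (hΓ : HasDerivAt Γ Γ1 0) (hsymm : ∀ᶠ s in 𝓝 0, ∀ x y, Γ s x y = Γ s y x)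
    (J : X →L[ℝ] E) (hpos : ∀ x, x ≠ 0 → 0 < Γ 0 (J x) (J x)) (v : E) (ℓ : X →L[ℝ] ℝ) (x0 : X)
    (hmin : ∀ x, Γ 0 (v + J x0) (v + J x0) - ℓ x0 ≤ Γ 0 (v + J x) (v + J x) - ℓ x) :
    ∃ x1 : X, ∀ ε > 0, ∀ᶠ s in 𝓝 (0 : ℝ), ∀ x,
      Γ s (v + J (x0 + s • x1)) (v + J (x0 + s • x1)) - ℓ (x0 + s • x1) ≤
        Γ s (v + J x) (v + J x) - ℓ x + ε * s ^ 2 := by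
  obtain ⟨c, hc, hcoer⟩ := exists_coercive ((Γ 0).bilinearComp J J) (by simpa using hpos)
  simp only [ContinuousLinearMap.bilinearComp_apply] at hcoer
  -- the direction
  have hx1 : ∃ x1 : X, ∀ d, Γ 0 (J x1) (J d) = - Γ1 (v + J x0) (J d) := by
    let B : X →ₗ[ℝ] Module.Dual ℝ X := LinearMap.mk₂ ℝ (fun x y => Γ 0 (J x) (J y))
      (by intros; simp) (by intros; simp) (by intros; simp) (by intros; simp)
    have hinj : Function.Injective B := by
      rw [← LinearMap.ker_eq_bot, LinearMap.ker_eq_bot']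
      intro x hx
      by_contra h0
      have h1 := hpos x h0
      have h2 : B x x = 0 := by rw [hx]; rfl
      exact h1.ne' h2
    have hsurj : Function.Surjective B :=
      (LinearMap.injective_iff_surjective_of_finrank_eq_finrank
        (Subspace.dual_finrank_eq (K := ℝ) (V := X)).symm).1 hinj
    obtain ⟨x1, hx1⟩ := hsurj (-((Γ1 (v + J x0)).comp J : X →L[ℝ] ℝ).toLinearMap)
    refine ⟨x1, fun d => ?_⟩
    have h1 : B x1 d = -((Γ1 (v + J x0)).comp J : X →L[ℝ] ℝ) d :=
      congrArg (fun L : Module.Dual ℝ X => L d) hx1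
    exact h1
  obtain ⟨x1, hx1⟩ := hx1
  -- the gradient along the curve
  let g : ℝ → X →L[ℝ] ℝ := fun s => (2 : ℝ) • (Γ s ((v + J x0) + s • J x1)).comp J - ℓ
  have hs0 := hsymm.self_of_nhds
  -- First order condition for the minimizer `x0` at parameter `0`.
  have hg0 : g 0 = 0 := by
    ext d
    have hd : HasDerivAt
        (fun t : ℝ => Γ 0 ((v + J x0) + t • J d) ((v + J x0) + t • J d) - ℓ (x0 + t • d))
        (g 0 d) 0 := by
      have hl : HasDerivAt (fun t : ℝ => (v + J x0) + t • J d) (J d) 0 := by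
        simpa using ((hasDerivAt_id (0 : ℝ)).smul_const (J d)).const_add (v + J x0)
      have hl' : HasDerivAt (fun t : ℝ => x0 + t • d) d 0 := by
        simpa using ((hasDerivAt_id (0 : ℝ)).smul_const d).const_add x0
      have h1 := hasDerivAt_bilin_line (hasDerivAt_const (0 : ℝ) (Γ 0))
        hl hl
      have h2 := ℓ.hasFDerivAt.comp_hasDerivAt (0 : ℝ) hl'
      refine (h1.sub h2).congr_deriv ?_
      simp [g, hs0 (J d)]
      ring
    have hloc : IsLocalMin
        (fun t : ℝ => Γ 0 ((v + J x0) + t • J d) ((v + J x0) + t • J d) - ℓ (x0 + t • d)) 0 := by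
      refine Eventually.of_forall fun t => ?_
      have := hmin (x0 + t • d)
      simpa [add_assoc] using this
    exact hloc.hasDerivAt_eq_zero hd
  -- The equation defining `x1` says exactly that the gradient along the curve `x0 + s • x1` has
  -- zero derivative at `s = 0`.
  have hg1 : HasDerivAt g 0 0 := by
    have hl : HasDerivAt (fun s : ℝ => (v + J x0) + s • J x1) (J x1) 0 := by
      simpa using ((hasDerivAt_id (0 : ℝ)).smul_const (J x1)).const_add (v + J x0)
    have h1 := hΓ.clm_apply hl
    have h2 := (((ContinuousLinearMap.compL ℝ X E ℝ).flip J).hasFDerivAt.comp_hasDerivAt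
      (0 : ℝ) h1).const_smul (2 : ℝ)
    refine (h2.sub_const ℓ).congr_deriv ?_
    ext d
    have := hx1 d
    simp at this ⊢
    linarith
  refine ⟨x1, fun ε hε => ?_⟩
  -- The factor √(2cε) makes (c/2)‖d‖² - √(2cε)|s|‖d‖ + εs² a square divided by `2 * c`, hence
  -- nonnegative; c/2 is the coercivity that survives for small `s`.
  have hsmall : ∀ᶠ s in 𝓝 (0 : ℝ), ‖g s‖ ≤ √(2 * c * ε) * |s| := by
    have h1 := (hasDerivAt_iff_isLittleO.1 hg1).def (Real.sqrt_pos.2 (by positivity : 0 < 2 * c * ε))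
    filter_upwards [h1] with s hs
    simpa [hg0] using hs
  have hcoer' : ∀ᶠ s in 𝓝 (0 : ℝ), ∀ d, c / 2 * ‖d‖ ^ 2 ≤ Γ s (J d) (J d) := by
    have hη : 0 < c / 2 / (‖J‖ ^ 2 + 1) := by positivity
    filter_upwards [Metric.tendsto_nhds.1 hΓ.continuousAt.tendsto _ hη] with s hs d
    rw [dist_eq_norm] at hs
    have h2 := (Γ s - Γ 0).le_opNorm₂ (J d) (J d)
    have h3 : ‖Γ s - Γ 0‖ * ‖J d‖ * ‖J d‖ ≤
        c / 2 / (‖J‖ ^ 2 + 1) * (‖J‖ * ‖d‖) * (‖J‖ * ‖d‖) := by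
      gcongr
      exacts [J.le_opNorm d, J.le_opNorm d]
    have h4 := (abs_le.1 (h2.trans h3)).1
    have h5 : c / 2 / (‖J‖ ^ 2 + 1) * (‖J‖ * ‖d‖) * (‖J‖ * ‖d‖) ≤ c / 2 * ‖d‖ ^ 2 := by
      have : c / 2 / (‖J‖ ^ 2 + 1) * (‖J‖ * ‖d‖) * (‖J‖ * ‖d‖) =
          c / 2 * ‖d‖ ^ 2 * (‖J‖ ^ 2 / (‖J‖ ^ 2 + 1)) := by ring
      rw [this]
      refine mul_le_of_le_one_right (by positivity) ?_
      rw [div_le_one (by positivity)]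
      linarith
    have h6 : (Γ s - Γ 0) (J d) (J d) = Γ s (J d) (J d) - Γ 0 (J d) (J d) := rfl
    rw [h6] at h4
    linarith [hcoer d]
  filter_upwards [hsmall, hcoer', hsymm] with s h1 h2 h3 x
  set d := x - (x0 + s • x1) with hd
  have hx : v + J x = ((v + J x0) + s • J x1) + J d := by
    rw [hd]
    simp
    abel
  have hx' : v + J (x0 + s • x1) = (v + J x0) + s • J x1 := by
    simp [add_assoc]
  have hxl : ℓ x = ℓ (x0 + s • x1) + ℓ d := by
    rw [hd]
    simp
  set y := (v + J x0) + s • J x1 with hy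
  have hgd : g s d = 2 * Γ s y (J d) - ℓ d := by
    simp [g, hy]
    ring
  have h4 := (g s).le_opNorm d
  have h5 : ‖g s‖ * ‖d‖ ≤ √(2 * c * ε) * |s| * ‖d‖ := by gcongr
  have h6 := (abs_le.1 (h4.trans h5)).1
  have h7 : 0 ≤ (c * ‖d‖ - √(2 * c * ε) * |s|) ^ 2 := sq_nonneg _
  have h8 : √(2 * c * ε) ^ 2 = 2 * c * ε := Real.sq_sqrt (by positivity)
  have h9 : 0 ≤ c / 2 * ‖d‖ ^ 2 - √(2 * c * ε) * |s| * ‖d‖ + ε * s ^ 2 := by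
    have : (c * ‖d‖ - √(2 * c * ε) * |s|) ^ 2 =
        2 * c * (c / 2 * ‖d‖ ^ 2 - √(2 * c * ε) * |s| * ‖d‖ + ε * s ^ 2) := by
      rw [sub_sq, mul_pow, mul_pow, h8, sq_abs]
      ring
    rw [this] at h7
    exact nonneg_of_mul_nonneg_right h7 (by positivity)
  rw [hx, hx', hxl]
  have h10 : Γ s (y + J d) (y + J d) = Γ s y y + 2 * Γ s y (J d) + Γ s (J d) (J d) := by
    simp [h3 (J d) y]
    ring
  rw [h10]
  have := h2 d
  rw [hgd] at h6
  linarith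

end Core

/-! ### The local minimum principle. -/

section Local

variable {n : ℕ}

/-- Multiplication by `i` as a real linear map. -/
def mulI (n : ℕ) : (ℂ × (Fin n → ℂ)) →L[ℝ] (ℂ × (Fin n → ℂ)) :=
  (Complex.I • ContinuousLinearMap.id ℂ (ℂ × (Fin n → ℂ))).restrictScalars ℝ

@[simp] theorem mulI_apply (v : ℂ × (Fin n → ℂ)) : mulI n v = Complex.I • v := rfl

/-- The part of a real bilinear form that is invariant under multiplication by `i`; for the
second derivative of a function `f` its value on the diagonal at `v` is `∑ f_{jk̄} v_j v̄_k`. -/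
def leviForm (T : (ℂ × (Fin n → ℂ)) →L[ℝ] (ℂ × (Fin n → ℂ)) →L[ℝ] ℝ) :
    (ℂ × (Fin n → ℂ)) →L[ℝ] (ℂ × (Fin n → ℂ)) →L[ℝ] ℝ :=
  (1 / 4 : ℝ) • (T + T.bilinearComp (mulI n) (mulI n))

theorem leviForm_apply (T : (ℂ × (Fin n → ℂ)) →L[ℝ] (ℂ × (Fin n → ℂ)) →L[ℝ] ℝ)
    (v w : ℂ × (Fin n → ℂ)) :
    leviForm T v w = (1 / 4) * (T v w + T (Complex.I • v) (Complex.I • w)) := by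
  simp [leviForm]
  ring

/-- `leviForm` as a continuous linear map. -/
def leviL (n : ℕ) : ((ℂ × (Fin n → ℂ)) →L[ℝ] (ℂ × (Fin n → ℂ)) →L[ℝ] ℝ) →L[ℝ]
    ((ℂ × (Fin n → ℂ)) →L[ℝ] (ℂ × (Fin n → ℂ)) →L[ℝ] ℝ) :=
  let E := ℂ × (Fin n → ℂ)
  let P := (ContinuousLinearMap.compL ℝ E E (E →L[ℝ] ℝ)).flip (mulI n)
  let F : (E →L[ℝ] E →L[ℝ] ℝ) →L[ℝ] (E →L[ℝ] E →L[ℝ] ℝ) :=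
    (ContinuousLinearMap.flipₗᵢ ℝ E E ℝ).toContinuousLinearEquiv.toContinuousLinearMap
  (1 / 4 : ℝ) • (ContinuousLinearMap.id ℝ _ + F.comp (P.comp (F.comp P)))

/-- The weight has a linear term δbt with b = 2 Re(τ ē). Its cross term 4δb B(x,m) is absorbed by 2μ
B(m,m), using `B ≥ 0` on δb x + μ m, at the cost of 2δ²b² B(x,x)/μ; finally b² ≤ 4|τ|²|e|². The
hypothesis `hμ` makes the remaining factor positive. -/
theorem quadratic_weight_pos {X : Type*} [NormedAddCommGroup X] [NormedSpace ℝ X]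
    (B : X →L[ℝ] X →L[ℝ] ℝ) (hB : ∀ x y, B x y = B y x) (hBnn : ∀ x, 0 ≤ B x x)
    (τ e : ℂ) (μ δ : ℝ) (hδ : 0 < δ) (hμ : 4 * δ * ‖τ‖ ^ 2 < μ) (x m : X) :
    ∃ c : ℝ, HasSecondDerivAtZero
      (fun t => (μ + δ * (‖τ + t • e‖ ^ 2 - ‖τ‖ ^ 2)) * B (x + t • m) (x + t • m)) c ∧
      2 * δ * (1 - 4 * δ * ‖τ‖ ^ 2 / μ) * ‖e‖ ^ 2 * B x x ≤ c := by
  have hμ0 : 0 < μ := lt_of_le_of_lt (by positivity) hμ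
  set b : ℝ := 2 * (τ.re * e.re + τ.im * e.im) with hb
  have hexp : ∀ t : ℝ, ‖τ + t • e‖ ^ 2 - ‖τ‖ ^ 2 = b * t + ‖e‖ ^ 2 * t ^ 2 := by
    intro t
    simp only [Complex.sq_norm, Complex.normSq_apply, hb]
    simp
    ring
  refine ⟨2 * δ * ‖e‖ ^ 2 * B x x + 2 * (δ * b * B m x + δ * b * B x m) + 2 * μ * B m m, ?_, ?_⟩
  · have h1 : ∀ᶠ t in 𝓝 (0 : ℝ), HasDerivAt
        (fun t : ℝ => (μ + δ * (‖τ + t • e‖ ^ 2 - ‖τ‖ ^ 2)) • B)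
        ((δ * (b + 2 * ‖e‖ ^ 2 * t)) • B) t := by
      refine Eventually.of_forall fun t => ?_
      simp only [hexp]
      have h2 := ((((hasDerivAt_id t).const_mul b).add
        ((hasDerivAt_pow 2 t).const_mul (‖e‖ ^ 2))).const_mul δ).const_add μ
      refine (h2.smul_const B).congr_deriv ?_
      congr 1
      push_cast
      ring
    have h2 : HasDerivAt (fun t : ℝ => (δ * (b + 2 * ‖e‖ ^ 2 * t)) • B)
        ((δ * (2 * ‖e‖ ^ 2)) • B) 0 := by
      have h3 := (((hasDerivAt_id (0 : ℝ)).const_mul (2 * ‖e‖ ^ 2)).const_add b).const_mul δ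
      refine (h3.smul_const B).congr_deriv ?_
      simp [mul_comm]
    have h3 := hasSecondDerivAtZero_quadratic h1 h2 x m
    have h4 : 2 * δ * ‖e‖ ^ 2 * B x x + 2 * (δ * b * B m x + δ * b * B x m) + 2 * μ * B m m =
        δ * (2 * ‖e‖ ^ 2) * B x x + 2 * (δ * (b + 2 * ‖e‖ ^ 2 * 0) * B m x +
          δ * (b + 2 * ‖e‖ ^ 2 * 0) * B x m) +
        2 * ((μ + δ * (‖τ + (0 : ℝ) • e‖ ^ 2 - ‖τ‖ ^ 2)) * B m m) := by
      simp
      ring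
    rw [h4]
    exact h3
  · have hcs : b ^ 2 ≤ 4 * (‖τ‖ ^ 2 * ‖e‖ ^ 2) := by
      simp only [Complex.sq_norm, Complex.normSq_apply, hb]
      nlinarith [sq_nonneg (τ.re * e.im - τ.im * e.re)]
    have h1 := hBnn ((δ * b) • x + μ • m)
    simp only [map_add, map_smul, add_apply, smul_apply, smul_eq_mul, hB m x] at h1
    rw [hB m x]
    have h2 : 2 * δ * (1 - 4 * δ * ‖τ‖ ^ 2 / μ) * ‖e‖ ^ 2 * B x x =
        2 * δ * ‖e‖ ^ 2 * B x x - 2 * δ ^ 2 * (4 * (‖τ‖ ^ 2 * ‖e‖ ^ 2)) * B x x / μ := by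
      field_simp
    have h3 : 2 * δ ^ 2 * b ^ 2 * B x x / μ ≤
        2 * δ ^ 2 * (4 * (‖τ‖ ^ 2 * ‖e‖ ^ 2)) * B x x / μ := by
      have := hBnn x
      gcongr
    have h4 : 0 ≤ 4 * (δ * b) * B x m + 2 * μ * B m m + 2 * δ ^ 2 * b ^ 2 * B x x / μ := by
      have h5 : 4 * (δ * b) * B x m + 2 * μ * B m m + 2 * δ ^ 2 * b ^ 2 * B x x / μ =
        2 / μ * (δ * b * (δ * b * B x x + μ * B x m) + μ * (δ * b * B x m + μ * B m m)) := by
        field_simp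
        ring
      rw [h5]
      refine mul_nonneg (by positivity) ?_
      linarith
    rw [h2]
    linarith

/-- Local form of the minimum principle. The functions `x ↦ ∑ w_k (L_p(v_k + x_k) - ℓ_k(x_k))`,
where `L_p` is the Levi form of `f` at `p`, have a minimum `κ` that does not depend on `p`. Then the
smallest value of `D²f + T₀` on the unit sphere `{B = 1}` in the directions of `X`, minus
`δ|τ|²`, has no positive local minimum. -/
theorem no_interior_min {K : Type*} [Fintype K] {f : ℂ × (Fin n → ℂ) → ℝ}
    {p : ℂ × (Fin n → ℂ)} (hf : ContDiffAt ℝ 4 f p)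
    (T0 : (ℂ × (Fin n → ℂ)) →L[ℝ] (ℂ × (Fin n → ℂ)) →L[ℝ] ℝ) (hT0 : ∀ x y, T0 x y = T0 y x)
    (w : K → ℝ) (hw : ∀ k, 0 < w k) (v : K → ℂ × (Fin n → ℂ)) (ℓ : K → (Fin n → ℂ) →L[ℝ] ℝ)
    (κ : ℝ)
    (hge : ∀ᶠ q in 𝓝 p, ∀ x : K → Fin n → ℂ,
      κ ≤ ∑ k, w k * (leviForm (hess f q + T0) (v k + (0, x k)) (v k + (0, x k)) - ℓ k (x k)))
    (hex : ∀ᶠ q in 𝓝 p, ∃ x : K → Fin n → ℂ,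
      ∑ k, w k * (leviForm (hess f q + T0) (v k + (0, x k)) (v k + (0, x k)) - ℓ k (x k)) = κ)
    (hpos : ∀ x : Fin n → ℂ, x ≠ 0 → 0 < leviForm (hess f p + T0) (0, x) (0, x))
    (hv : ∃ k, (v k).1 ≠ 0)
    (B : (Fin n → ℂ) →L[ℝ] (Fin n → ℂ) →L[ℝ] ℝ) (hB : ∀ x y, B x y = B y x)
    (hBnn : ∀ x, 0 ≤ B x x) (ξ : Fin n → ℂ) (hξ : 0 < B ξ ξ) (μ δ : ℝ) (hδ : 0 < δ)
    (hμ : 4 * δ * ‖p.1‖ ^ 2 < μ)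
    (hW : ∀ᶠ q in 𝓝 p, ∀ x : Fin n → ℂ,
      (μ + δ * (‖q.1‖ ^ 2 - ‖p.1‖ ^ 2)) * B x x ≤ (hess f q + T0) (0, x) (0, x))
    (heq : (hess f p + T0) (0, ξ) (0, ξ) = μ * B ξ ξ) : False := by
  set J : (Fin n → ℂ) →L[ℝ] ℂ × (Fin n → ℂ) := ContinuousLinearMap.inr ℝ ℂ (Fin n → ℂ) with hJ
  have hJa : ∀ x, J x = (0, x) := fun x => rfl
  set η : ℂ × (Fin n → ℂ) := (0, ξ) with hη
  let Γ : ℝ → (ℂ × (Fin n → ℂ)) →L[ℝ] (ℂ × (Fin n → ℂ)) →L[ℝ] ℝ :=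
    fun s => leviForm (hess f (p + s • η) + T0)
  have hΓ0 : Γ 0 = leviForm (hess f p + T0) := by simp [Γ]
  have hline := tendsto_line p η
  obtain ⟨Γ1, hΓ1⟩ : ∃ Γ1, HasDerivAt Γ Γ1 0 := by
    have h1 : DifferentiableAt ℝ (hess f) p :=
      (hf.hess (m := 2) (by norm_num)).differentiableAt (by simp)
    have h2 : DifferentiableAt ℝ (fun s : ℝ => hess f (p + s • η)) 0 :=
      (hasDerivAt_line_of_differentiableAt (t := 0) (by simpa using h1)).differentiableAt
    have h3 : HasDerivAt (fun s : ℝ => (leviL n) (hess f (p + s • η) + T0)) _ 0 :=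
      (leviL n).hasFDerivAt.comp_hasDerivAt (0 : ℝ) (h2.hasDerivAt.add_const T0)
    exact ⟨_, h3⟩
  have hsymm : ∀ᶠ s in 𝓝 (0 : ℝ), ∀ x y, Γ s x y = Γ s y x := by
    filter_upwards [hline.eventually (hf.eventually (by simp))] with s hs x y
    have h1 := hess_symm (hs.of_le (by norm_num : (2 : WithTop ℕ∞) ≤ 4))
    simp only [Γ, leviForm_apply, add_apply]
    rw [h1 x y, hT0 x y, h1 (Complex.I • x), hT0 (Complex.I • x)]
  obtain ⟨x0, hx0⟩ := hex.self_of_nhds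
  have hge0 := hge.self_of_nhds
  -- The minimum of the sum is attained at `x0`; changing one component at a time, and dividing by
  -- the positive weight, shows that each `x0 k` minimizes its own summand.
  have hterm : ∀ k x, Γ 0 (v k + J (x0 k)) (v k + J (x0 k)) - ℓ k (x0 k) ≤
      Γ 0 (v k + J x) (v k + J x) - ℓ k x := by
    classical
    intro k x
    have h1 := hge0 (Function.update x0 k x)
    rw [← hx0, ← sub_nonneg, ← Finset.sum_sub_distrib,
      Finset.sum_eq_single k (fun j _ hj => by simp [Function.update_of_ne hj])
        (fun h => absurd (Finset.mem_univ k) h)] at h1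
    simp only [Function.update_self, ← mul_sub] at h1
    have h2 := nonneg_of_mul_nonneg_right h1 (hw k)
    rw [hΓ0]
    simpa [hJa] using h2
  choose x1 hx1 using fun k => exists_firstOrder_minimizer hΓ1 hsymm J
    (fun x hx => by rw [hΓ0]; exact hpos x hx) (v k) (ℓ k) (x0 k) (hterm k)
  -- the function `N`
  let N : ℝ → ℝ := fun s => ∑ k, w k *
    (Γ s (v k + J (x0 k + s • x1 k)) (v k + J (x0 k + s • x1 k)) - ℓ k (x0 k + s • x1 k))
  have hN0 : N 0 = κ := by
    simp only [N, hΓ0]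
    simpa [hJa] using hx0
  -- At `p + s • η` the minimum is again `κ`, attained at some `x`; the first order approximations
  -- lose at most an arbitrarily small multiple of s².
  have hNle : ∀ ε > 0, ∀ᶠ s in 𝓝 (0 : ℝ), N s ≤ κ + ε * s ^ 2 := by
    intro ε hε
    set W := ∑ k, w k with hWdef
    have hWnn : 0 ≤ W := Finset.sum_nonneg fun k _ => (hw k).le
    have hε' : 0 < ε / (W + 1) := by positivity
    filter_upwards [eventually_all.2 fun k => hx1 k _ hε', hline.eventually hex] with s h1 ⟨x, hx⟩
    have h2 : N s ≤ ∑ k, (w k * (Γ s (v k + J (x k)) (v k + J (x k)) - ℓ k (x k)) +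
        w k * (ε / (W + 1) * s ^ 2)) := by
      refine Finset.sum_le_sum fun k _ => ?_
      rw [← mul_add]
      exact mul_le_mul_of_nonneg_left (h1 k (x k)) (hw k).le
    rw [Finset.sum_add_distrib, ← Finset.sum_mul] at h2
    have h3 : ∑ k, w k * (Γ s (v k + J (x k)) (v k + J (x k)) - ℓ k (x k)) = κ := hx
    have h4 : W * (ε / (W + 1) * s ^ 2) ≤ ε * s ^ 2 := by
      have : W * (ε / (W + 1) * s ^ 2) = ε * s ^ 2 * (W / (W + 1)) := by ring
      rw [this]
      refine mul_le_of_le_one_right (by positivity) ?_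
      rw [div_le_one (by positivity)]
      linarith
    linarith
  -- second derivatives along each direction
  have hμ0 : 0 < μ := lt_of_le_of_lt (by positivity) hμ
  have hfac : 0 < 2 * δ * (1 - 4 * δ * ‖p.1‖ ^ 2 / μ) := by
    refine mul_pos (by positivity) (sub_pos.2 ?_)
    rwa [div_lt_one hμ0]
  have hdir : ∀ (e : ℂ × (Fin n → ℂ)) (m : Fin n → ℂ), ∃ c : ℝ,
      HasSecondDerivAtZero
        (fun s => (hess f (p + s • η) + T0) (e + s • J m) (e + s • J m)) c ∧
      2 * δ * (1 - 4 * δ * ‖p.1‖ ^ 2 / μ) * ‖e.1‖ ^ 2 * B ξ ξ ≤ c := by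
    intro e m
    -- The exchange of `e` and `η`: the derivative in `s` along η becomes one in `t` along `e` of
    -- the form at `η + t • J m`. This vector stays in the directions of `X`, so that `hW` applies
    -- and gives a local minimum at `t = 0`.
    obtain ⟨c, hc1, hc2⟩ := exists_hasSecondDerivAtZero_hess hf e η (J m)
    obtain ⟨d, hd1, hd2⟩ := quadratic_weight_pos B hB hBnn p.1 e.1 μ δ hδ hμ ξ m
    have hT : ∀ a, HasSecondDerivAtZero (fun s => T0 (a + s • J m) (a + s • J m))
        (2 * T0 (J m) (J m)) := fun a => by
      simpa using hasSecondDerivAtZero_quadratic (T := fun _ => T0) (T1 := fun _ => 0) (T2 := 0)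
        (Eventually.of_forall fun t => hasDerivAt_const t T0) (hasDerivAt_const _ _) a (J m)
    refine ⟨c + 2 * T0 (J m) (J m), hc1.add (hT e), hd2.trans ?_⟩
    have h1 := (hc2.add (hT η)).sub hd1
    have h2 : IsLocalMin (fun t : ℝ => hess f (p + t • e) (η + t • J m) (η + t • J m) +
        T0 (η + t • J m) (η + t • J m) - (μ + δ * (‖p.1 + t • e.1‖ ^ 2 - ‖p.1‖ ^ 2)) *
          B (ξ + t • m) (ξ + t • m)) 0 := by
      filter_upwards [(tendsto_line p e).eventually hW] with t ht
      have h3 := ht (ξ + t • m)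
      have h4 : ((0, ξ + t • m) : ℂ × (Fin n → ℂ)) = η + t • J m := by
        simp [hη, hJa]
      rw [h4] at h3
      have h5 : (hess f p) η η + T0 η η = μ * B ξ ξ := heq
      have h6 : (μ + δ * (‖p.1 + t • e.1‖ ^ 2 - ‖p.1‖ ^ 2)) * B (ξ + t • m) (ξ + t • m) ≤
        hess f (p + t • e) (η + t • J m) (η + t • J m) + T0 (η + t • J m) (η + t • J m) := h3
      simp only [zero_smul, add_zero]
      rw [h5, sub_self, mul_zero, add_zero, sub_self]
      linarith
    have h3 := h1.nonneg_of_isLocalMin h2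
    linarith
  choose c hc1 hc2 using hdir
  -- The Levi form averages the Hessian over a vector and its multiple by `i`, so `hdir` is used for
  -- both; the linear terms `ℓ k` are affine in `s` and contribute `0`.
  have hNd : HasSecondDerivAtZero N (∑ k, w k * ((1 / 4) *
      (c (v k + J (x0 k)) (x1 k) +
        c (Complex.I • (v k + J (x0 k))) (Complex.I • x1 k)) - 0)) := by
    refine HasSecondDerivAtZero.sum _ fun k _ => ?_
    have h1 := ((((hc1 (v k + J (x0 k)) (x1 k)).add
      (hc1 (Complex.I • (v k + J (x0 k))) (Complex.I • x1 k))).const_mul (1 / 4)).sub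
      (HasSecondDerivAtZero.affine (ℓ k (x0 k)) (ℓ k (x1 k)))).const_mul (w k)
    convert h1 using 2 with s
    have h2 : v k + J (x0 k + s • x1 k) = v k + J (x0 k) + s • J (x1 k) := by
      simp [add_assoc]
    have h3 : Complex.I • (v k + J (x0 k) + s • J (x1 k)) =
        Complex.I • (v k + J (x0 k)) + s • J (Complex.I • x1 k) := by
      rw [smul_add, smul_comm, hJa (Complex.I • x1 k), hJa (x1 k)]
      simp
    simp only [Γ, leviForm_apply]
    rw [h2, h3]
    simp
  have hpos' : 0 < ∑ k, w k * ((1 / 4) *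
      (c (v k + J (x0 k)) (x1 k) +
        c (Complex.I • (v k + J (x0 k))) (Complex.I • x1 k)) - 0) := by
    have hc0 : ∀ e m, 0 ≤ c e m := fun e m =>
      le_trans (by positivity) (hc2 e m)
    obtain ⟨k, hk⟩ := hv
    refine Finset.sum_pos' (fun j _ => ?_) ⟨k, Finset.mem_univ k, ?_⟩
    · have := hc0 (v j + J (x0 j)) (x1 j)
      have := hc0 (Complex.I • (v j + J (x0 j))) (Complex.I • x1 j)
      have := (hw j).le
      rw [sub_zero]
      positivity
    · have h1 : 0 < c (v k + J (x0 k)) (x1 k) := by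
        refine lt_of_lt_of_le ?_ (hc2 _ _)
        have : 0 < ‖(v k + J (x0 k)).1‖ := by simpa [hJa] using hk
        positivity
      have := hc0 (Complex.I • (v k + J (x0 k))) (Complex.I • x1 k)
      have := hw k
      rw [sub_zero]
      positivity
  set C := ∑ k, w k * ((1 / 4) *
      (c (v k + J (x0 k)) (x1 k) +
        c (Complex.I • (v k + J (x0 k))) (Complex.I • x1 k)) - 0) with hC
  -- With C = N''(0) > 0, the bound N ≤ κ + (C/4)s² makes (C/4)s² - N minimal at `0`, although its
  -- second derivative there is C/2 - C < 0.
  have h1 := (HasSecondDerivAtZero.sq (C / 4)).sub hNd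
  have h2 : IsLocalMin (fun s : ℝ => C / 4 * s ^ 2 - N s) 0 := by
    filter_upwards [hNle (C / 4) (by positivity)] with s hs
    simp only [hN0]
    linarith
  have h3 := h1.nonneg_of_isLocalMin h2
  linarith

end Local

end

noncomputable section

/-! ### Sesquilinear and bilinear forms of complex matrices. -/

section Forms

open Matrix

variable {ι : Type*} [Fintype ι]

/-- The sesquilinear form `∑ v_i M_{ij} conj(w_j)`. -/
def hForm (M : Matrix ι ι ℂ) (v w : ι → ℂ) : ℂ := v ⬝ᵥ M *ᵥ star w

/-- The bilinear form `∑ v_i M_{ij} w_j`. -/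
def sForm (M : Matrix ι ι ℂ) (v w : ι → ℂ) : ℂ := v ⬝ᵥ M *ᵥ w

theorem hForm_add_left (M : Matrix ι ι ℂ) (u v w : ι → ℂ) :
    hForm M (u + v) w = hForm M u w + hForm M v w := by simp [hForm, add_dotProduct]

theorem hForm_add_right (M : Matrix ι ι ℂ) (u v w : ι → ℂ) :
    hForm M u (v + w) = hForm M u v + hForm M u w := by
  simp [hForm, mulVec_add, dotProduct_add]

theorem hForm_smul_left (M : Matrix ι ι ℂ) (c : ℂ) (v w : ι → ℂ) :
    hForm M (c • v) w = c * hForm M v w := by simp [hForm]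

theorem hForm_smul_right (M : Matrix ι ι ℂ) (c : ℂ) (v w : ι → ℂ) :
    hForm M v (c • w) = star c * hForm M v w := by simp [hForm, mulVec_smul]

theorem hForm_add_matrix (M N : Matrix ι ι ℂ) (v w : ι → ℂ) :
    hForm (M + N) v w = hForm M v w + hForm N v w := by
  simp [hForm, add_mulVec, dotProduct_add]

theorem sForm_add_left (M : Matrix ι ι ℂ) (u v w : ι → ℂ) :
    sForm M (u + v) w = sForm M u w + sForm M v w := by simp [sForm, add_dotProduct]

theorem sForm_add_right (M : Matrix ι ι ℂ) (u v w : ι → ℂ) :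
    sForm M u (v + w) = sForm M u v + sForm M u w := by
  simp [sForm, mulVec_add, dotProduct_add]

theorem sForm_smul_left (M : Matrix ι ι ℂ) (c : ℂ) (v w : ι → ℂ) :
    sForm M (c • v) w = c * sForm M v w := by simp [sForm]

theorem sForm_smul_right (M : Matrix ι ι ℂ) (c : ℂ) (v w : ι → ℂ) :
    sForm M v (c • w) = c * sForm M v w := by simp [sForm, mulVec_smul]

theorem sForm_sub_matrix (M N : Matrix ι ι ℂ) (v w : ι → ℂ) :
    sForm (M - N) v w = sForm M v w - sForm N v w := by
  simp [sForm, sub_mulVec, dotProduct_sub]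

theorem sForm_comm {M : Matrix ι ι ℂ} (hM : M.IsSymm) (v w : ι → ℂ) :
    sForm M v w = sForm M w v := by
  rw [sForm, dotProduct_mulVec, ← mulVec_transpose, hM.eq, dotProduct_comm, sForm]

theorem star_hForm {M : Matrix ι ι ℂ} (hM : M.IsHermitian) (v w : ι → ℂ) :
    star (hForm M v w) = hForm M w v := by
  rw [hForm, ← star_dotProduct_star, star_mulVec, star_star, hM.eq, ← dotProduct_mulVec, hForm]

theorem re_hForm_comm {M : Matrix ι ι ℂ} (hM : M.IsHermitian) (v w : ι → ℂ) :
    (hForm M v w).re = (hForm M w v).re := by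
  rw [← star_hForm hM w v]
  simp

theorem hForm_self_im {M : Matrix ι ι ℂ} (hM : M.IsHermitian) (v : ι → ℂ) :
    (hForm M v v).im = 0 := by
  have := congrArg Complex.im (star_hForm hM v v)
  simp at this
  linarith

/-- `hForm` conjugates its second argument, whereas `PosDef` conjugates the first vector; the two
conditions correspond under `v ↦ star v`. -/
theorem posDef_iff_hForm {M : Matrix ι ι ℂ} :
    M.PosDef ↔ M.IsHermitian ∧ ∀ v, v ≠ 0 → 0 < (hForm M v v).re := by
  rw [posDef_iff_dotProduct_mulVec]
  refine and_congr_right fun hM => ⟨fun h v hv => ?_, fun h v hv => ?_⟩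
  · have := h (x := star v) (by simpa using hv)
    rw [star_star] at this
    exact (Complex.pos_iff.1 this).1
  · have h1 := h (star v) (by simpa using hv)
    have h2 := hForm_self_im hM (star v)
    rw [hForm, star_star] at h1 h2
    exact Complex.pos_iff.2 ⟨h1, h2.symm⟩

theorem Matrix.PosDef.hForm_nonneg {M : Matrix ι ι ℂ} (hM : M.PosDef) (v : ι → ℂ) :
    0 ≤ (hForm M v v).re := by
  rcases eq_or_ne v 0 with rfl | hv
  · simp [hForm]
  · exact ((posDef_iff_hForm.1 hM).2 v hv).le

theorem map_conj_mulVec_star (M : Matrix ι ι ℂ) (v : ι → ℂ) :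
    M.map (starRingEnd ℂ) *ᵥ star v = star (M *ᵥ v) := by
  ext i
  simp [mulVec, dotProduct]

theorem eq_zero_of_re_dotProduct {u : ι → ℂ} (h : ∀ v : ι → ℂ, (v ⬝ᵥ u).re = 0) : u = 0 := by
  have h1 := h (star u)
  have h2 : (star u ⬝ᵥ u).im = 0 := by
    have := dotProduct_star_self_nonneg (star u)
    rw [star_star] at this
    rw [dotProduct_comm]
    exact (Complex.nonneg_iff.1 this).2.symm
  have h3 : star u ⬝ᵥ u = 0 := Complex.ext h1 h2
  exact dotProduct_star_self_eq_zero.1 h3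

/-- A quadratic function on a line that is nonnegative and vanishes at `0` has no linear term. -/
theorem linear_coeff_eq_zero {a b : ℝ} (h : ∀ t : ℝ, 0 ≤ a * t + b * t ^ 2) : a = 0 := by
  by_contra ha
  rcases le_or_gt b 0 with hb | hb
  · have h1 := h (-a)
    have : 0 < a ^ 2 := by positivity
    nlinarith
  · have h1 := h (-a / (2 * b))
    have h2 : a * (-a / (2 * b)) + b * (-a / (2 * b)) ^ 2 = -(a ^ 2 / (4 * b)) := by
      field_simp
      ring
    rw [h2] at h1
    have : 0 < a ^ 2 / (4 * b) := by positivity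
    linarith

end Forms

/-! ### Eigenvalues of K_S and positivity of a real quadratic form. -/

section Eigenvalues

open Matrix

variable {n : ℕ}

theorem mem_spectrum_iff_exists_mulVec {K : Matrix (Fin n) (Fin n) ℂ} {k : ℂ} :
    k ∈ spectrum ℂ K ↔ ∃ w, w ≠ 0 ∧ K *ᵥ w = k • w := by
  rw [spectrum.mem_iff, isUnit_iff_isUnit_det, isUnit_iff_ne_zero, not_not,
    ← exists_mulVec_eq_zero_iff]
  refine exists_congr fun w => and_congr_right fun _ => ?_
  rw [sub_mulVec, sub_eq_zero, Algebra.algebraMap_eq_smul_one, smul_mulVec, one_mulVec, eq_comm]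

theorem finite_spectrum_re (K : Matrix (Fin n) (Fin n) ℂ) : (Complex.re '' spectrum ℂ K).Finite :=
  (Matrix.finite_spectrum K).image _

/-- Let -μ be the minimum of Re C(x,x) / A(x,x). If the form is not positive at `v`, then μ ≥ 1. The
minimizer `y` satisfies C y = -μ A ȳ, and applying this relation twice shows that A ȳ is an
eigenvector of K with eigenvalue μ² ≥ 1. -/
theorem convexForm_pos_of_maxEigenvalue {A C : Matrix (Fin n) (Fin n) ℂ} (hA : A.PosDef)
    (hC : C.IsSymm)
    (hK : maxEigenvalue (C * (A⁻¹).map (starRingEnd ℂ) * C.map (starRingEnd ℂ) * A⁻¹) < 1)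
    (v : Fin n → ℂ) (hv : v ≠ 0) : 0 < (hForm A v v).re + (sForm C v v).re := by
  obtain ⟨hAh, hApos⟩ := posDef_iff_hForm.1 hA
  by_contra! hneg
  have hcontH : Continuous fun x : Fin n → ℂ => (hForm A x x).re := by
    unfold hForm
    simp only [dotProduct, mulVec]
    fun_prop
  have hcontS : Continuous fun x : Fin n → ℂ => (sForm C x x).re := by
    unfold sForm
    simp only [dotProduct, mulVec]
    fun_prop
  have hS0 : ∀ x ∈ Metric.sphere (0 : Fin n → ℂ) 1, x ≠ 0 := by
    rintro x hx rfl
    simp at hx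
  have hscale : ∀ (t : ℝ) (x : Fin n → ℂ), (hForm A ((t : ℂ) • x) ((t : ℂ) • x)).re =
      t ^ 2 * (hForm A x x).re ∧ (sForm C ((t : ℂ) • x) ((t : ℂ) • x)).re =
      t ^ 2 * (sForm C x x).re := by
    intro t x
    rw [hForm_smul_left, hForm_smul_right, sForm_smul_left, sForm_smul_right]
    constructor <;> simp <;> ring
  obtain ⟨y, hy, hmin⟩ := (isCompact_sphere (0 : Fin n → ℂ) 1).exists_isMinOn
    ⟨((‖v‖⁻¹ : ℝ) : ℂ) • v, by simp [norm_smul, hv]⟩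
    (f := fun x => (sForm C x x).re / (hForm A x x).re)
    (hcontS.continuousOn.div hcontH.continuousOn fun x hx => (hApos x (hS0 x hx)).ne')
  set μ : ℝ := -((sForm C y y).re / (hForm A y y).re) with hμ
  have hy0 := hS0 y hy
  have hyA := hApos y hy0
  have hq : ∀ x, 0 ≤ μ * (hForm A x x).re + (sForm C x x).re := by
    intro x
    rcases eq_or_ne x 0 with rfl | hx
    · simp [hForm, sForm]
    · have h1 := hmin (show ((‖x‖⁻¹ : ℝ) : ℂ) • x ∈ Metric.sphere (0 : Fin n → ℂ) 1 by
        simp [norm_smul, hx])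
      simp only [mem_ofPred_eq] at h1
      rw [(hscale _ x).1, (hscale _ x).2, mul_div_mul_left _ _ (by simp [hx])] at h1
      have h2 := (le_div_iff₀ (hApos x hx)).1 h1
      simp only [hμ]
      linarith
  have hq0 : μ * (hForm A y y).re + (sForm C y y).re = 0 := by
    rw [hμ]
    field_simp
    ring
  have hμ1 : 1 ≤ μ := by
    by_contra! h
    have h1 := hq v
    have h2 := hApos v hv
    nlinarith
  -- Euler-Lagrange equation: the nonnegative form μ A + Re C vanishes at `y`, so its polarization
  -- with `y` vanishes in every direction.
  have hlin : C *ᵥ y + (μ : ℂ) • (A *ᵥ star y) = 0 := by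
    refine eq_zero_of_re_dotProduct fun h => ?_
    have h1 : (h ⬝ᵥ (C *ᵥ y + (μ : ℂ) • (A *ᵥ star y))).re =
        (sForm C h y).re + μ * (hForm A h y).re := by
      simp [sForm, hForm, dotProduct_add]
    rw [h1]
    have h2 : 2 * ((sForm C h y).re + μ * (hForm A h y).re) = 0 := by
      refine linear_coeff_eq_zero (b := μ * (hForm A h h).re + (sForm C h h).re) fun t => ?_
      have h3 := hq (y + (t : ℂ) • h)
      have h4 := hscale t h
      simp only [hForm_add_left, hForm_add_right, sForm_add_left, sForm_add_right,
        Complex.add_re, h4.1, h4.2] at h3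
      rw [re_hForm_comm hAh y ((t : ℂ) • h), sForm_comm hC y ((t : ℂ) • h), hForm_smul_left,
        sForm_smul_left] at h3
      simp only [Complex.re_ofReal_mul] at h3
      nlinarith
    linarith
  have hC1 : C *ᵥ y = -((μ : ℂ) • (A *ᵥ star y)) := eq_neg_of_add_eq_zero_left hlin
  have hdet : IsUnit A.det := (isUnit_iff_isUnit_det A).1 hA.isUnit
  have hcanc : ∀ x, A⁻¹ *ᵥ (A *ᵥ x) = x := fun x => by
    rw [mulVec_mulVec, nonsing_inv_mul _ hdet, one_mulVec]
  have hmem : ((μ ^ 2 : ℝ) : ℂ) ∈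
      spectrum ℂ (C * (A⁻¹).map (starRingEnd ℂ) * C.map (starRingEnd ℂ) * A⁻¹) := by
    rw [mem_spectrum_iff_exists_mulVec]
    refine ⟨A *ᵥ star y, fun h => hy0 ?_, ?_⟩
    · have := hcanc (star y)
      rw [h, mulVec_zero] at this
      simpa using this.symm
    · rw [← mulVec_mulVec, ← mulVec_mulVec, ← mulVec_mulVec, hcanc, map_conj_mulVec_star, hC1,
        map_conj_mulVec_star, mulVec_neg, mulVec_smul, hcanc, star_neg, star_smul, star_star,
        mulVec_neg, mulVec_smul, hC1]
      simp only [smul_neg, neg_neg, smul_smul, pow_two, Complex.ofReal_mul]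
      simp
  have h1 := le_csSup (finite_spectrum_re _).bddAbove (mem_image_of_mem Complex.re hmem)
  rw [Complex.ofReal_re] at h1
  have h2 : (1 : ℝ) ≤ μ ^ 2 := one_le_pow₀ hμ1
  exact absurd hK (not_lt.2 (h2.trans h1))

/-- Adding the inequalities for `v` and `i v` cancels the bilinear part, which changes sign. -/
theorem posDef_of_convexForm_pos {A C : Matrix (Fin n) (Fin n) ℂ} (hA : A.IsHermitian)
    (hpos : ∀ v, v ≠ 0 → 0 < (hForm A v v).re + (sForm C v v).re) : A.PosDef := by
  refine posDef_iff_hForm.2 ⟨hA, fun v hv => ?_⟩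
  have h1 := hpos v hv
  have h2 := hpos (Complex.I • v) (by simpa using hv)
  rw [hForm_smul_left, hForm_smul_right, sForm_smul_left, sForm_smul_right, ← mul_assoc,
    ← mul_assoc] at h2
  simp at h2
  linarith

/-- For an eigenvector `w` with eigenvalue `k` define `v`, `y` by A v̄ = w and A ȳ = C v; then C y =
k A v̄ and A(y,y) = k A(v,v), so `k` is real. If k ≥ 1, put s = k^(-1/2) and add the inequalities
for i(v + s y) and v - s y: the sum is 4 A(v,v)(1 - √k), which should be positive. -/
theorem maxEigenvalue_lt_one_of_convexForm_pos {A C : Matrix (Fin n) (Fin n) ℂ}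
    (hAh : A.IsHermitian) (hC : C.IsSymm)
    (hpos : ∀ v, v ≠ 0 → 0 < (hForm A v v).re + (sForm C v v).re) :
    maxEigenvalue (C * (A⁻¹).map (starRingEnd ℂ) * C.map (starRingEnd ℂ) * A⁻¹) < 1 := by
  have hA := posDef_of_convexForm_pos hAh hpos
  have hApos := (posDef_iff_hForm.1 hA).2
  set K := C * (A⁻¹).map (starRingEnd ℂ) * C.map (starRingEnd ℂ) * A⁻¹ with hK
  rcases (Complex.re '' spectrum ℂ K).eq_empty_or_nonempty with he | hne
  -- An empty spectrum (dimension zero) is covered by `sSup ∅ = 0`.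
  · simp [maxEigenvalue, he]
  obtain ⟨k, hk, hkre⟩ := hne.csSup_mem (finite_spectrum_re K)
  rw [maxEigenvalue, ← hkre]
  obtain ⟨w, hw, hKw⟩ := mem_spectrum_iff_exists_mulVec.1 hk
  have hdet : IsUnit A.det := (isUnit_iff_isUnit_det A).1 hA.isUnit
  have hcanc : ∀ x, A *ᵥ (A⁻¹ *ᵥ x) = x := fun x => by
    rw [mulVec_mulVec, mul_nonsing_inv _ hdet, one_mulVec]
  set v := star (A⁻¹ *ᵥ w) with hv
  have hAv : A *ᵥ star v = w := by rw [hv, star_star, hcanc]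
  have hv0 : v ≠ 0 := by
    rintro h
    rw [h, star_zero, mulVec_zero] at hAv
    exact hw hAv.symm
  set y := star (A⁻¹ *ᵥ (C *ᵥ v)) with hy
  have hAy : A *ᵥ star y = C *ᵥ v := by rw [hy, star_star, hcanc]
  have hCy : C *ᵥ y = k • (A *ᵥ star v) := by
    rw [hAv, ← hKw, hK, ← mulVec_mulVec, ← mulVec_mulVec, ← mulVec_mulVec]
    have : A⁻¹ *ᵥ w = star v := by rw [hv, star_star]
    rw [this, map_conj_mulVec_star, map_conj_mulVec_star]
  have h1 : sForm C v y = k * hForm A v v := by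
    rw [sForm, hCy, dotProduct_smul, hForm, smul_eq_mul]
  have h2 : sForm C y v = hForm A y y := by rw [sForm, ← hAy, hForm]
  have h3 : hForm A y y = k * hForm A v v := by rw [← h2, sForm_comm hC, h1]
  have him : k.im * (hForm A v v).re = 0 := by
    have := congrArg Complex.im h3
    rw [hForm_self_im hAh, Complex.mul_im, hForm_self_im hAh] at this
    simpa using this.symm
  have hAv0 := hApos v hv0
  have hkim : k.im = 0 := by
    rcases mul_eq_zero.1 him with h | h
    · exact h
    · exact absurd h hAv0.ne'
  have hyy : (hForm A y y).re = k.re * (hForm A v v).re := by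
    rw [h3, Complex.mul_re, hkim]
    simp
  have hvy : (sForm C v y).re = k.re * (hForm A v v).re := by
    rw [h1, Complex.mul_re, hkim]
    simp
  by_contra! hk1
  set s : ℝ := (√k.re)⁻¹ with hs
  have hkpos : 0 < k.re := by linarith
  have hs2 : s ^ 2 * k.re = 1 := by
    rw [hs, inv_pow, Real.sq_sqrt hkpos.le, inv_mul_cancel₀ hkpos.ne']
  have hspos : 0 < s := inv_pos.2 (Real.sqrt_pos.2 hkpos)
  have hs1 : s ≤ 1 := by
    by_contra! h
    nlinarith
  -- test vectors `v ± s y`, rotated so that the two inequalities add up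
  have hall : ∀ x : Fin n → ℂ, 0 ≤ (hForm A x x).re + (sForm C x x).re := fun x => by
    rcases eq_or_ne x 0 with rfl | hx
    · simp [hForm, sForm]
    · exact (hpos x hx).le
  have hexp : ∀ t : ℝ, (hForm A (v + (t : ℂ) • y) (v + (t : ℂ) • y)).re =
      (hForm A v v).re + 2 * t * (hForm A v y).re + t ^ 2 * (hForm A y y).re ∧
      (sForm C (v + (t : ℂ) • y) (v + (t : ℂ) • y)).re =
      (sForm C v v).re + 2 * t * (sForm C v y).re + t ^ 2 * (sForm C y y).re := by
    intro t
    simp only [hForm_add_left, hForm_add_right, sForm_add_left, sForm_add_right, hForm_smul_left,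
      hForm_smul_right, sForm_smul_left, sForm_smul_right, Complex.add_re]
    rw [sForm_comm hC y v]
    have := re_hForm_comm hAh y v
    constructor
    · simp
      rw [this]
      ring
    · simp
      ring
  have hrot : ∀ x : Fin n → ℂ, (hForm A (Complex.I • x) (Complex.I • x)).re = (hForm A x x).re ∧
      (sForm C (Complex.I • x) (Complex.I • x)).re = -(sForm C x x).re := by
    intro x
    rw [hForm_smul_left, hForm_smul_right, sForm_smul_left, sForm_smul_right, ← mul_assoc,
      ← mul_assoc]
    simp
  have e1 := hexp s
  have e2 := hexp (-s)
  have p1 := hall (Complex.I • (v + (s : ℂ) • y))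
  have p2 := hall (v + ((-s : ℝ) : ℂ) • y)
  rw [(hrot _).1, (hrot _).2, e1.1, e1.2] at p1
  rw [e2.1, e2.2] at p2
  have hsum : 2 * ((hForm A v v).re + s ^ 2 * (hForm A y y).re) -
      4 * s * (sForm C v y).re ≥ 0 := by linarith
  -- One of the two test vectors is nonzero because their sum is `2 v`; this makes the summed
  -- inequality strict.
  have hx0 : v + (s : ℂ) • y ≠ 0 ∨ v + ((-s : ℝ) : ℂ) • y ≠ 0 := by
    by_contra! h
    apply hv0
    have h4 := congrArg₂ (· + ·) h.1 h.2
    have h5 : (2 : ℂ) • v = 0 := by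
      rw [two_smul]
      simpa [add_assoc, add_comm, add_left_comm] using h4
    simpa using h5
  have hstrict : 0 < 2 * ((hForm A v v).re + s ^ 2 * (hForm A y y).re) -
      4 * s * (sForm C v y).re := by
    rcases hx0 with h | h
    · have p1' := hpos (Complex.I • (v + (s : ℂ) • y))
        (smul_ne_zero Complex.I_ne_zero h)
      rw [(hrot _).1, (hrot _).2, e1.1, e1.2] at p1'
      linarith
    · have p2' := hpos _ h
      rw [e2.1, e2.2] at p2'
      linarith
  rw [hyy, hvy] at hstrict
  have h6 : s * k.re * s = 1 := by nlinarith
  have h7 : 1 ≤ s * k.re := by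
    by_contra! h
    nlinarith
  nlinarith

end Eigenvalues

end

noncomputable section

/-! ### Wedge products as determinants. -/

section Wedge

open Matrix Equiv

theorem wedgeCoeff_eq_sum_det {k : ℕ} (H : Fin k → Matrix (Fin k) (Fin k) ℂ) :
    wedgeCoeff H = ∑ s : Perm (Fin k), ((Perm.sign s : ℤ) : ℂ) *
      (Matrix.of fun l j => H l (s l) j).det := by
  refine Finset.sum_congr rfl fun s _ => ?_
  rw [← det_transpose, det_apply', Finset.mul_sum]
  refine Finset.sum_congr rfl fun t _ => ?_
  simp [mul_assoc]

theorem wedgeCoeff_const {k : ℕ} (H : Matrix (Fin k) (Fin k) ℂ) :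
    wedgeCoeff (fun _ : Fin k => H) = (k.factorial : ℂ) * H.det := by
  rw [wedgeCoeff_eq_sum_det]
  have : ∀ s : Perm (Fin k), ((Perm.sign s : ℤ) : ℂ) *
      (Matrix.of fun l j => H (s l) j).det = H.det := by
    intro s
    have h1 := det_permute s H
    have h2 : (H.submatrix s id) = Matrix.of fun l j => H (s l) j := rfl
    rw [← h2, h1, ← mul_assoc, ← Int.cast_mul]
    simp
  simp [this, Fintype.card_perm]

/-- Each value of `σ 0` is taken by `m!` permutations. -/
theorem sum_perm_apply_zero {m : ℕ} (f : Fin (m + 1) → ℂ) :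
    ∑ σ : Perm (Fin (m + 1)), f (σ 0) = (m.factorial : ℂ) * ∑ k, f k := by
  rw [← Perm.decomposeFin.symm.sum_comp, Fintype.sum_prod_type]
  simp [Fintype.card_perm, Finset.mul_sum]

/-- Expansion of each determinant along the replaced row; both sides are the derivative of det at
`A` in the direction `b`. -/
theorem sum_det_updateRow {k : ℕ} (A b : Matrix (Fin k) (Fin k) ℂ) :
    ∑ i, (A.updateRow i (b i)).det = (b * A.adjugate).trace := by
  simp only [trace, diag]
  refine Finset.sum_congr rfl fun i _ => ?_
  rw [← cramer_transpose_apply, cramer_eq_adjugate_mulVec, ← adjugate_transpose]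
  simp [mulVec, dotProduct, Matrix.mul_apply, mul_comm]

/-- The form in dτ kills every permutation with `s 0 ≠ 0` and reduces the others to the block along
V. There one row of the block is replaced by the corresponding row of `b`, and each choice of that
row occurs `m!` times. -/
theorem wedgeCoeff_mixed {m : ℕ} (G : Matrix (Fin (m + 2)) (Fin (m + 2)) ℂ)
    (b : Matrix (Fin (m + 1)) (Fin (m + 1)) ℂ) :
    wedgeCoeff (fun l : Fin (m + 2) =>
        if l.val = 0 then Matrix.single 0 0 1
        else if l.val = 1 then pullbackCoeff b
        else G) =
      (m.factorial : ℂ) * (b * (G.submatrix Fin.succ Fin.succ).adjugate).trace := by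
  set H : Fin (m + 2) → Matrix (Fin (m + 2)) (Fin (m + 2)) ℂ := fun l =>
        if l.val = 0 then Matrix.single 0 0 1
        else if l.val = 1 then pullbackCoeff b
        else G with hH
  set A := G.submatrix Fin.succ Fin.succ with hA
  rw [wedgeCoeff_eq_sum_det, ← Perm.decomposeFin.symm.sum_comp, Fintype.sum_prod_type,
    Fin.sum_univ_succ, ← sum_det_updateRow,
    ← sum_perm_apply_zero fun i => (A.updateRow i (b i)).det]
  have hzero : ∀ p : Fin (m + 1), ∑ σ : Perm (Fin (m + 1)),
      ((Perm.sign (Perm.decomposeFin.symm (p.succ, σ)) : ℤ) : ℂ) *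
        (Matrix.of fun l j => H l (Perm.decomposeFin.symm (p.succ, σ) l) j).det = 0 := by
    intro p
    refine Finset.sum_eq_zero fun σ _ => ?_
    rw [det_eq_zero_of_row_eq_zero 0, mul_zero]
    intro j
    simp [hH, (Fin.succ_ne_zero p).symm]
  rw [Finset.sum_eq_zero fun p _ => hzero p, add_zero]
  refine Finset.sum_congr rfl fun σ _ => ?_
  have h1 : (Matrix.of fun l j => H l (Perm.decomposeFin.symm (0, σ) l) j).det =
      ((A.updateRow (σ 0) (b (σ 0))).submatrix σ id).det := by
    rw [det_succ_row_zero, Finset.sum_eq_single 0]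
    · have h2 : (Matrix.of fun l j => H l (Perm.decomposeFin.symm (0, σ) l) j).submatrix
          Fin.succ (Fin.succAbove 0) = (A.updateRow (σ 0) (b (σ 0))).submatrix σ id := by
        ext i j
        simp only [submatrix_apply, of_apply, Fin.succAbove_zero, id]
        rw [Perm.decomposeFin_symm_apply_succ, swap_self, refl_apply]
        refine Fin.cases ?_ (fun i => ?_) i
        · simp [hH, pullbackCoeff]
        · rw [updateRow_ne (by simp)]
          simp [hH, hA]
      rw [h2]
      simp [hH]
    · intro j _ hj
      simp [hH, hj.symm]
    · simp
  rw [h1, det_permute, Perm.decomposeFin.symm_sign]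
  simp only [if_true, one_mul]
  rw [← mul_assoc, ← Int.cast_mul]
  simp

end Wedge

/-! ### The equation as a minimum over trial vectors. -/

section Variational

open Matrix

variable {ι : Type*} [Fintype ι]

theorem hForm_completing_square [DecidableEq ι] {M : Matrix ι ι ℂ} (hM : M.PosDef) (y c : ι → ℂ) :
    (hForm M c c).re - 2 * (c ⬝ᵥ y).re =
      (hForm M (c - star (M⁻¹ *ᵥ y)) (c - star (M⁻¹ *ᵥ y))).re - (star y ⬝ᵥ M⁻¹ *ᵥ y).re := by
  set c0 := star (M⁻¹ *ᵥ y) with hc0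
  have hdet : IsUnit M.det := (isUnit_iff_isUnit_det M).1 hM.isUnit
  have h1 : M *ᵥ star c0 = y := by
    rw [hc0, star_star, mulVec_mulVec, mul_nonsing_inv _ hdet, one_mulVec]
  have h2 : ∀ x, hForm M x c0 = x ⬝ᵥ y := fun x => by rw [hForm, h1]
  have h3 : (star y ⬝ᵥ M⁻¹ *ᵥ y).re = (c0 ⬝ᵥ y).re := by
    have : star y ⬝ᵥ M⁻¹ *ᵥ y = star (c0 ⬝ᵥ y) := by
      rw [hc0, ← star_dotProduct_star, star_star]
    rw [this]
    simp
  have h4 : ∀ x, hForm M (c - c0) x = hForm M c x - hForm M c0 x := fun x => by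
    simp [hForm, sub_dotProduct]
  have h5 : ∀ x, hForm M x (c - c0) = hForm M x c - hForm M x c0 := fun x => by
    simp [hForm, mulVec_sub, dotProduct_sub]
  rw [h3, h4, h5, h5, Complex.sub_re, Complex.sub_re, Complex.sub_re, re_hForm_comm hM.1 c0 c,
    h2, h2]
  ring

-- Writing b = P* P splits a trace against `b` into rank one terms, one for each trial vector `c k`.
open scoped MatrixOrder Matrix.Norms.L2Operator in
theorem exists_frame [DecidableEq ι] {b : Matrix ι ι ℂ} (hb : b.PosDef) :
    ∃ y : ι → ι → ℂ, ∀ i j, ∑ k, y k i * star (y k j) = b i j := by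
  obtain ⟨P, hP⟩ := CStarAlgebra.nonneg_iff_eq_star_mul_self.1 hb.posSemidef.nonneg
  rw [star_eq_conjTranspose] at hP
  refine ⟨fun k i => star (P k i), fun i j => ?_⟩
  rw [hP]
  simp [Matrix.mul_apply]

theorem sum_frame_eq_trace {b : Matrix ι ι ℂ} {y : ι → ι → ℂ}
    (hy : ∀ i j, ∑ k, y k i * star (y k j) = b i j) (N : Matrix ι ι ℂ) :
    ∑ k, star (y k) ⬝ᵥ N *ᵥ y k = (b * N).trace := by
  simp only [trace, diag, Matrix.mul_apply, ← hy, dotProduct, mulVec, Finset.sum_mul,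
    Finset.mul_sum]
  rw [Finset.sum_comm]
  have : ∀ i, (∑ k, ∑ j, star (y k) i * (N i j * y k j)) =
      ∑ j, ∑ k, star (y k) i * (N i j * y k j) := fun i => Finset.sum_comm
  simp only [this]
  rw [Finset.sum_comm]
  refine Finset.sum_congr rfl fun i _ => Finset.sum_congr rfl fun j _ =>
    Finset.sum_congr rfl fun k _ => ?_
  simp
  ring

theorem hForm_cons_zero {n : ℕ} (G : Matrix (Fin (n + 1)) (Fin (n + 1)) ℂ) (c : Fin n → ℂ) :
    hForm G (Fin.cons 0 c) (Fin.cons 0 c) = hForm (G.submatrix Fin.succ Fin.succ) c c := by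
  simp [hForm, dotProduct, mulVec, Fin.sum_univ_succ]

/-- The function of trial vectors whose smallest value is zero exactly for solutions of the
perturbed Monge-Ampère equation. -/
def trialValue {n : ℕ} (r : ℝ) (y : Fin n → Fin n → ℂ)
    (G : Matrix (Fin (n + 1)) (Fin (n + 1)) ℂ) (a : Fin n → ℂ) (c : Fin n → Fin n → ℂ) : ℝ :=
  (hForm G (Fin.cons 1 a) (Fin.cons 1 a)).re +
    r * ∑ k, ((hForm G (Fin.cons 0 (c k)) (Fin.cons 0 (c k))).re - 2 * (c k ⬝ᵥ y k).re)

/-- The equation is (m+2)! det G = ε m! tr(b adj A), which is det G / det A = r tr(b A⁻¹). The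
quotient is the Schur complement, the minimum of G on vectors (1, a). Completing squares turns
`trialValue` into a sum of nonnegative squares, the two constants cancelling by the equation. -/
theorem trialValue_of_equation {m : ℕ} {G : Matrix (Fin (m + 2)) (Fin (m + 2)) ℂ}
    (hG : G.PosDef) {b : Matrix (Fin (m + 1)) (Fin (m + 1)) ℂ}
    {y : Fin (m + 1) → Fin (m + 1) → ℂ}
    (hy : ∀ i j, ∑ k, y k i * star (y k j) = b i j) {ε : ℝ} (hε : 0 < ε)
    (heq : wedgeCoeff (fun _ : Fin (m + 2) => G) =
      (ε : ℂ) * wedgeCoeff (fun l : Fin (m + 2) =>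
        if l.val = 0 then Matrix.single 0 0 1
        else if l.val = 1 then pullbackCoeff b
        else G)) :
    (∀ a c, 0 ≤ trialValue (ε * m.factorial / (m + 2).factorial) y G a c) ∧
      ∃ a c, trialValue (ε * m.factorial / (m + 2).factorial) y G a c = 0 := by
  set r : ℝ := ε * m.factorial / (m + 2).factorial with hr
  have hr0 : 0 < r := by positivity
  set A := G.submatrix Fin.succ Fin.succ with hA
  have hApd : A.PosDef := by
    refine posDef_iff_hForm.2 ⟨hG.1.submatrix _, fun v hv => ?_⟩
    rw [hA, ← hForm_cons_zero]
    refine (posDef_iff_hForm.1 hG).2 _ fun h => hv ?_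
    ext i
    have := congrFun h i.succ
    simpa using this
  have hAd : A.det ≠ 0 := hApd.det_pos.ne'
  have hGd : G.det ≠ 0 := hG.det_pos.ne'
  rw [wedgeCoeff_const, wedgeCoeff_mixed, ← hA] at heq
  have hadj : A.adjugate = A.det • A⁻¹ := by
    rw [Matrix.inv_def, smul_smul, Ring.mul_inverse_cancel _ (Ne.isUnit hAd), one_smul]
  have hG00 : G⁻¹ 0 0 = A.det / G.det := by
    rw [Matrix.inv_def, Matrix.smul_apply, adjugate_fin_succ_eq_det_submatrix]
    simp [hA, div_eq_inv_mul]
  -- the Schur complement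
  set t : ℂ := G.det / A.det with ht
  have htval : t = (r : ℂ) * (b * A⁻¹).trace := by
    rw [hadj, Matrix.mul_smul, trace_smul] at heq
    have h1 : ((m + 2).factorial : ℂ) ≠ 0 := by exact_mod_cast (m + 2).factorial_ne_zero
    rw [ht, hr]
    push_cast
    rw [div_eq_iff hAd, div_mul_eq_mul_div, div_mul_eq_mul_div, eq_div_iff h1, mul_comm, heq,
      smul_eq_mul]
    ring
  have htinv : t * G⁻¹ 0 0 = 1 := by
    rw [hG00, ht]
    field_simp
  have htim : t.im = 0 := by
    have h1 := (Complex.pos_iff.1 hG.det_pos).2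
    have h2 := (Complex.pos_iff.1 hApd.det_pos).2
    rw [ht, Complex.div_im, ← h1, ← h2]
    simp
  have htc : star t = t := Complex.conj_eq_iff_im.2 htim
  -- With y0 = t e₀ the linear term is constant on vectors (1, a), and the unconstrained minimizer
  -- has zeroth component `t * G⁻¹ 0 0 = 1`, so it satisfies the constraint.
  set y0 : Fin (m + 2) → ℂ := Pi.single 0 t with hy0
  have hGy : ∀ i, (G⁻¹ *ᵥ y0) i = G⁻¹ i 0 * t := fun i => by simp [hy0]
  have hv0 : (star y0 ⬝ᵥ G⁻¹ *ᵥ y0) = t := by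
    have : star y0 = Pi.single 0 t := by
      ext i
      refine Fin.cases ?_ (fun i => ?_) i
      · simpa [hy0] using htc
      · simp [hy0]
    rw [this, single_dotProduct, hGy, mul_comm (G⁻¹ 0 0), htinv, mul_one]
  have hsq : ∀ a, (hForm G (Fin.cons 1 a) (Fin.cons 1 a)).re = t.re +
      (hForm G (Fin.cons 1 a - star (G⁻¹ *ᵥ y0)) (Fin.cons 1 a - star (G⁻¹ *ᵥ y0))).re := by
    intro a
    have h1 := hForm_completing_square hG y0 (Fin.cons 1 a)
    have h2 : (Fin.cons 1 a : Fin (m + 2) → ℂ) ⬝ᵥ y0 = t := by simp [hy0]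
    rw [hv0, h2] at h1
    linarith
  have hsqk : ∀ (k) (c : Fin (m + 1) → ℂ),
      (hForm G (Fin.cons 0 c) (Fin.cons 0 c)).re - 2 * (c ⬝ᵥ y k).re =
      (hForm A (c - star (A⁻¹ *ᵥ y k)) (c - star (A⁻¹ *ᵥ y k))).re -
        (star (y k) ⬝ᵥ A⁻¹ *ᵥ y k).re := by
    intro k c
    rw [hForm_cons_zero, ← hA, hForm_completing_square hApd]
  have htre : t.re = r * ∑ k, (star (y k) ⬝ᵥ A⁻¹ *ᵥ y k).re := by
    rw [htval, ← sum_frame_eq_trace hy, Complex.re_ofReal_mul, Complex.re_sum]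
  have hval : ∀ a c, trialValue r y G a c =
      (hForm G (Fin.cons 1 a - star (G⁻¹ *ᵥ y0)) (Fin.cons 1 a - star (G⁻¹ *ᵥ y0))).re +
      r * ∑ k, (hForm A (c k - star (A⁻¹ *ᵥ y k)) (c k - star (A⁻¹ *ᵥ y k))).re := by
    intro a c
    rw [trialValue, hsq, htre]
    simp only [hsqk]
    rw [Finset.sum_sub_distrib]
    ring
  refine ⟨fun a c => ?_, fun i => star (G⁻¹ *ᵥ y0) i.succ, fun k => star (A⁻¹ *ᵥ y k), ?_⟩
  · rw [hval]
    have h1 := hG.hForm_nonneg (Fin.cons 1 a - star (G⁻¹ *ᵥ y0))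
    have h2 : 0 ≤ ∑ k, (hForm A (c k - star (A⁻¹ *ᵥ y k)) (c k - star (A⁻¹ *ᵥ y k))).re :=
      Finset.sum_nonneg fun k _ => hApd.hForm_nonneg _
    positivity
  · rw [hval]
    have h1 : (Fin.cons 1 fun i => star (G⁻¹ *ᵥ y0) (Fin.succ i) : Fin (m + 2) → ℂ) =
        star (G⁻¹ *ᵥ y0) := by
      ext i
      refine Fin.cases ?_ (fun i => ?_) i
      · rw [Fin.cons_zero, Pi.star_apply, hGy, mul_comm, htinv, star_one]
      · rw [Fin.cons_succ]
    rw [h1]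
    simp [hForm]

end Variational

end

noncomputable section

/-! ### Wirtinger derivatives in terms of the real Hessian. -/

section Wirtinger

variable {E : Type*} [NormedAddCommGroup E] [NormedSpace ℝ E]

theorem hess_comp_affine {G : Type*} [NormedAddCommGroup G] [NormedSpace ℝ G] {g : E → ℝ}
    (L : G →L[ℝ] E) (c : E) {z : G} (hg : ContDiffAt ℝ 2 g (L z + c)) (u v : G) :
    hess (fun w => g (L w + c)) z u v = hess g (L z + c) (L u) (L v) := by
  have hL : ∀ w, HasFDerivAt (fun w => L w + c) L w := fun w => L.hasFDerivAt.add_const c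
  have hcont : Tendsto (fun w => L w + c) (𝓝 z) (𝓝 (L z + c)) := (hL z).continuousAt
  have h1 : fderiv ℝ (fun w => g (L w + c)) =ᶠ[𝓝 z] fun w => (fderiv ℝ g (L w + c)).comp L := by
    filter_upwards [hcont.eventually (hg.eventually (by simp))] with w hw
    exact ((hw.differentiableAt (by simp)).hasFDerivAt.comp w (hL w)).fderiv
  have h2 : DifferentiableAt ℝ (fderiv ℝ g) (L z + c) :=
    (hg.fderiv_right (m := 1) (by norm_num)).differentiableAt (by simp)
  have h3 : HasFDerivAt (fun w => (fderiv ℝ g (L w + c)).comp L) _ z :=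
    ((ContinuousLinearMap.compL ℝ G E ℝ).flip L).hasFDerivAt.comp z
      (h2.hasFDerivAt.comp z (hL z))
  rw [hess, h1.fderiv_eq, h3.fderiv]
  rfl

variable [NormedSpace ℂ E]

theorem dz_dzbar_ofReal {f : E → ℝ} {p : E} (hf : ContDiffAt ℝ 2 f p) (v w : E) :
    dz (dzbar (fun q => ((f q : ℝ) : ℂ)) w) v p = (1 / 4) *
      (hess f p v w + hess f p (Complex.I • v) (Complex.I • w) +
        Complex.I * (hess f p v (Complex.I • w) - hess f p (Complex.I • v) w)) ∧
    dz (dz (fun q => ((f q : ℝ) : ℂ)) w) v p = (1 / 4) *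
      (hess f p v w - hess f p (Complex.I • v) (Complex.I • w) -
        Complex.I * (hess f p v (Complex.I • w) + hess f p (Complex.I • v) w)) := by
  have h0 : ∀ᶠ q in 𝓝 p, fderiv ℝ (fun q => ((f q : ℝ) : ℂ)) q =
      Complex.ofRealCLM.comp (fderiv ℝ f q) := by
    filter_upwards [hf.eventually (by simp)] with q hq
    exact (Complex.ofRealCLM.hasFDerivAt.comp q (hq.differentiableAt (by simp)).hasFDerivAt).fderiv
  have h2 : DifferentiableAt ℝ (fderiv ℝ f) p :=
    (hf.fderiv_right (m := 1) (by norm_num)).differentiableAt (by simp)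
  have h3 : ∀ x : E, HasFDerivAt (fun q => ((fderiv ℝ f q x : ℝ) : ℂ))
      (Complex.ofRealCLM.comp ((hess f p).flip x)) p := fun x => by
    have h4 := h2.hasFDerivAt.clm_apply (hasFDerivAt_const x p)
    have h5 := Complex.ofRealCLM.hasFDerivAt.comp p h4
    refine h5.congr_fderiv ?_
    ext y
    simp [hess]
  have h6 : ∀ c : ℂ, HasFDerivAt
      (fun q => (1 / 2 : ℂ) * ((fderiv ℝ f q w : ℝ) + c * (fderiv ℝ f q (Complex.I • w) : ℝ)))
      ((1 / 2 : ℂ) • (Complex.ofRealCLM.comp ((hess f p).flip w) +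
        c • Complex.ofRealCLM.comp ((hess f p).flip (Complex.I • w)))) p := fun c =>
    ((h3 w).add ((h3 (Complex.I • w)).const_mul c)).const_mul (1 / 2 : ℂ)
  have h7 : dzbar (fun q => ((f q : ℝ) : ℂ)) w =ᶠ[𝓝 p]
      fun q => (1 / 2 : ℂ) * ((fderiv ℝ f q w : ℝ) +
        Complex.I * (fderiv ℝ f q (Complex.I • w) : ℝ)) := by
    filter_upwards [h0] with q hq
    simp [dzbar, hq]
  have h8 : dz (fun q => ((f q : ℝ) : ℂ)) w =ᶠ[𝓝 p]
      fun q => (1 / 2 : ℂ) * ((fderiv ℝ f q w : ℝ) +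
        (-Complex.I) * (fderiv ℝ f q (Complex.I • w) : ℝ)) := by
    filter_upwards [h0] with q hq
    simp [dz, hq]
    ring
  constructor
  · rw [dz, h7.fderiv_eq, (h6 _).fderiv]
    simp
    linear_combination (-1 / 4 * (hess f p (Complex.I • v) (Complex.I • w) : ℂ)) * Complex.I_mul_I
  · rw [dz, h8.fderiv_eq, (h6 _).fderiv]
    simp
    linear_combination (1 / 4 * (hess f p (Complex.I • v) (Complex.I • w) : ℂ)) * Complex.I_mul_I

variable [IsScalarTower ℝ ℂ E]

theorem bilin_complex_smul (H : E →L[ℝ] E →L[ℝ] ℝ) (c d : ℂ) (v w : E) :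
    H (c • v) (d • w) = c.re * d.re * H v w + c.re * d.im * H v (Complex.I • w) +
      c.im * d.re * H (Complex.I • v) w + c.im * d.im * H (Complex.I • v) (Complex.I • w) := by
  have hr : ∀ (r : ℝ) (x : E), (r : ℂ) • x = r • x := fun r x => algebraMap_smul ℂ r x
  have : ∀ (c : ℂ) (x : E), c • x = c.re • x + c.im • (Complex.I • x) := fun c x => by
    conv_lhs => rw [← Complex.re_add_im c]
    rw [add_smul, mul_smul, hr, hr]
  rw [this c, this d]
  simp
  ring

theorem re_hForm_levi {ι : Type*} [Fintype ι] {f : E → ℝ} {p : E} (hf : ContDiffAt ℝ 2 f p)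
    (e : ι → E) (v : ι → ℂ) :
    (hForm (Matrix.of fun i j => dz (dzbar (fun q => ((f q : ℝ) : ℂ)) (e j)) (e i) p) v v).re =
      (1 / 4) * (hess f p (∑ i, v i • e i) (∑ i, v i • e i) +
        hess f p (Complex.I • ∑ i, v i • e i) (Complex.I • ∑ i, v i • e i)) := by
  have h1 : hForm (Matrix.of fun i j => dz (dzbar (fun q => ((f q : ℝ) : ℂ)) (e j)) (e i) p) v v =
      ∑ i, ∑ j, v i * star (v j) * dz (dzbar (fun q => ((f q : ℝ) : ℂ)) (e j)) (e i) p := by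
    simp only [hForm, dotProduct, Matrix.mulVec, Finset.mul_sum, Matrix.of_apply, Pi.star_apply]
    refine Finset.sum_congr rfl fun i _ => Finset.sum_congr rfl fun j _ => ?_
    ring
  rw [h1]
  simp only [Finset.smul_sum, map_sum, sum_apply, Complex.re_sum,
    ← Finset.sum_add_distrib, Finset.mul_sum]
  rw [Finset.sum_comm]
  refine Finset.sum_congr rfl fun j _ => Finset.sum_congr rfl fun i _ => ?_
  rw [(dz_dzbar_ofReal hf (e i) (e j)).1]
  rw [smul_smul, smul_smul, bilin_complex_smul _ (v i) (v j),
    bilin_complex_smul _ (Complex.I * v i) (Complex.I * v j)]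
  simp
  ring

theorem re_sForm_hess {ι : Type*} [Fintype ι] {f : E → ℝ} {p : E} (hf : ContDiffAt ℝ 2 f p)
    (e : ι → E) (v : ι → ℂ) :
    (sForm (Matrix.of fun i j => dz (dz (fun q => ((f q : ℝ) : ℂ)) (e j)) (e i) p) v v).re =
      (1 / 4) * (hess f p (∑ i, v i • e i) (∑ i, v i • e i) -
        hess f p (Complex.I • ∑ i, v i • e i) (Complex.I • ∑ i, v i • e i)) := by
  have h1 : sForm (Matrix.of fun i j => dz (dz (fun q => ((f q : ℝ) : ℂ)) (e j)) (e i) p) v v =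
      ∑ i, ∑ j, v i * v j * dz (dz (fun q => ((f q : ℝ) : ℂ)) (e j)) (e i) p := by
    simp only [sForm, dotProduct, Matrix.mulVec, Finset.mul_sum, Matrix.of_apply]
    refine Finset.sum_congr rfl fun i _ => Finset.sum_congr rfl fun j _ => ?_
    ring
  rw [h1]
  simp only [Finset.smul_sum, map_sum, sum_apply, Complex.re_sum,
    ← Finset.sum_sub_distrib, Finset.mul_sum]
  rw [Finset.sum_comm]
  refine Finset.sum_congr rfl fun j _ => Finset.sum_congr rfl fun i _ => ?_
  rw [(dz_dzbar_ofReal hf (e i) (e j)).2]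
  rw [smul_smul, smul_smul, bilin_complex_smul _ (v i) (v j),
    bilin_complex_smul _ (Complex.I * v i) (Complex.I * v j)]
  simp
  ring

omit [IsScalarTower ℝ ℂ E] in
theorem isHermitian_levi {ι : Type*} {f : E → ℝ} {p : E} (hf : ContDiffAt ℝ 2 f p) (e : ι → E) :
    (Matrix.of fun i j => dz (dzbar (fun q => ((f q : ℝ) : ℂ)) (e j)) (e i) p).IsHermitian := by
  ext i j
  simp only [Matrix.conjTranspose_apply, Matrix.of_apply]
  rw [(dz_dzbar_ofReal hf (e i) (e j)).1, (dz_dzbar_ofReal hf (e j) (e i)).1,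
    hess_symm hf (e j), hess_symm hf (Complex.I • e j) (Complex.I • e i),
    hess_symm hf (e j) (Complex.I • e i), hess_symm hf (Complex.I • e j) (e i)]
  simp
  ring

omit [IsScalarTower ℝ ℂ E] in
theorem isSymm_hess {ι : Type*} {f : E → ℝ} {p : E} (hf : ContDiffAt ℝ 2 f p) (e : ι → E) :
    (Matrix.of fun i j => dz (dz (fun q => ((f q : ℝ) : ℂ)) (e j)) (e i) p).IsSymm := by
  ext i j
  simp only [Matrix.transpose_apply, Matrix.of_apply]
  rw [(dz_dzbar_ofReal hf (e i) (e j)).2, (dz_dzbar_ofReal hf (e j) (e i)).2,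
    hess_symm hf (e j), hess_symm hf (Complex.I • e j) (Complex.I • e i),
    hess_symm hf (e j) (Complex.I • e i), hess_symm hf (Complex.I • e j) (e i)]
  ring

end Wirtinger

/-! ### Strict convexity as positivity of `convexForm`, and changes of charts. -/

section ConvexForm

variable {n : ℕ} {V : Type*} [TopologicalSpace V] [ChartedSpace (Fin n → ℂ) V]

/-- The real quadratic form `b_{αβ̄} ξ^α ξ̄^β - Re (S_{αβ} ξ^α ξ^β)` in the chart `e`. -/
def constForm (ω : ConstantMetric n V) (S : ConstantTensor n V)
    (e : OpenPartialHomeomorph V (Fin n → ℂ)) (ξ : Fin n → ℂ) : ℝ :=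
  (hForm (ω.coeff e) ξ ξ).re - (sForm (S.coeff e) ξ ξ).re

/-- The real quadratic form `(b_{αβ̄} + φ_{αβ̄}) ξ^α ξ̄^β + Re ((φ_{αβ} - S_{αβ}) ξ^α ξ^β)`. -/
def convexForm (ω : ConstantMetric n V) (S : ConstantTensor n V) (φ : V → ℝ)
    (e : OpenPartialHomeomorph V (Fin n → ℂ)) (z ξ : Fin n → ℂ) : ℝ :=
  constForm ω S e ξ + (1 / 2) * hess (fun w => φ (e.symm w)) z ξ ξ

theorem sum_smul_single (v : Fin n → ℂ) :
    ∑ i, v i • (Pi.single i 1 : Fin n → ℂ) = v := by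
  ext j
  simp [Pi.single_apply]

/-- The mixed derivatives give a quarter of D²φ(ξ,ξ) + D²φ(iξ,iξ), the pure ones a quarter of the
difference; the sum retains only D²φ(ξ,ξ)/2. -/
theorem convexForm_eq (ω : ConstantMetric n V) (S : ConstantTensor n V) {φ : V → ℝ}
    {e : OpenPartialHomeomorph V (Fin n → ℂ)} {z : Fin n → ℂ}
    (hφ : ContDiffAt ℝ 2 (fun w => φ (e.symm w)) z) (ξ : Fin n → ℂ) :
    (hForm (matrixA ω φ e z) ξ ξ).re + (sForm (matrixB φ e z - S.coeff e) ξ ξ).re =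
      convexForm ω S φ e z ξ := by
  rw [matrixA, matrixB, hForm_add_matrix, sForm_sub_matrix, Complex.add_re, Complex.sub_re,
    re_hForm_levi hφ, re_sForm_hess hφ, sum_smul_single, convexForm, constForm]
  ring

/-- This replaces eigenvalues and inverse matrices by a condition affine in D²φ, to which minimum
principles apply. -/
theorem strictlySOmegaConvex_iff (ω : ConstantMetric n V) (S : ConstantTensor n V) (φ : V → ℝ) :
    StrictlySOmegaConvex ω S φ ↔
      (∀ e ∈ atlas (Fin n → ℂ) V, ContDiffOn ℝ 2 (fun z => φ (e.symm z)) e.target) ∧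
      ∀ e ∈ atlas (Fin n → ℂ) V, ∀ z ∈ e.target, ∀ ξ, ξ ≠ 0 → 0 < convexForm ω S φ e z ξ := by
  constructor
  · intro h
    refine ⟨h.contDiff, fun e he z hz ξ hξ => ?_⟩
    have hφ := (h.contDiff e he).contDiffAt (e.open_target.mem_nhds hz)
    rw [← convexForm_eq ω S hφ]
    exact convexForm_pos_of_maxEigenvalue (h.posDef e he z hz)
      ((isSymm_hess hφ _).sub (S.symmetric e he)) (h.eigenvalue_lt e he z hz) ξ hξ
  · rintro ⟨h1, h2⟩
    have hφ : ∀ e ∈ atlas (Fin n → ℂ) V, ∀ z ∈ e.target,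
        ContDiffAt ℝ 2 (fun z => φ (e.symm z)) z := fun e he z hz =>
      (h1 e he).contDiffAt (e.open_target.mem_nhds hz)
    have hA : ∀ e ∈ atlas (Fin n → ℂ) V, ∀ z ∈ e.target, (matrixA ω φ e z).IsHermitian :=
      fun e he z hz => (ω.posDef e he).1.add (isHermitian_levi (hφ e he z hz) _)
    refine ⟨h1, fun e he z hz => ?_, fun e he z hz => ?_⟩
    · refine posDef_of_convexForm_pos (C := matrixB φ e z - S.coeff e) (hA e he z hz) ?_
      intro v hv
      rw [convexForm_eq ω S (hφ e he z hz)]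
      exact h2 e he z hz v hv
    · refine maxEigenvalue_lt_one_of_convexForm_pos (hA e he z hz)
        ((isSymm_hess (hφ e he z hz) _).sub (S.symmetric e he)) ?_
      intro v hv
      rw [convexForm_eq ω S (hφ e he z hz)]
      exact h2 e he z hz v hv

theorem sum_smul_productFrame (a : ℂ) (x : Fin n → ℂ) :
    ∑ i, (Fin.cons a x : Fin (n + 1) → ℂ) i • productFrame n i = (a, x) := by
  rw [Fin.sum_univ_succ]
  have : ∑ i : Fin n, x i • ((0, Pi.single i 1) : ℂ × (Fin n → ℂ)) = (0, x) := by
    refine Prod.ext ?_ ?_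
    · simp [Prod.fst_sum]
    · rw [Prod.snd_sum]
      exact sum_smul_single x
  simp only [Fin.cons_zero, Fin.cons_succ, productFrame, Fin.cases_zero, Fin.cases_succ, this]
  simp

theorem hForm_pullbackCoeff (b : Matrix (Fin n) (Fin n) ℂ) (a : ℂ) (x : Fin n → ℂ) :
    hForm (pullbackCoeff b) (Fin.cons a x) (Fin.cons a x) = hForm b x x := by
  simp [hForm, dotProduct, Matrix.mulVec, Fin.sum_univ_succ, pullbackCoeff]

theorem re_hForm_fullMatrix (ω : ConstantMetric n V) {Φ : ℂ → V → ℝ}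
    {e : OpenPartialHomeomorph V (Fin n → ℂ)} {p : ℂ × (Fin n → ℂ)}
    (hΦ : ContDiffAt ℝ 2 (inChart Φ e) p) (a : ℂ) (x : Fin n → ℂ) :
    (hForm (fullMatrix ω Φ e p) (Fin.cons a x) (Fin.cons a x)).re =
      (hForm (ω.coeff e) x x).re + leviForm (hess (inChart Φ e) p) (a, x) (a, x) := by
  rw [fullMatrix, hForm_add_matrix, Complex.add_re, hForm_pullbackCoeff, re_hForm_levi hΦ,
    sum_smul_productFrame, leviForm_apply]

theorem hess_slice {f : ℂ × (Fin n → ℂ) → ℝ} {τ : ℂ} {z : Fin n → ℂ}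
    (hf : ContDiffAt ℝ 2 f (τ, z)) (u v : Fin n → ℂ) :
    hess (fun w => f (τ, w)) z u v = hess f (τ, z) (0, u) (0, v) := by
  have h1 : ∀ w, (ContinuousLinearMap.inr ℝ ℂ (Fin n → ℂ)) w + (τ, 0) = (τ, w) := fun w => by simp
  have h2 := hess_comp_affine (g := f) (ContinuousLinearMap.inr ℝ ℂ (Fin n → ℂ)) (τ, 0) (z := z)
    (by rwa [h1]) u v
  simp only [h1] at h2
  exact h2

/-- The quadratic forms of a change of charts. -/
theorem exists_chart_change (hV : IsComplexAffine n V) (ω : ConstantMetric n V)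
    (S : ConstantTensor n V) {e e' : OpenPartialHomeomorph V (Fin n → ℂ)}
    (he : e ∈ atlas (Fin n → ℂ) V) (he' : e' ∈ atlas (Fin n → ℂ) V) {x : V}
    (hx : x ∈ e.source) (hx' : x ∈ e'.source) :
    ∃ J : (Fin n → ℂ) → (Fin n → ℂ),
      (∀ ξ, (hForm (ω.coeff e) ξ ξ).re = (hForm (ω.coeff e') (J ξ) (J ξ)).re) ∧
      (∀ ξ, constForm ω S e ξ = constForm ω S e' (J ξ)) ∧
      ∀ φ : V → ℝ, ContDiffAt ℝ 2 (fun w => φ (e'.symm w)) (e' x) →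
        ∀ ξ, convexForm ω S φ e (e x) ξ = convexForm ω S φ e' (e' x) (J ξ) := by
  have hz : e x ∈ (e.symm.trans e').source := by simp [hx, hx']
  obtain ⟨a, ha⟩ := hV e he e' he' (e x) hz
  set L : (Fin n → ℂ) →L[ℂ] (Fin n → ℂ) := LinearMap.toContinuousLinearMap a.linear with hL
  have haL : ∀ w, a w = L w + a 0 := fun w => by
    have := a.map_vadd 0 w
    simpa [hL] using this
  have hfd : fderiv ℂ (fun w => e' (e.symm w)) (e x) = L := by
    rw [ha.fderiv_eq]
    have : HasFDerivAt (fun w => L w + a 0) L (e x) := L.hasFDerivAt.add_const _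
    have h2 : (a : (Fin n → ℂ) → (Fin n → ℂ)) = fun w => L w + a 0 := funext haL
    rw [h2]
    exact this.fderiv
  set T := transitionJacobian e e' x with hT
  have hTL : ∀ ξ, T.mulVec ξ = L ξ := by
    intro ξ
    ext γ
    simp only [hT, transitionJacobian, hfd, Matrix.mulVec, dotProduct, Matrix.of_apply]
    conv_rhs => rw [← sum_smul_single ξ, map_sum, Finset.sum_apply]
    refine Finset.sum_congr rfl fun i _ => ?_
    rw [map_smul, Pi.smul_apply, smul_eq_mul, mul_comm]
  have hb : ∀ ξ, hForm (ω.coeff e) ξ ξ = hForm (ω.coeff e') (L ξ) (L ξ) := by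
    intro ξ
    rw [ω.compatible e he e' he' x ⟨hx, hx'⟩, ← hT, hForm, hForm, ← hTL,
      ← Matrix.mulVec_mulVec, ← Matrix.mulVec_mulVec, map_conj_mulVec_star,
      Matrix.dotProduct_mulVec, Matrix.vecMul_transpose]
  have hS : ∀ ξ, sForm (S.coeff e) ξ ξ = sForm (S.coeff e') (L ξ) (L ξ) := by
    intro ξ
    rw [S.compatible e he e' he' x ⟨hx, hx'⟩, ← hT, sForm, sForm, ← hTL,
      ← Matrix.mulVec_mulVec, ← Matrix.mulVec_mulVec,
      Matrix.dotProduct_mulVec, Matrix.vecMul_transpose]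
  have hc : ∀ ξ, constForm ω S e ξ = constForm ω S e' (L ξ) := fun ξ => by
    rw [constForm, constForm, hb, hS]
  refine ⟨L, fun ξ => by rw [hb], hc, fun φ hφ ξ => ?_⟩
  rw [convexForm, convexForm, hc]
  have hax : L (e x) + a 0 = e' x := by
    rw [← haL, ← ha.self_of_nhds]
    exact congrArg e' (e.left_inv hx)
  have h1 : (fun w => φ (e.symm w)) =ᶠ[𝓝 (e x)]
      fun w => φ (e'.symm ((L.restrictScalars ℝ) w + a 0)) := by
    filter_upwards [ha, (e.symm.trans e').open_source.mem_nhds hz] with w hw hw'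
    have h2 : e'.symm (e' (e.symm w)) = e.symm w := e'.left_inv (by
      simp at hw'
      exact hw'.2)
    rw [← h2, hw, haL]
    rfl
  have h2 : hess (fun w => φ (e.symm w)) (e x) =
      hess (fun w => φ (e'.symm ((L.restrictScalars ℝ) w + a 0))) (e x) := by
    rw [hess, hess]
    exact h1.fderiv.fderiv_eq
  have hax' : (L.restrictScalars ℝ) (e x) + a 0 = e' x := hax
  -- Affinity of the transition map is essential: no term with first derivatives of `φ` appears.
  rw [h2, hess_comp_affine (g := fun w => φ (e'.symm w)) (L.restrictScalars ℝ) (a 0)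
    (by rw [hax']; exact hφ), hax']
  rfl

end ConvexForm

end

noncomputable section

/-! ### Continuity of second derivatives along V up to the boundary. -/

section Closure

variable {n : ℕ}

theorem ContDiffOn.slice {f : ℂ × (Fin n → ℂ) → ℝ} {T : Set ℂ} {O : Set (Fin n → ℂ)}
    {k : WithTop ℕ∞} (hf : ContDiffOn ℝ k f (T ×ˢ O)) {τ : ℂ} (hτ : τ ∈ T) :
    ContDiffOn ℝ k (fun w => f (τ, w)) O :=
  hf.comp (contDiff_prodMk_right τ).contDiffOn fun _ hw => ⟨hτ, hw⟩

/-- The second derivatives in the directions of the second factor of a `C²` function on `T × O` are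
continuous on `T × O`, for an arbitrary set `T` and an open set `O`. -/
theorem continuousOn_hess_slice {f : ℂ × (Fin n → ℂ) → ℝ} {T : Set ℂ} {O : Set (Fin n → ℂ)}
    (hO : IsOpen O) (hf : ContDiffOn ℝ 2 f (T ×ˢ O)) :
    ContinuousOn (fun q : (ℂ × (Fin n → ℂ)) × (Fin n → ℂ) =>
      hess (fun w => f (q.1.1, w)) q.1.2 q.2 q.2) ((T ×ˢ O) ×ˢ univ) := by
  rintro ⟨⟨τ0, z0⟩, ξ0⟩ ⟨⟨hτ0, hz0⟩, -⟩
  -- `T` is arbitrary, so derivatives within `T ×ˢ O` need not be unique. A Taylor series `P` near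
  -- the point is used instead; its components in the directions of the open factor are the true
  -- derivatives of the slices, and `P` is continuous.
  obtain ⟨u, hu, P, hP⟩ := (hf (τ0, z0) ⟨hτ0, hz0⟩) 2 le_rfl
  rw [insert_eq_of_mem (show (τ0, z0) ∈ T ×ˢ O from ⟨hτ0, hz0⟩), nhdsWithin_prod_eq,
    hO.nhdsWithin_eq hz0] at hu
  obtain ⟨A, hA, B0, hB0, hAB⟩ := Filter.mem_prod_iff.1 hu
  obtain ⟨B, hBB0, hBo, hzB⟩ := mem_nhds_iff.1 hB0
  have hP' : HasFTaylorSeriesUpToOn 2 f P (A ×ˢ B) :=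
    hP.mono ((prod_mono_right hBB0).trans hAB)
  have key : ∀ p ∈ A ×ˢ B, ∀ ξ, hess (fun w => f (p.1, w)) p.2 ξ ξ =
      P p 2 (fun _ => ((0, ξ) : ℂ × (Fin n → ℂ))) := by
    rintro ⟨τ, z⟩ ⟨hτ, hz⟩ ξ
    have hin : ∀ w, HasFDerivWithinAt (fun w : Fin n → ℂ => (τ, w))
        (ContinuousLinearMap.inr ℝ ℂ (Fin n → ℂ)) B w := fun w =>
      (hasFDerivAt_prodMk_right τ w).hasFDerivWithinAt
    have hmaps : MapsTo (fun w : Fin n → ℂ => (τ, w)) B (A ×ˢ B) := fun w hw => ⟨hτ, hw⟩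
    have h1 : ∀ w ∈ B, HasFDerivAt (fun w => f (τ, w))
        ((continuousMultilinearCurryFin1 ℝ (ℂ × (Fin n → ℂ)) ℝ (P (τ, w) 1)).comp
          (ContinuousLinearMap.inr ℝ ℂ (Fin n → ℂ))) w := fun w hw =>
      ((hP'.hasFDerivWithinAt (x := (τ, w)) (by norm_num) ⟨hτ, hw⟩).comp w (hin w) hmaps).hasFDerivAt
        (hBo.mem_nhds hw)
    have h2 : HasFDerivAt (fun w => P (τ, w) 1)
        ((P (τ, z) 2).curryLeft.comp (ContinuousLinearMap.inr ℝ ℂ (Fin n → ℂ))) z :=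
      ((hP'.fderivWithin 1 (by norm_num) (τ, z) ⟨hτ, hz⟩).comp z (hin z) hmaps).hasFDerivAt
        (hBo.mem_nhds hz)
    have h3 : fderiv ℝ (fun w => f (τ, w)) =ᶠ[𝓝 z] fun w =>
        (continuousMultilinearCurryFin1 ℝ (ℂ × (Fin n → ℂ)) ℝ (P (τ, w) 1)).comp
          (ContinuousLinearMap.inr ℝ ℂ (Fin n → ℂ)) := by
      filter_upwards [hBo.mem_nhds hz] with w hw using (h1 w hw).fderiv
    have h4 : DifferentiableAt ℝ (fderiv ℝ (fun w => f (τ, w))) z := by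
      refine DifferentiableAt.congr_of_eventuallyEq ?_ h3
      refine DifferentiableAt.clm_comp ?_ (differentiableAt_const _)
      exact (continuousMultilinearCurryFin1 ℝ (ℂ × (Fin n → ℂ)) ℝ).differentiableAt.comp z
        h2.differentiableAt
    have h5 : hess (fun w => f (τ, w)) z ξ ξ =
        fderiv ℝ (fun w => fderiv ℝ (fun w => f (τ, w)) w ξ) z ξ := by
      rw [fderiv_clm_apply h4 (differentiableAt_const ξ)]
      simp [hess]
    have h6 : (fun w => fderiv ℝ (fun w => f (τ, w)) w ξ) =ᶠ[𝓝 z] fun w =>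
        P (τ, w) 1 (fun _ => ((0, ξ) : ℂ × (Fin n → ℂ))) := by
      filter_upwards [h3] with w hw
      rw [hw]
      simp [continuousMultilinearCurryFin1]
      congr
      funext i
      rw [Fin.fin_one_eq_zero i]
      rfl
    have h7 : HasFDerivAt (fun w => P (τ, w) 1 (fun _ => ((0, ξ) : ℂ × (Fin n → ℂ))))
        ((ContinuousMultilinearMap.apply ℝ (fun _ : Fin 1 => ℂ × (Fin n → ℂ)) ℝ
          (fun _ => ((0, ξ) : ℂ × (Fin n → ℂ)))).comp
          ((P (τ, z) 2).curryLeft.comp (ContinuousLinearMap.inr ℝ ℂ (Fin n → ℂ)))) z :=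
      (ContinuousMultilinearMap.apply ℝ (fun _ : Fin 1 => ℂ × (Fin n → ℂ)) ℝ
          (fun _ => ((0, ξ) : ℂ × (Fin n → ℂ)))).hasFDerivAt.comp z h2
    rw [h5, h6.fderiv_eq, h7.fderiv]
    simp
    congr
    funext i
    exact Fin.cases rfl (fun i => rfl) i
  have hAB' : (A ×ˢ B) ×ˢ (univ : Set (Fin n → ℂ)) ∈
      𝓝[(T ×ˢ O) ×ˢ univ] ((τ0, z0), ξ0) := by
    rw [nhdsWithin_prod_eq, nhdsWithin_prod_eq, hO.nhdsWithin_eq hz0]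
    exact prod_mem_prod (prod_mem_prod hA (hBo.mem_nhds hzB)) univ_mem
  have hmem : ((τ0, z0) : ℂ × (Fin n → ℂ)) ∈ A ×ˢ B := ⟨mem_of_mem_nhdsWithin hτ0 hA, hzB⟩
  have hcont : ContinuousOn (fun q : (ℂ × (Fin n → ℂ)) × (Fin n → ℂ) =>
      P q.1 2 (fun _ => ((0, q.2) : ℂ × (Fin n → ℂ)))) ((A ×ˢ B) ×ˢ univ) := by
    have h1 : ContinuousOn (fun q : (ℂ × (Fin n → ℂ)) × (Fin n → ℂ) => P q.1 2)
        ((A ×ˢ B) ×ˢ univ) := (hP'.cont 2 le_rfl).comp continuous_fst.continuousOn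
      (fun q hq => hq.1)
    have h2 : Continuous (fun q : (ℂ × (Fin n → ℂ)) × (Fin n → ℂ) =>
        (fun _ : Fin 2 => ((0, q.2) : ℂ × (Fin n → ℂ)))) :=
      continuous_pi fun _ => by fun_prop
    exact h1.eval h2.continuousOn
  refine ContinuousWithinAt.mono_of_mem_nhdsWithin ?_ hAB'
  exact (hcont _ ⟨hmem, mem_univ ξ0⟩).congr (fun q hq => key q.1 hq.1 q.2) (key _ hmem ξ0)

end Closure

/-! ### Minima over the unit sphere bundle of a compact manifold. -/

section Compactness

variable {n : ℕ} {V : Type*} [TopologicalSpace V] [ChartedSpace (Fin n → ℂ) V]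

/-- The quadratic form of the metric in the chart `e`. -/
def metricForm (ω : ConstantMetric n V) (e : OpenPartialHomeomorph V (Fin n → ℂ))
    (ξ : Fin n → ℂ) : ℝ := (hForm (ω.coeff e) ξ ξ).re

theorem metricForm_pos (ω : ConstantMetric n V) {e : OpenPartialHomeomorph V (Fin n → ℂ)}
    (he : e ∈ atlas (Fin n → ℂ) V) {ξ : Fin n → ℂ} (hξ : ξ ≠ 0) : 0 < metricForm ω e ξ :=
  (posDef_iff_hForm.1 (ω.posDef e he)).2 ξ hξ

theorem metricForm_smul (ω : ConstantMetric n V) (e : OpenPartialHomeomorph V (Fin n → ℂ))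
    (t : ℝ) (ξ : Fin n → ℂ) : metricForm ω e (t • ξ) = t ^ 2 * metricForm ω e ξ := by
  have : t • ξ = (t : ℂ) • ξ := by
    ext
    simp
  rw [this, metricForm, hForm_smul_left, hForm_smul_right, metricForm]
  simp
  ring

theorem constForm_smul (ω : ConstantMetric n V) (S : ConstantTensor n V)
    (e : OpenPartialHomeomorph V (Fin n → ℂ))
    (t : ℝ) (ξ : Fin n → ℂ) : constForm ω S e (t • ξ) = t ^ 2 * constForm ω S e ξ := by
  have h : t • ξ = (t : ℂ) • ξ := by
    ext
    simp
  have h1 := metricForm_smul ω e t ξ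
  rw [metricForm, metricForm] at h1
  rw [constForm, constForm, h1, h, sForm_smul_left, sForm_smul_right]
  simp
  ring

theorem convexForm_smul (ω : ConstantMetric n V) (S : ConstantTensor n V) (φ : V → ℝ)
    (e : OpenPartialHomeomorph V (Fin n → ℂ)) (z : Fin n → ℂ) (t : ℝ) (ξ : Fin n → ℂ) :
    convexForm ω S φ e z (t • ξ) = t ^ 2 * convexForm ω S φ e z ξ := by
  rw [convexForm, convexForm, constForm_smul]
  simp
  ring

theorem continuous_metricForm (ω : ConstantMetric n V)
    (e : OpenPartialHomeomorph V (Fin n → ℂ)) : Continuous (metricForm ω e) := by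
  unfold metricForm hForm
  simp only [dotProduct, Matrix.mulVec]
  fun_prop

theorem continuous_constForm (ω : ConstantMetric n V) (S : ConstantTensor n V)
    (e : OpenPartialHomeomorph V (Fin n → ℂ)) : Continuous (constForm ω S e) := by
  unfold constForm hForm sForm
  simp only [dotProduct, Matrix.mulVec]
  fun_prop

theorem exists_metricForm_coercive (ω : ConstantMetric n V)
    {e : OpenPartialHomeomorph V (Fin n → ℂ)} (he : e ∈ atlas (Fin n → ℂ) V) :
    ∃ c > 0, ∀ ξ, c * ‖ξ‖ ^ 2 ≤ metricForm ω e ξ := by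
  rcases subsingleton_or_nontrivial (Fin n → ℂ) with hX | hX
  · refine ⟨1, one_pos, fun x => ?_⟩
    rw [Subsingleton.elim x 0]
    simp [metricForm, hForm]
  · obtain ⟨y, hy, hmin⟩ := (isCompact_sphere (0 : Fin n → ℂ) 1).exists_isMinOn
      (NormedSpace.sphere_nonempty.2 zero_le_one) (continuous_metricForm ω e).continuousOn
    have hy0 : y ≠ 0 := by
      rintro rfl
      simp at hy
    refine ⟨metricForm ω e y, metricForm_pos ω he hy0, fun x => ?_⟩
    rcases eq_or_ne x 0 with rfl | hx
    · simp [metricForm, hForm]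
    have hn : ‖x‖ ≠ 0 := norm_ne_zero_iff.2 hx
    have h1 : (‖x‖⁻¹ • x) ∈ Metric.sphere (0 : Fin n → ℂ) 1 := by
      simp [norm_smul, hn]
    have h2 := hmin h1
    simp only [mem_ofPred_eq, metricForm_smul] at h2
    have h3 := mul_le_mul_of_nonneg_right h2 (sq_nonneg ‖x‖)
    field_simp at h3
    exact h3

theorem isCompact_metric_sphere (ω : ConstantMetric n V)
    {e : OpenPartialHomeomorph V (Fin n → ℂ)} (he : e ∈ atlas (Fin n → ℂ) V) :
    IsCompact {ξ | metricForm ω e ξ = 1} := by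
  obtain ⟨c, hc, hcoer⟩ := exists_metricForm_coercive ω he
  refine Metric.isCompact_of_isClosed_isBounded
    (isClosed_eq (continuous_metricForm ω e) continuous_const) ?_
  refine (Metric.isBounded_closedBall (x := 0) (r := c⁻¹ + 1)).subset fun ξ hξ => ?_
  have h1 := hcoer ξ
  rw [show metricForm ω e ξ = 1 from hξ] at h1
  rw [mem_closedBall_zero_iff]
  by_contra! h
  have h2 : 0 < c⁻¹ := inv_pos.2 hc
  have h3 : 1 < c * ‖ξ‖ := by
    have := mul_lt_mul_of_pos_left h hc
    rw [mul_add, mul_inv_cancel₀ hc.ne'] at this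
    linarith
  have h4 : 1 ≤ ‖ξ‖ := by linarith
  nlinarith

/-- A finite cover of a compact manifold by compact subsets of coordinate charts. -/
theorem exists_finite_compact_cover [CompactSpace V] : ∃ (t : Finset V) (K : V → Set (Fin n → ℂ)),
    (∀ x, IsCompact (K x)) ∧ (∀ x, K x ⊆ (chartAt (Fin n → ℂ) x).target) ∧
      ∀ v : V, ∃ x ∈ t, v ∈ (chartAt (Fin n → ℂ) x).source ∧ chartAt (Fin n → ℂ) x v ∈ K x := by
  have hK : ∀ x : V, ∃ K : Set (Fin n → ℂ), IsCompact K ∧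
      chartAt (Fin n → ℂ) x x ∈ interior K ∧ K ⊆ (chartAt (Fin n → ℂ) x).target := fun x =>
    exists_compact_subset (chartAt (Fin n → ℂ) x).open_target (mem_chart_target _ x)
  choose K hKc hxK hKt using hK
  let N : V → Set V := fun x =>
    (chartAt (Fin n → ℂ) x).source ∩ chartAt (Fin n → ℂ) x ⁻¹' K x
  have hN : ∀ x, N x ∈ 𝓝 x := fun x =>
    inter_mem (chart_source_mem_nhds _ x)
      (((chartAt (Fin n → ℂ) x).continuousAt (mem_chart_source _ x)).preimage_mem_nhds
        (mem_interior_iff_mem_nhds.1 (hxK x)))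
  obtain ⟨t, ht⟩ := CompactSpace.elim_nhds_subcover N hN
  refine ⟨t, K, hKc, hKt, fun v => ?_⟩
  obtain ⟨x, hxt, hx⟩ := mem_iUnion₂.1 (ht ▸ mem_univ v : v ∈ ⋃ x ∈ t, N x)
  exact ⟨x, hxt, hx⟩

/-- A function on the unit sphere bundle of `T × V`, given in charts, attains its minimum. -/
theorem exists_isLeast_sphereBundle [CompactSpace V] (ω : ConstantMetric n V) {T : Set ℂ}
    (hT : IsCompact T) (ρ : ℂ → OpenPartialHomeomorph V (Fin n → ℂ) → (Fin n → ℂ) → (Fin n → ℂ) → ℝ)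
    (hcont : ∀ e ∈ atlas (Fin n → ℂ) V, ContinuousOn
      (fun q : (ℂ × (Fin n → ℂ)) × (Fin n → ℂ) => ρ q.1.1 e q.1.2 q.2) ((T ×ˢ e.target) ×ˢ univ))
    (hinv : ∀ e ∈ atlas (Fin n → ℂ) V, ∀ e' ∈ atlas (Fin n → ℂ) V, ∀ x ∈ e.source ∩ e'.source,
      ∀ ξ, metricForm ω e ξ = 1 → ∃ ξ', metricForm ω e' ξ' = 1 ∧
        ∀ τ ∈ T, ρ τ e (e x) ξ = ρ τ e' (e' x) ξ')
    (hne : ∃ τ ∈ T, ∃ e ∈ atlas (Fin n → ℂ) V, ∃ z ∈ e.target, ∃ ξ, metricForm ω e ξ = 1) :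
    ∃ τ ∈ T, ∃ e ∈ atlas (Fin n → ℂ) V, ∃ z ∈ e.target, ∃ ξ, metricForm ω e ξ = 1 ∧
      ∀ τ' ∈ T, ∀ e' ∈ atlas (Fin n → ℂ) V, ∀ z' ∈ e'.target, ∀ ξ', metricForm ω e' ξ' = 1 →
        ρ τ e z ξ ≤ ρ τ' e' z' ξ' := by
  obtain ⟨t, K, hKc, hKt, ht⟩ := exists_finite_compact_cover (n := n) (V := V)
  -- Finitely many charts suffice: by `hinv` every value of `ρ` in any chart is one of the values
  -- over this finite union of compact sets.
  let A : Set ℝ := ⋃ x ∈ t, (fun q : (ℂ × (Fin n → ℂ)) × (Fin n → ℂ) =>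
    ρ q.1.1 (chartAt (Fin n → ℂ) x) q.1.2 q.2) ''
      ((T ×ˢ K x) ×ˢ {ξ | metricForm ω (chartAt (Fin n → ℂ) x) ξ = 1})
  have hA : IsCompact A := by
    refine t.isCompact_biUnion fun x _ => IsCompact.image_of_continuousOn
      ((hT.prod (hKc x)).prod (isCompact_metric_sphere ω (chart_mem_atlas _ x))) ?_
    exact (hcont _ (chart_mem_atlas _ x)).mono
      (prod_mono (prod_mono_right (hKt x)) (subset_univ _))
  have hval : ∀ τ' ∈ T, ∀ e' ∈ atlas (Fin n → ℂ) V, ∀ z' ∈ e'.target, ∀ ξ',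
      metricForm ω e' ξ' = 1 → ρ τ' e' z' ξ' ∈ A := by
    intro τ hτ e he z hz ξ hξ
    obtain ⟨x, hxt, hx⟩ := ht (e.symm z)
    obtain ⟨ξ', hξ', h2⟩ := hinv e he _ (chart_mem_atlas _ x) (e.symm z)
      ⟨e.map_target hz, hx.1⟩ ξ hξ
    rw [e.right_inv hz] at h2
    rw [h2 τ hτ]
    exact mem_iUnion₂.2 ⟨x, hxt, ((τ, _), ξ'), ⟨⟨hτ, hx.2⟩, hξ'⟩, rfl⟩
  obtain ⟨τ0, hτ0, e0, he0, z0, hz0, ξ0, hξ0⟩ := hne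
  obtain ⟨m, hmA, hm⟩ := hA.exists_isLeast ⟨_, hval τ0 hτ0 e0 he0 z0 hz0 ξ0 hξ0⟩
  obtain ⟨x, -, ⟨⟨τ, z⟩, ξ⟩, ⟨⟨hτ, hz⟩, hξ⟩, rfl⟩ := mem_iUnion₂.1 hmA
  exact ⟨τ, hτ, _, chart_mem_atlas _ x, z, hKt x hz, ξ, hξ, fun τ' hτ' e' he' z' hz' ξ' hξ' =>
    hm (hval τ' hτ' e' he' z' hz' ξ' hξ')⟩

/-- The minimum of `convexForm - w(τ)` on the unit sphere bundle is attained. -/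
theorem exists_min_convexForm [CompactSpace V] (hV : IsComplexAffine n V)
    (ω : ConstantMetric n V) (S : ConstantTensor n V) {T : Set ℂ} (hT : IsCompact T)
    {Φ : ℂ → V → ℝ}
    (hΦ : ∀ e ∈ atlas (Fin n → ℂ) V, ContDiffOn ℝ 2 (inChart Φ e) (T ×ˢ e.target))
    {w : ℂ → ℝ} (hw : Continuous w)
    (hne : ∃ τ ∈ T, ∃ e ∈ atlas (Fin n → ℂ) V, ∃ z ∈ e.target, ∃ ξ, metricForm ω e ξ = 1) :
    ∃ τ ∈ T, ∃ e ∈ atlas (Fin n → ℂ) V, ∃ z ∈ e.target, ∃ ξ, metricForm ω e ξ = 1 ∧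
      ∀ τ' ∈ T, ∀ e' ∈ atlas (Fin n → ℂ) V, ∀ z' ∈ e'.target, ∀ ξ', metricForm ω e' ξ' = 1 →
        convexForm ω S (Φ τ) e z ξ - w τ ≤ convexForm ω S (Φ τ') e' z' ξ' - w τ' := by
  refine exists_isLeast_sphereBundle ω hT
    (fun τ e z ξ => convexForm ω S (Φ τ) e z ξ - w τ) ?_ ?_ hne
  · intro e he
    have h1 := continuousOn_hess_slice e.open_target (hΦ e he)
    have h2 : Continuous fun q : (ℂ × (Fin n → ℂ)) × (Fin n → ℂ) => constForm ω S e q.2 :=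
      (continuous_constForm ω S e).comp continuous_snd
    have h3 : Continuous fun q : (ℂ × (Fin n → ℂ)) × (Fin n → ℂ) => w q.1.1 := by fun_prop
    exact (h2.continuousOn.add (h1.const_smul (1 / 2 : ℝ))).sub h3.continuousOn
  · rintro e he e' he' x ⟨hx, hx'⟩ ξ hξ
    obtain ⟨J, hJ1, -, hJ3⟩ := exists_chart_change hV ω S he he' hx hx'
    refine ⟨J ξ, (hJ1 ξ).symm.trans hξ, fun τ hτ => ?_⟩
    have h1 : ContDiffAt ℝ 2 (fun w => Φ τ (e'.symm w)) (e' x) :=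
      ((hΦ e' he').slice hτ).contDiffAt (e'.open_target.mem_nhds (e'.map_source hx'))
    show convexForm ω S (Φ τ) e (e x) ξ - w τ = convexForm ω S (Φ τ) e' (e' x) (J ξ) - w τ
    rw [hJ3 _ h1]

end Compactness
end

noncomputable section

/-! ### From boundary to interior lower bounds. -/

section LowerBound

variable {n : ℕ} {V : Type*} [TopologicalSpace V] [ChartedSpace (Fin n → ℂ) V]

theorem real_smul_eq_complex_smul (t : ℝ) (v : Fin n → ℂ) : t • v = (t : ℂ) • v := by
  ext
  simp

/-- The polarization of `2 * constForm` as a bilinear form on `ℂ × ℂⁿ`. -/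
def constBilin (ω : ConstantMetric n V) (S : ConstantTensor n V)
    (e : OpenPartialHomeomorph V (Fin n → ℂ)) :
    (ℂ × (Fin n → ℂ)) →L[ℝ] (ℂ × (Fin n → ℂ)) →L[ℝ] ℝ :=
  (LinearMap.mk₂ ℝ (fun v w : ℂ × (Fin n → ℂ) =>
      2 * ((hForm (ω.coeff e) v.2 w.2).re - (sForm (S.coeff e) v.2 w.2).re))
    (fun v v' w => by simp [hForm_add_left, sForm_add_left]; ring)
    (fun t v w => by
      simp only [Prod.smul_snd, real_smul_eq_complex_smul, hForm_smul_left, sForm_smul_left,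
        Complex.re_ofReal_mul, smul_eq_mul]
      ring)
    (fun v w w' => by simp [hForm_add_right, sForm_add_right]; ring)
    (fun t v w => by
      simp only [Prod.smul_snd, real_smul_eq_complex_smul, hForm_smul_right, sForm_smul_right,
        Complex.re_ofReal_mul, smul_eq_mul, Complex.star_def, Complex.conj_ofReal]
      ring)).toContinuousBilinearMap

theorem constBilin_apply (ω : ConstantMetric n V) (S : ConstantTensor n V)
    (e : OpenPartialHomeomorph V (Fin n → ℂ)) (v w : ℂ × (Fin n → ℂ)) :
    constBilin ω S e v w =
      2 * ((hForm (ω.coeff e) v.2 w.2).re - (sForm (S.coeff e) v.2 w.2).re) := rfl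

/-- The polarization of `2 * metricForm`. -/
def metricBilin (ω : ConstantMetric n V) (e : OpenPartialHomeomorph V (Fin n → ℂ)) :
    (Fin n → ℂ) →L[ℝ] (Fin n → ℂ) →L[ℝ] ℝ :=
  (LinearMap.mk₂ ℝ (fun v w : Fin n → ℂ => 2 * (hForm (ω.coeff e) v w).re)
    (fun v v' w => by simp [hForm_add_left]; ring)
    (fun t v w => by
      simp only [real_smul_eq_complex_smul, hForm_smul_left, Complex.re_ofReal_mul, smul_eq_mul]
      ring)
    (fun v w w' => by simp [hForm_add_right]; ring)
    (fun t v w => by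
      simp only [real_smul_eq_complex_smul, hForm_smul_right,
        Complex.re_ofReal_mul, smul_eq_mul, Complex.star_def, Complex.conj_ofReal]
      ring)).toContinuousBilinearMap

theorem metricBilin_apply (ω : ConstantMetric n V)
    (e : OpenPartialHomeomorph V (Fin n → ℂ)) (v w : Fin n → ℂ) :
    metricBilin ω e v w = 2 * (hForm (ω.coeff e) v w).re := rfl

/-- The real linear form `c ↦ 2 Re ∑ c_i y_i`. -/
def reDotForm (y : Fin n → ℂ) : (Fin n → ℂ) →L[ℝ] ℝ :=
  LinearMap.toContinuousLinearMap
    { toFun := fun c => 2 * (c ⬝ᵥ y).re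
      map_add' := fun c d => by simp [add_dotProduct]; ring
      map_smul' := fun t c => by
        simp only [real_smul_eq_complex_smul, smul_dotProduct, smul_eq_mul, Complex.re_ofReal_mul,
          RingHom.id_apply]
        ring }

theorem reDotForm_apply (y c : Fin n → ℂ) : reDotForm y c = 2 * (c ⬝ᵥ y).re := rfl

/-- The `S` part changes sign under multiplication by `i` and drops out of the Levi form. Hence
adding `constBilin` to the Hessian serves both the equation and the convexity form. -/
theorem leviForm_constBilin (ω : ConstantMetric n V) (S : ConstantTensor n V)
    (e : OpenPartialHomeomorph V (Fin n → ℂ)) (T : (ℂ × (Fin n → ℂ)) →L[ℝ] (ℂ × (Fin n → ℂ)) →L[ℝ] ℝ)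
    (v : ℂ × (Fin n → ℂ)) :
    leviForm (T + constBilin ω S e) v v = metricForm ω e v.2 + leviForm T v v := by
  rw [leviForm_apply, leviForm_apply, add_apply, add_apply, add_apply, add_apply,
    constBilin_apply, constBilin_apply, Prod.smul_snd, hForm_smul_left, hForm_smul_right,
    sForm_smul_left, sForm_smul_right, ← mul_assoc, ← mul_assoc, metricForm]
  simp
  ring

theorem leviForm_eq_fullMatrix (ω : ConstantMetric n V) (S : ConstantTensor n V) {Φ : ℂ → V → ℝ}
    {e : OpenPartialHomeomorph V (Fin n → ℂ)} {p : ℂ × (Fin n → ℂ)}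
    (hΦ : ContDiffAt ℝ 2 (inChart Φ e) p) (a : ℂ) (x : Fin n → ℂ) :
    leviForm (hess (inChart Φ e) p + constBilin ω S e) (a, x) (a, x) =
      (hForm (fullMatrix ω Φ e p) (Fin.cons a x) (Fin.cons a x)).re := by
  rw [leviForm_constBilin, re_hForm_fullMatrix ω hΦ]
  rfl

/-- Matches the notation of `no_interior_min`: index `0` carries the vector (1, a) with weight `1`
and no linear term, the other indices the vectors (0, c k) with weight `r`. -/
theorem sum_levi_eq_trialValue (ω : ConstantMetric n V) (S : ConstantTensor n V) {Φ : ℂ → V → ℝ}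
    {e : OpenPartialHomeomorph V (Fin n → ℂ)} {p : ℂ × (Fin n → ℂ)}
    (hΦ : ContDiffAt ℝ 2 (inChart Φ e) p) (r : ℝ) (y : Fin n → Fin n → ℂ)
    (x : Fin (n + 1) → Fin n → ℂ) :
    ∑ k, (Fin.cons 1 (fun _ => r) : Fin (n + 1) → ℝ) k *
      (leviForm (hess (inChart Φ e) p + constBilin ω S e)
        ((Fin.cons (1, 0) (fun _ => 0) : Fin (n + 1) → ℂ × (Fin n → ℂ)) k + (0, x k))
        ((Fin.cons (1, 0) (fun _ => 0) : Fin (n + 1) → ℂ × (Fin n → ℂ)) k + (0, x k)) -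
        (Fin.cons 0 (fun k => reDotForm (y k)) : Fin (n + 1) → (Fin n → ℂ) →L[ℝ] ℝ) k (x k)) =
    trialValue r y (fullMatrix ω Φ e p) (x 0) (fun k => x k.succ) := by
  rw [Fin.sum_univ_succ, trialValue]
  simp only [Fin.cons_zero, Fin.cons_succ, Prod.mk_add_mk, add_zero, zero_add, one_mul,
    zero_apply, sub_zero, leviForm_eq_fullMatrix ω S hΦ, reDotForm_apply, Finset.mul_sum]

theorem convexForm_eq_hess (ω : ConstantMetric n V) (S : ConstantTensor n V) {Φ : ℂ → V → ℝ}
    {e : OpenPartialHomeomorph V (Fin n → ℂ)} {p : ℂ × (Fin n → ℂ)}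
    (hΦ : ContDiffAt ℝ 2 (inChart Φ e) p) (x : Fin n → ℂ) :
    (hess (inChart Φ e) p + constBilin ω S e) (0, x) (0, x) =
      2 * convexForm ω S (Φ p.1) e p.2 x := by
  have h1 : hess (fun w => Φ p.1 (e.symm w)) p.2 x x = hess (inChart Φ e) p (0, x) (0, x) :=
    hess_slice (f := inChart Φ e) (τ := p.1) (z := p.2) hΦ x x
  rw [add_apply, add_apply, constBilin_apply, convexForm, h1, constForm]
  ring

theorem IsPerturbedSolution.exists_trialValue {m : ℕ} {V : Type*} [TopologicalSpace V]
    [ChartedSpace (Fin (m + 1) → ℂ) V] {R : Set ℂ} {ω : ConstantMetric (m + 1) V} {ε : ℝ}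
    (hε : 0 < ε) {F Φ : ℂ → V → ℝ} (hΦ : IsPerturbedSolution R ω ε F Φ)
    {e : OpenPartialHomeomorph V (Fin (m + 1) → ℂ)} (he : e ∈ atlas (Fin (m + 1) → ℂ) V)
    {y : Fin (m + 1) → Fin (m + 1) → ℂ}
    (hy : ∀ i j, ∑ k, y k i * star (y k j) = ω.coeff e i j)
    {p : ℂ × (Fin (m + 1) → ℂ)} (hp : p ∈ R ×ˢ e.target) :
    (∀ a c, 0 ≤ trialValue (ε * m.factorial / (m + 2).factorial) y (fullMatrix ω Φ e p) a c) ∧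
      ∃ a c, trialValue (ε * m.factorial / (m + 2).factorial) y (fullMatrix ω Φ e p) a c = 0 :=
  trialValue_of_equation (hΦ.posDef e he p hp) hy hε (hΦ.equation e he p hp)

theorem exists_unit_vector (ω : ConstantMetric n V)
    {e : OpenPartialHomeomorph V (Fin n → ℂ)} (he : e ∈ atlas (Fin n → ℂ) V) {ξ : Fin n → ℂ}
    (hξ : ξ ≠ 0) : ∃ t : ℝ, 0 < t ∧ t ^ 2 * metricForm ω e ξ = 1 ∧ metricForm ω e (t • ξ) = 1 := by
  have h := metricForm_pos ω he hξ
  have h1 : (√(metricForm ω e ξ))⁻¹ ^ 2 * metricForm ω e ξ = 1 := by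
    rw [inv_pow, Real.sq_sqrt h.le, inv_mul_cancel₀ h.ne']
  exact ⟨(√(metricForm ω e ξ))⁻¹, inv_pos.2 (Real.sqrt_pos.2 h), h1, by rw [metricForm_smul, h1]⟩

theorem convexForm_ge_of_unit (ω : ConstantMetric n V) (S : ConstantTensor n V) {φ : V → ℝ}
    {e : OpenPartialHomeomorph V (Fin n → ℂ)} (he : e ∈ atlas (Fin n → ℂ) V) {z : Fin n → ℂ}
    {c : ℝ} (h : ∀ ξ, metricForm ω e ξ = 1 → c ≤ convexForm ω S φ e z ξ) (ξ : Fin n → ℂ) :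
    c * metricForm ω e ξ ≤ convexForm ω S φ e z ξ := by
  rcases eq_or_ne ξ 0 with rfl | hξ
  · simp [metricForm, hForm, convexForm, constForm, sForm]
  · obtain ⟨t, ht, h1, h2⟩ := exists_unit_vector ω he hξ
    have h3 := h _ h2
    rw [convexForm_smul] at h3
    have h4 : t ^ 2 * (c * metricForm ω e ξ) ≤ t ^ 2 * convexForm ω S φ e z ξ := by
      calc t ^ 2 * (c * metricForm ω e ξ) = c * (t ^ 2 * metricForm ω e ξ) := by ring
        _ = c := by rw [h1, mul_one]
        _ ≤ _ := h3
    exact le_of_mul_le_mul_left h4 (by positivity)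

/-- Weak minimum principle: a lower bound of the convexity form on the boundary holds in the
interior, as long as the form is positive. -/
theorem convexForm_ge_of_boundary {m : ℕ} {V : Type*} [TopologicalSpace V] [CompactSpace V]
    [ChartedSpace (Fin (m + 1) → ℂ) V] (hV : IsComplexAffine (m + 1) V)
    (ω : ConstantMetric (m + 1) V) (S : ConstantTensor (m + 1) V) {R : Set ℂ} (hRo : IsOpen R)
    (hRb : Bornology.IsBounded R) {ε : ℝ} (hε : 0 < ε) {F Φ : ℂ → V → ℝ}
    (hΦ : IsPerturbedSolution R ω ε F Φ)
    (hcd : ∀ e ∈ atlas (Fin (m + 1) → ℂ) V,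
      ContDiffOn ℝ 2 (inChart Φ e) (closure R ×ˢ e.target))
    (hpos : ∀ τ ∈ closure R, ∀ e ∈ atlas (Fin (m + 1) → ℂ) V, ∀ z ∈ e.target, ∀ ξ, ξ ≠ 0 →
      0 < convexForm ω S (Φ τ) e z ξ) {c : ℝ}
    (hbdry : ∀ τ ∈ frontier R, ∀ e ∈ atlas (Fin (m + 1) → ℂ) V, ∀ z ∈ e.target, ∀ ξ,
      c * metricForm ω e ξ ≤ convexForm ω S (Φ τ) e z ξ) :
    ∀ τ ∈ closure R, ∀ e ∈ atlas (Fin (m + 1) → ℂ) V, ∀ z ∈ e.target, ∀ ξ,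
      c * metricForm ω e ξ ≤ convexForm ω S (Φ τ) e z ξ := by
  intro τ hτ e he z hz
  refine convexForm_ge_of_unit ω S he fun ξ hξ => ?_
  by_contra! hlt
  have hK : IsCompact (closure R) := hRb.isCompact_closure
  have hne : ∃ τ ∈ closure R, ∃ e ∈ atlas (Fin (m + 1) → ℂ) V, ∃ z ∈ e.target, ∃ ξ,
    metricForm ω e ξ = 1 := ⟨τ, hτ, e, he, z, hz, ξ, hξ⟩
  have hunit : ∀ (e : OpenPartialHomeomorph V (Fin (m + 1) → ℂ)) (ξ : Fin (m + 1) → ℂ),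
      metricForm ω e ξ = 1 → ξ ≠ 0 := by
    rintro e ξ h rfl
    simp [metricForm, hForm] at h
  obtain ⟨τ1, hτ1, e1, he1, z1, hz1, ξ1, hξ1, hmin1⟩ :=
    exists_min_convexForm hV ω S hK hcd (w := fun _ => 0) continuous_const hne
  simp only [sub_zero] at hmin1
  set m0 := convexForm ω S (Φ τ1) e1 z1 ξ1 with hm0
  have hm0pos : 0 < m0 := hpos τ1 hτ1 e1 he1 z1 hz1 ξ1 (hunit _ _ hξ1)
  have hm0c : m0 < c := (hmin1 τ hτ e he z hz ξ hξ).trans_lt hlt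
  obtain ⟨D, hD0, hD⟩ : ∃ D > 0, ∀ τ ∈ closure R, ‖τ‖ ^ 2 ≤ D := by
    obtain ⟨C, hC⟩ := hK.isBounded.exists_norm_le
    refine ⟨C ^ 2 + 1, by positivity, fun τ hτ => ?_⟩
    have := hC τ hτ
    nlinarith [norm_nonneg τ]
  -- δD < c - m0 keeps the minimum of the form minus δ|τ|² away from the boundary; 4δD < m0 is the
  -- smallness required by `no_interior_min`, and it is here that m0 > 0 is needed.
  obtain ⟨δ, hδ, hδ1, hδ2⟩ : ∃ δ > 0, δ * D < c - m0 ∧ 4 * (δ * D) < m0 := by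
    refine ⟨min (c - m0) (m0 / 4) / (2 * D), ?_, ?_⟩
    · have : 0 < min (c - m0) (m0 / 4) := lt_min (by linarith) (by linarith)
      positivity
    · have h1 : min (c - m0) (m0 / 4) / (2 * D) * D = min (c - m0) (m0 / 4) / 2 := by
        field_simp
      rw [h1]
      have h2 := min_le_left (c - m0) (m0 / 4)
      have h3 := min_le_right (c - m0) (m0 / 4)
      constructor <;> linarith
  obtain ⟨τ0, hτ0, e0, he0, z0, hz0, ξ0, hξ0, hmin⟩ :=
    exists_min_convexForm hV ω S hK hcd (w := fun τ => δ * ‖τ‖ ^ 2) (by fun_prop) hne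
  have hle := hmin τ1 hτ1 e1 he1 z1 hz1 ξ1 hξ1
  rw [← hm0] at hle
  have hδτ : ∀ τ ∈ closure R, δ * ‖τ‖ ^ 2 ≤ δ * D := fun τ hτ =>
    mul_le_mul_of_nonneg_left (hD τ hτ) hδ.le
  have hτR : τ0 ∈ R := by
    by_contra hnot
    have hfr : τ0 ∈ frontier R := by
      rw [hRo.frontier_eq]
      exact ⟨hτ0, hnot⟩
    have h1 := hbdry τ0 hfr e0 he0 z0 hz0 ξ0
    rw [hξ0, mul_one] at h1
    have h2 := hδτ τ0 hτ0
    have h3 : 0 ≤ δ * ‖τ1‖ ^ 2 := by positivity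
    linarith
  set μ := convexForm ω S (Φ τ0) e0 z0 ξ0 with hμ
  have hμm : m0 ≤ μ := hmin1 τ0 hτ0 e0 he0 z0 hz0 ξ0 hξ0
  have hnhds : ∀ᶠ q in 𝓝 ((τ0, z0) : ℂ × (Fin (m + 1) → ℂ)), q ∈ R ×ˢ e0.target :=
    (hRo.prod e0.open_target).mem_nhds ⟨hτR, hz0⟩
  have hcd4 : ∀ q ∈ R ×ˢ e0.target, ContDiffAt ℝ 4 (inChart Φ e0) q := fun q hq =>
    (hΦ.contDiff e0 he0).contDiffAt ((hRo.prod e0.open_target).mem_nhds hq)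
  have hcd2 : ∀ q ∈ R ×ˢ e0.target, ContDiffAt ℝ 2 (inChart Φ e0) q := fun q hq =>
    (hcd4 q hq).of_le (by norm_num)
  obtain ⟨y, hy⟩ := exists_frame (ω.posDef e0 he0)
  set r : ℝ := ε * m.factorial / (m + 2).factorial with hr
  have hr0 : 0 < r := by positivity
  have hp0 : ((τ0, z0) : ℂ × (Fin (m + 1) → ℂ)) ∈ R ×ˢ e0.target := ⟨hτR, hz0⟩
  -- The data are `T0 = constBilin`, κ = 0 and `B = metricBilin`; both bilinear forms carry a factor
  -- 2, so the minimum value is μ again.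
  refine no_interior_min (K := Fin (m + 2)) (f := inChart Φ e0) (p := (τ0, z0))
    (hcd4 _ hp0) (constBilin ω S e0) ?_
    (Fin.cons 1 (fun _ => r)) ?_ (Fin.cons (1, 0) (fun _ => 0))
    (Fin.cons 0 (fun k => reDotForm (y k))) 0 ?_ ?_ ?_ ⟨0, by simp⟩
    (metricBilin ω e0) ?_ ?_ ξ0 ?_ μ δ hδ ?_ ?_ ?_
  · intro v w
    rw [constBilin_apply, constBilin_apply, re_hForm_comm (ω.posDef e0 he0).1,
      sForm_comm (S.symmetric e0 he0)]
  · intro k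
    refine Fin.cases ?_ (fun k => ?_) k
    · simp
    · simpa using hr0
  · filter_upwards [hnhds] with q hq x
    rw [sum_levi_eq_trialValue ω S (hcd2 q hq)]
    exact (hΦ.exists_trialValue hε he0 hy hq).1 _ _
  · filter_upwards [hnhds] with q hq
    obtain ⟨a, b, hab⟩ := (hΦ.exists_trialValue hε he0 hy hq).2
    refine ⟨Fin.cons a b, ?_⟩
    rw [sum_levi_eq_trialValue ω S (hcd2 q hq)]
    simpa using hab
  · intro x hx
    rw [leviForm_eq_fullMatrix ω S (hcd2 _ hp0)]
    refine (posDef_iff_hForm.1 (hΦ.posDef e0 he0 _ hp0)).2 _ fun h => hx ?_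
    ext i
    have := congrFun h i.succ
    simpa using this
  · intro v w
    rw [metricBilin_apply, metricBilin_apply, re_hForm_comm (ω.posDef e0 he0).1]
  · intro v
    rw [metricBilin_apply]
    exact mul_nonneg zero_le_two ((ω.posDef e0 he0).hForm_nonneg v)
  · rw [metricBilin_apply]
    have : (hForm (ω.coeff e0) ξ0 ξ0).re = 1 := hξ0
    rw [this]
    norm_num
  · have := hδτ τ0 hτ0
    show 4 * δ * ‖τ0‖ ^ 2 < μ
    linarith
  · filter_upwards [hnhds] with q hq x
    rw [convexForm_eq_hess ω S (hcd2 q hq), metricBilin_apply]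
    have h1 : ∀ ξ, metricForm ω e0 ξ = 1 →
        μ + δ * (‖q.1‖ ^ 2 - ‖τ0‖ ^ 2) ≤ convexForm ω S (Φ q.1) e0 q.2 ξ := fun ξ hξ => by
      have := hmin q.1 (subset_closure hq.1) e0 he0 q.2 hq.2 ξ hξ
      linarith
    have h2 := convexForm_ge_of_unit ω S he0 h1 x
    have h3 : metricForm ω e0 x = (hForm (ω.coeff e0) x x).re := rfl
    rw [h3] at h2
    show (μ + δ * (‖q.1‖ ^ 2 - ‖τ0‖ ^ 2)) * (2 * (hForm (ω.coeff e0) x x).re) ≤ _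
    linarith
  · rw [convexForm_eq_hess ω S (hcd2 _ hp0), metricBilin_apply]
    have : (hForm (ω.coeff e0) ξ0 ξ0).re = 1 := hξ0
    rw [this]
    show 2 * μ = μ * (2 * 1)
    ring

end LowerBound

end

noncomputable section

/-! ### Comparison principle and solutions constant along V. -/

section Comparison

theorem hasSecondDerivAtZero_line {E : Type*} [NormedAddCommGroup E] [NormedSpace ℝ E]
    {f : E → ℝ} {p : E} (hf : ContDiffAt ℝ 2 f p) (v : E) :
    HasSecondDerivAtZero (fun t => f (p + t • v)) (hess f p v v) := by
  have h1 : DifferentiableAt ℝ (fderiv ℝ f) p :=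
    (hf.fderiv_right (m := 1) (by norm_num)).differentiableAt (by simp)
  refine ⟨fun t => fderiv ℝ f (p + t • v) v, ?_, ?_⟩
  · filter_upwards [(tendsto_line p v).eventually (hf.eventually (by simp))] with t ht
    exact hasDerivAt_line_of_differentiableAt (ht.differentiableAt (by simp))
  · have h2 : HasDerivAt (fun t : ℝ => fderiv ℝ f (p + t • v))
        (fderiv ℝ (fderiv ℝ f) (p + (0 : ℝ) • v) v) 0 :=
      hasDerivAt_line_of_differentiableAt (by simpa using h1)
    have h3 := h2.clm_apply (hasDerivAt_const 0 v)
    simpa [hess] using h3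

theorem hess_nonpos_of_isLocalMax {E : Type*} [NormedAddCommGroup E] [NormedSpace ℝ E]
    {f : E → ℝ} {p : E} (hf : ContDiffAt ℝ 2 f p) (hmax : IsLocalMax f p) (v : E) :
    hess f p v v ≤ 0 := by
  have h1 := (hasSecondDerivAtZero_line hf v).const_mul (-1)
  have h2 : IsLocalMin (fun t : ℝ => -1 * f (p + t • v)) 0 := by
    filter_upwards [(tendsto_line p v).eventually hmax] with t ht
    simpa using ht
  have := h1.nonneg_of_isLocalMin h2
  linarith

theorem hasSecondDerivAtZero_norm_sq (τ e : ℂ) :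
    HasSecondDerivAtZero (fun t : ℝ => ‖τ + t • e‖ ^ 2) (2 * ‖e‖ ^ 2) := by
  have h1 := (HasSecondDerivAtZero.affine (‖τ‖ ^ 2) (2 * (τ.re * e.re + τ.im * e.im))).add
    (HasSecondDerivAtZero.sq (‖e‖ ^ 2))
  rw [zero_add] at h1
  convert h1 using 2 with t
  simp only [Complex.sq_norm, Complex.normSq_apply]
  simp
  ring

variable {m : ℕ} {V : Type*} [TopologicalSpace V] [ChartedSpace (Fin (m + 1) → ℂ) V]

/-- The gain `δ` comes from the single vector (1, a); the vectors (0, c k) have no τ-component. -/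
theorem trialValue_le_of_levi (ω : ConstantMetric (m + 1) V)
    {e : OpenPartialHomeomorph V (Fin (m + 1) → ℂ)} {Φ Ψ : ℂ → V → ℝ}
    {p : ℂ × (Fin (m + 1) → ℂ)} (hΦ : ContDiffAt ℝ 2 (inChart Φ e) p)
    (hΨ : ContDiffAt ℝ 2 (inChart Ψ e) p) {δ : ℝ}
    (h : ∀ v, leviForm (hess (inChart Φ e) p) v v + δ * ‖v.1‖ ^ 2 ≤
      leviForm (hess (inChart Ψ e) p) v v) {r : ℝ} (hr : 0 ≤ r)
    (y : Fin (m + 1) → Fin (m + 1) → ℂ) (a : Fin (m + 1) → ℂ)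
    (c : Fin (m + 1) → Fin (m + 1) → ℂ) :
    trialValue r y (fullMatrix ω Φ e p) a c + δ ≤ trialValue r y (fullMatrix ω Ψ e p) a c := by
  simp only [trialValue, re_hForm_fullMatrix ω hΦ, re_hForm_fullMatrix ω hΨ]
  have h1 := h (1, a)
  have h2 : ∀ k, leviForm (hess (inChart Φ e) p) (0, c k) (0, c k) ≤
      leviForm (hess (inChart Ψ e) p) (0, c k) (0, c k) := fun k => by
    have := h (0, c k)
    simpa using this
  have h3 : ∑ k, ((hForm (ω.coeff e) (c k) (c k)).re +
      leviForm (hess (inChart Φ e) p) (0, c k) (0, c k) - 2 * (c k ⬝ᵥ y k).re) ≤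
      ∑ k, ((hForm (ω.coeff e) (c k) (c k)).re +
      leviForm (hess (inChart Ψ e) p) (0, c k) (0, c k) - 2 * (c k ⬝ᵥ y k).re) :=
    Finset.sum_le_sum fun k _ => by linarith [h2 k]
  have h4 := mul_le_mul_of_nonneg_left h3 hr
  simp only [norm_one, one_pow, mul_one] at h1
  linarith

theorem exists_norm_sq_bound {K : Set ℂ} (hK : IsCompact K) :
    ∃ D > 0, ∀ τ ∈ K, ‖τ‖ ^ 2 ≤ D := by
  obtain ⟨C, hC⟩ := hK.isBounded.exists_norm_le
  refine ⟨C ^ 2 + 1, by positivity, fun τ hτ => ?_⟩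
  have := hC τ hτ
  nlinarith [norm_nonneg τ]

/-- Comparison principle for the perturbed problem. -/
theorem IsPerturbedSolution.le [CompactSpace V] {R : Set ℂ} (hRo : IsOpen R)
    (hRb : Bornology.IsBounded R) {ω : ConstantMetric (m + 1) V} {ε : ℝ} (hε : 0 < ε)
    {F G Φ Ψ : ℂ → V → ℝ} (hΦ : IsPerturbedSolution R ω ε F Φ)
    (hΨ : IsPerturbedSolution R ω ε G Ψ) (hFG : ∀ τ ∈ frontier R, ∀ x, F τ x ≤ G τ x) :
    ∀ τ ∈ closure R, ∀ x, Φ τ x ≤ Ψ τ x := by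
  intro τ1 hτ1 x1
  by_contra! hlt
  have hK : IsCompact (closure R) := hRb.isCompact_closure
  obtain ⟨D, hD0, hD⟩ := exists_norm_sq_bound hK
  set η := Φ τ1 x1 - Ψ τ1 x1 with hη
  have hη0 : 0 < η := sub_pos.2 hlt
  set δ := η / (2 * D) with hδ
  have hδ0 : 0 < δ := by positivity
  have hδD : δ * D < η := by
    have : δ * D = η / 2 := by
      rw [hδ]
      field_simp
    linarith
  -- As δD < η, the term δ|τ|² cannot move the maximum to the boundary; at an interior maximum it
  -- makes the Levi form of Ψ exceed that of Φ by `δ` in the τ-direction.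
  obtain ⟨⟨τ0, x0⟩, ⟨hτ0, -⟩, hmax⟩ := (hK.prod isCompact_univ).exists_isMaxOn
    (f := fun p : ℂ × V => Φ p.1 p.2 - Ψ p.1 p.2 + δ * ‖p.1‖ ^ 2)
    ⟨(τ1, x1), hτ1, mem_univ _⟩
    ((hΦ.continuous.sub hΨ.continuous).add (by fun_prop))
  have hle : η ≤ Φ τ0 x0 - Ψ τ0 x0 + δ * ‖τ0‖ ^ 2 := by
    have h1 := hmax (show (τ1, x1) ∈ closure R ×ˢ (univ : Set V) from ⟨hτ1, mem_univ _⟩)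
    have h2 : 0 ≤ δ * ‖τ1‖ ^ 2 := by positivity
    simp only [mem_ofPred_eq] at h1
    linarith
  have hτR : τ0 ∈ R := by
    by_contra hnot
    have hfr : τ0 ∈ frontier R := by
      rw [hRo.frontier_eq]
      exact ⟨hτ0, hnot⟩
    have h1 := hFG τ0 hfr x0
    rw [hΦ.boundary τ0 hfr, hΨ.boundary τ0 hfr] at hle
    have h2 := mul_le_mul_of_nonneg_left (hD τ0 hτ0) hδ0.le
    linarith
  set e := chartAt (Fin (m + 1) → ℂ) x0 with he
  have hea : e ∈ atlas (Fin (m + 1) → ℂ) V := chart_mem_atlas _ x0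
  have hx0 : x0 ∈ e.source := mem_chart_source _ x0
  set p : ℂ × (Fin (m + 1) → ℂ) := (τ0, e x0) with hp
  have hpm : p ∈ R ×ˢ e.target := ⟨hτR, e.map_source hx0⟩
  have hnh := (hRo.prod e.open_target).mem_nhds hpm
  have c1 : ContDiffAt ℝ 2 (inChart Φ e) p :=
    ((hΦ.contDiff e hea).contDiffAt hnh).of_le (by norm_num)
  have c2 : ContDiffAt ℝ 2 (inChart Ψ e) p :=
    ((hΨ.contDiff e hea).contDiffAt hnh).of_le (by norm_num)
  have hreal : ∀ v, hess (inChart Φ e) p v v + 2 * δ * ‖v.1‖ ^ 2 ≤ hess (inChart Ψ e) p v v := by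
    intro v
    have h1 := ((hasSecondDerivAtZero_line c2 v).sub (hasSecondDerivAtZero_line c1 v)).sub
      ((hasSecondDerivAtZero_norm_sq τ0 v.1).const_mul δ)
    have h2 : IsLocalMin (fun t : ℝ => inChart Ψ e (p + t • v) - inChart Φ e (p + t • v) -
        δ * ‖τ0 + t • v.1‖ ^ 2) 0 := by
      have h3 : ∀ᶠ t in 𝓝 (0 : ℝ), τ0 + t • v.1 ∈ R :=
        (tendsto_line τ0 v.1).eventually (hRo.mem_nhds hτR)
      filter_upwards [h3] with t ht
      have h4 := hmax (show (τ0 + t • v.1, e.symm (e x0 + t • v.2)) ∈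
        closure R ×ˢ (univ : Set V) from ⟨subset_closure ht, mem_univ _⟩)
      simp only [mem_ofPred_eq] at h4
      simp only [inChart, hp, Prod.fst_add, Prod.snd_add, Prod.smul_fst, Prod.smul_snd,
        zero_smul, add_zero, e.left_inv hx0]
      linarith
    have := h1.nonneg_of_isLocalMin h2
    linarith
  have hlevi : ∀ v, leviForm (hess (inChart Φ e) p) v v + δ * ‖v.1‖ ^ 2 ≤
      leviForm (hess (inChart Ψ e) p) v v := by
    intro v
    have h1 := hreal v
    have h2 := hreal (Complex.I • v)
    simp only [Prod.smul_fst, norm_smul, Complex.norm_I, one_mul] at h2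
    rw [leviForm_apply, leviForm_apply]
    linarith
  obtain ⟨y, hy⟩ := exists_frame (ω.posDef e hea)
  -- Optimal trial vectors for Ψ have value 0, so they would give Φ a value at most -δ,
  -- contradicting its minimum 0.
  obtain ⟨a, c, hac⟩ := (hΨ.exists_trialValue hε hea hy hpm).2
  have h1 := trialValue_le_of_levi ω c1 c2 hlevi
    (r := ε * m.factorial / (m + 2).factorial) (by positivity) y a c
  have h2 := (hΦ.exists_trialValue hε hea hy hpm).1 a c
  linarith

/-- The minimum is -tr(b b⁻¹). Being independent of the chart, it allows the equation to be compared
at two different points of V. -/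
theorem metric_trial {b : Matrix (Fin (m + 1)) (Fin (m + 1)) ℂ} (hb : b.PosDef)
    {y : Fin (m + 1) → Fin (m + 1) → ℂ} (hy : ∀ i j, ∑ k, y k i * star (y k j) = b i j) :
    (∀ c : Fin (m + 1) → Fin (m + 1) → ℂ,
      -(m + 1 : ℝ) ≤ ∑ k, ((hForm b (c k) (c k)).re - 2 * (c k ⬝ᵥ y k).re)) ∧
    ∃ c : Fin (m + 1) → Fin (m + 1) → ℂ,
      ∑ k, ((hForm b (c k) (c k)).re - 2 * (c k ⬝ᵥ y k).re) = -(m + 1 : ℝ) := by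
  have hdet : IsUnit b.det := (Matrix.isUnit_iff_isUnit_det b).1 hb.isUnit
  have htr : ∑ k, (star (y k) ⬝ᵥ b⁻¹.mulVec (y k)).re = (m + 1 : ℝ) := by
    rw [← Complex.re_sum, sum_frame_eq_trace hy, Matrix.mul_nonsing_inv _ hdet]
    simp
  have hval : ∀ c : Fin (m + 1) → Fin (m + 1) → ℂ,
      ∑ k, ((hForm b (c k) (c k)).re - 2 * (c k ⬝ᵥ y k).re) =
      ∑ k, (hForm b (c k - star (b⁻¹.mulVec (y k))) (c k - star (b⁻¹.mulVec (y k)))).re -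
        (m + 1 : ℝ) := by
    intro c
    simp only [hForm_completing_square hb]
    rw [Finset.sum_sub_distrib, htr]
  refine ⟨fun c => ?_, fun k => star (b⁻¹.mulVec (y k)), ?_⟩
  · rw [hval]
    have := Finset.sum_nonneg fun k (_ : k ∈ Finset.univ) =>
      hb.hForm_nonneg (c k - star (b⁻¹.mulVec (y k)))
    linarith
  · rw [hval]
    simp [hForm]

/-- A solution with boundary values that are constant along `V` is constant along `V`. -/
theorem IsPerturbedSolution.le_of_zero_boundary [CompactSpace V] {R : Set ℂ} (hRo : IsOpen R)
    (hRb : Bornology.IsBounded R) {ω : ConstantMetric (m + 1) V} {ε : ℝ} (hε : 0 < ε)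
    {F Φ : ℂ → V → ℝ} (hΦ : IsPerturbedSolution R ω ε F Φ)
    (hF : ∀ τ ∈ frontier R, ∀ x y, F τ x = F τ y) :
    ∀ τ ∈ closure R, ∀ x x', Φ τ x ≤ Φ τ x' := by
  intro τ1 hτ1 x1 x1'
  by_contra! hlt
  have hK : IsCompact (closure R) := hRb.isCompact_closure
  obtain ⟨D, hD0, hD⟩ := exists_norm_sq_bound hK
  set η := Φ τ1 x1 - Φ τ1 x1' with hη
  have hη0 : 0 < η := sub_pos.2 hlt
  set δ := η / (2 * D) with hδ
  have hδ0 : 0 < δ := by positivity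
  have hδD : δ * D < η := by
    have : δ * D = η / 2 := by
      rw [hδ]
      field_simp
    linarith
  -- Doubling of variables: Φ(τ,x) - Φ(τ,x') + δ|τ|² is maximized over closure R × V × V. At an
  -- interior maximum the two points may be moved independently along V, provided they share the
  -- same τ.
  have hcont : ContinuousOn (fun p : ℂ × (V × V) => Φ p.1 p.2.1 - Φ p.1 p.2.2 + δ * ‖p.1‖ ^ 2)
      (closure R ×ˢ univ) := by
    have h1 : ContinuousOn (fun p : ℂ × (V × V) => Φ p.1 p.2.1) (closure R ×ˢ univ) :=
      hΦ.continuous.comp (f := fun p : ℂ × (V × V) => (p.1, p.2.1)) (by fun_prop)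
        fun p hp => ⟨hp.1, mem_univ _⟩
    have h2 : ContinuousOn (fun p : ℂ × (V × V) => Φ p.1 p.2.2) (closure R ×ˢ univ) :=
      hΦ.continuous.comp (f := fun p : ℂ × (V × V) => (p.1, p.2.2)) (by fun_prop)
        fun p hp => ⟨hp.1, mem_univ _⟩
    exact (h1.sub h2).add (by fun_prop)
  obtain ⟨⟨τ0, x0, x0'⟩, ⟨hτ0, -⟩, hmax⟩ := (hK.prod isCompact_univ).exists_isMaxOn
    ⟨(τ1, x1, x1'), hτ1, mem_univ _⟩ hcont
  have hle : η ≤ Φ τ0 x0 - Φ τ0 x0' + δ * ‖τ0‖ ^ 2 := by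
    have h1 := hmax (show (τ1, x1, x1') ∈ closure R ×ˢ (univ : Set (V × V)) from
      ⟨hτ1, mem_univ _⟩)
    have h2 : 0 ≤ δ * ‖τ1‖ ^ 2 := by positivity
    simp only [mem_ofPred_eq] at h1
    linarith
  have hτR : τ0 ∈ R := by
    by_contra hnot
    have hfr : τ0 ∈ frontier R := by
      rw [hRo.frontier_eq]
      exact ⟨hτ0, hnot⟩
    rw [hΦ.boundary τ0 hfr, hΦ.boundary τ0 hfr, hF τ0 hfr x0 x0'] at hle
    have h2 := mul_le_mul_of_nonneg_left (hD τ0 hτ0) hδ0.le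
    linarith
  have hchart : ∀ x : V, ∃ e ∈ atlas (Fin (m + 1) → ℂ) V, x ∈ e.source ∧
      (τ0, e x) ∈ R ×ˢ e.target ∧ ContDiffAt ℝ 2 (inChart Φ e) (τ0, e x) := by
    intro x
    set e := chartAt (Fin (m + 1) → ℂ) x with he
    have hea : e ∈ atlas (Fin (m + 1) → ℂ) V := chart_mem_atlas _ x
    have hx : x ∈ e.source := mem_chart_source _ x
    have hpm : (τ0, e x) ∈ R ×ˢ e.target := ⟨hτR, e.map_source hx⟩
    exact ⟨e, hea, hx, hpm, ((hΦ.contDiff e hea).contDiffAt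
      ((hRo.prod e.open_target).mem_nhds hpm)).of_le (by norm_num)⟩
  obtain ⟨e, he, hx0, hp, c1⟩ := hchart x0
  obtain ⟨e', he', hx0', hp', c2⟩ := hchart x0'
  set p : ℂ × (Fin (m + 1) → ℂ) := (τ0, e x0) with hpdef
  set p' : ℂ × (Fin (m + 1) → ℂ) := (τ0, e' x0') with hpdef'
  have hreal : ∀ v v' : ℂ × (Fin (m + 1) → ℂ), v.1 = v'.1 →
      hess (inChart Φ e) p v v + 2 * δ * ‖v.1‖ ^ 2 ≤ hess (inChart Φ e') p' v' v' := by
    intro v v' hv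
    have h1 := ((hasSecondDerivAtZero_line c2 v').sub (hasSecondDerivAtZero_line c1 v)).sub
      ((hasSecondDerivAtZero_norm_sq τ0 v.1).const_mul δ)
    have h2 : IsLocalMin (fun t : ℝ => inChart Φ e' (p' + t • v') - inChart Φ e (p + t • v) -
        δ * ‖τ0 + t • v.1‖ ^ 2) 0 := by
      have h3 : ∀ᶠ t in 𝓝 (0 : ℝ), τ0 + t • v.1 ∈ R :=
        (tendsto_line τ0 v.1).eventually (hRo.mem_nhds hτR)
      filter_upwards [h3] with t ht
      have h4 := hmax (show (τ0 + t • v.1, e.symm (e x0 + t • v.2), e'.symm (e' x0' + t • v'.2)) ∈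
        closure R ×ˢ (univ : Set (V × V)) from ⟨subset_closure ht, mem_univ _⟩)
      simp only [mem_ofPred_eq] at h4
      simp only [inChart, hpdef, hpdef', Prod.fst_add, Prod.snd_add, Prod.smul_fst, Prod.smul_snd,
        zero_smul, add_zero, e.left_inv hx0, e'.left_inv hx0', ← hv]
      linarith
    have := h1.nonneg_of_isLocalMin h2
    linarith
  have hlevi : ∀ v v' : ℂ × (Fin (m + 1) → ℂ), v.1 = v'.1 →
      leviForm (hess (inChart Φ e) p) v v + δ * ‖v.1‖ ^ 2 ≤
      leviForm (hess (inChart Φ e') p') v' v' := by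
    intro v v' hv
    have h1 := hreal v v' hv
    have h2 := hreal (Complex.I • v) (Complex.I • v') (by simp [hv])
    simp only [Prod.smul_fst, norm_smul, Complex.norm_I, one_mul] at h2
    rw [leviForm_apply, leviForm_apply]
    linarith
  set r : ℝ := ε * m.factorial / (m + 2).factorial with hr
  have hr0 : 0 < r := by positivity
  -- the point of maximum
  obtain ⟨y, hy⟩ := exists_frame (ω.posDef e he)
  obtain ⟨c, hc⟩ := (metric_trial (ω.posDef e he) hy).2
  -- At `x0` the Levi form of Φ is nonpositive along V, so `a = 0` and the trial vectors optimal for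
  -- `b` give a Levi form of at least r(m+1) at (1, 0).
  have t1 := (hΦ.exists_trialValue hε he hy hp).1 0 c
  simp only [trialValue, re_hForm_fullMatrix ω c1] at t1
  have t2 : ∑ k, ((hForm (ω.coeff e) (c k) (c k)).re +
      leviForm (hess (inChart Φ e) p) (0, c k) (0, c k) - 2 * (c k ⬝ᵥ y k).re) ≤
      -(m + 1 : ℝ) := by
    rw [← hc]
    refine Finset.sum_le_sum fun k _ => ?_
    have := hlevi (0, c k) 0 (by simp)
    simp at this
    linarith
  have t3 : (hForm (ω.coeff e) 0 0).re = 0 := by simp [hForm]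
  have t4 := mul_le_mul_of_nonneg_left t2 hr0.le
  rw [t3] at t1
  -- the point of minimum
  obtain ⟨y', hy'⟩ := exists_frame (ω.posDef e' he')
  -- At `x0'` the Levi form is nonnegative along V, so the optimal trial vectors give a Levi form of
  -- at most r(m+1) at (1, a). This contradicts `hlevi` for (1, 0) and (1, a), which has the gap
  -- `δ`.
  obtain ⟨a, c', hac⟩ := (hΦ.exists_trialValue hε he' hy' hp').2
  have u1 := (metric_trial (ω.posDef e' he') hy').1 c'
  simp only [trialValue, re_hForm_fullMatrix ω c2] at hac
  have u2 : -(m + 1 : ℝ) ≤ ∑ k, ((hForm (ω.coeff e') (c' k) (c' k)).re +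
      leviForm (hess (inChart Φ e') p') (0, c' k) (0, c' k) - 2 * (c' k ⬝ᵥ y' k).re) := by
    refine u1.trans (Finset.sum_le_sum fun k _ => ?_)
    have := hlevi 0 (0, c' k) (by simp)
    simp at this
    linarith
  have u3 := (ω.posDef e' he').hForm_nonneg a
  have u4 := mul_le_mul_of_nonneg_left u2 hr0.le
  have h5 := hlevi (1, 0) (1, a) rfl
  simp only [norm_one, one_pow, mul_one] at h5
  linarith

end Comparison

/-! ### Positivity of the constant form. -/

section Base

variable {n : ℕ} {V : Type*} [TopologicalSpace V] [ChartedSpace (Fin n → ℂ) V]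

/-- If there is a strictly `(S, ω₀)`-convex function on a compact manifold, then the function
`0` is strictly `(S, ω₀)`-convex. -/
theorem constForm_pos_of_strictlyConvex [CompactSpace V] (hV : IsComplexAffine n V)
    (ω : ConstantMetric n V) (S : ConstantTensor n V) {φ : V → ℝ}
    (hφ : StrictlySOmegaConvex ω S φ) {e : OpenPartialHomeomorph V (Fin n → ℂ)}
    (he : e ∈ atlas (Fin n → ℂ) V) {z : Fin n → ℂ} (hz : z ∈ e.target) {ξ : Fin n → ℂ}
    (hξ : ξ ≠ 0) : 0 < constForm ω S e ξ := by
  obtain ⟨hcd, hpos⟩ := (strictlySOmegaConvex_iff ω S φ).1 hφ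
  by_contra! hneg
  -- Since the coefficients are constant in charts, the set where `constForm` fails to be positive
  -- is open and closed. A maximum of `φ` on it is therefore a local maximum on V; there D²φ ≤ 0,
  -- and a bad direction of `constForm` is bad for `convexForm` too.
  let Z : Set V := {x | ∃ e ∈ atlas (Fin n → ℂ) V, x ∈ e.source ∧
    ∃ ξ, ξ ≠ 0 ∧ constForm ω S e ξ ≤ 0}
  have hZo : IsOpen Z := by
    refine isOpen_iff_mem_nhds.2 ?_
    rintro x ⟨e, he, hx, h⟩
    filter_upwards [e.open_source.mem_nhds hx] with y hy using ⟨e, he, hy, h⟩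
  have hmove : ∀ x ∈ Z, ∀ e ∈ atlas (Fin n → ℂ) V, x ∈ e.source →
      ∃ ξ, ξ ≠ 0 ∧ constForm ω S e ξ ≤ 0 := by
    rintro x ⟨e', he', hx', ξ, hξ, h⟩ e he hx
    obtain ⟨J, hJ1, hJ2, -⟩ := exists_chart_change hV ω S he' he hx' hx
    refine ⟨J ξ, fun h0 => ?_, by rwa [← hJ2]⟩
    have h1 := metricForm_pos ω he' hξ
    rw [metricForm, hJ1, h0] at h1
    simp [hForm] at h1
  have hZc : IsClosed Z := by
    refine isClosed_of_closure_subset fun x hx => ?_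
    obtain ⟨y, hy1, hy2⟩ := mem_closure_iff_nhds.1 hx _ (chart_source_mem_nhds (Fin n → ℂ) x)
    exact ⟨_, chart_mem_atlas _ x, mem_chart_source _ x, hmove y hy2 _ (chart_mem_atlas _ x) hy1⟩
  have hcont : Continuous φ := by
    refine continuous_iff_continuousAt.2 fun x => ?_
    set c := chartAt (Fin n → ℂ) x
    have hx : x ∈ c.source := mem_chart_source _ x
    have h1 : ContinuousAt (fun w => φ (c.symm w)) (c x) :=
      ((hcd c (chart_mem_atlas _ x)).continuousOn).continuousAt
        (c.open_target.mem_nhds (c.map_source hx))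
    have h2 : ContinuousAt (fun y => φ (c.symm (c y))) x := h1.comp (c.continuousAt hx)
    refine h2.congr ?_
    filter_upwards [c.open_source.mem_nhds hx] with y hy
    rw [c.left_inv hy]
  obtain ⟨x, hxZ, hmax⟩ := hZc.isCompact.exists_isMaxOn
    ⟨e.symm z, e, he, e.map_target hz, ξ, hξ, hneg⟩ hcont.continuousOn
  set c := chartAt (Fin n → ℂ) x
  have hc : c ∈ atlas (Fin n → ℂ) V := chart_mem_atlas _ x
  have hx : x ∈ c.source := mem_chart_source _ x
  obtain ⟨ζ, hζ, hζneg⟩ := hmove x hxZ c hc hx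
  have h1 := hpos c hc (c x) (c.map_source hx) ζ hζ
  have h2 : IsLocalMax (fun w => φ (c.symm w)) (c x) := by
    have h3 : ∀ᶠ w in 𝓝 (c x), c.symm w ∈ Z := by
      have h4 := (c.continuousAt_symm (c.map_source hx)).tendsto
      rw [c.left_inv hx] at h4
      exact h4.eventually (hZo.mem_nhds hxZ)
    filter_upwards [h3] with w hw
    rw [c.left_inv hx]
    exact hmax hw
  have h3 := hess_nonpos_of_isLocalMax
    ((hcd c hc).contDiffAt (c.open_target.mem_nhds (c.map_source hx))) h2 ζ
  rw [convexForm] at h1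
  linarith

end Base

end

noncomputable section

/-! ### Dependence of the forms on the path parameter. -/

section Path

variable {n : ℕ} {V : Type*} [TopologicalSpace V] [ChartedSpace (Fin n → ℂ) V]

theorem hess_slice_eq_iteratedFDerivWithin {f : ℂ × (Fin n → ℂ) → ℝ} {s : Set (ℂ × (Fin n → ℂ))}
    {τ : ℂ} {z : Fin n → ℂ} (hs : s ∈ 𝓝 (τ, z)) (hf : ContDiffAt ℝ 2 f (τ, z)) (ξ : Fin n → ℂ) :
    hess (fun w => f (τ, w)) z ξ ξ =
      iteratedFDerivWithin ℝ 2 f s (τ, z) (fun _ => ((0, ξ) : ℂ × (Fin n → ℂ))) := by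
  rw [hess_slice hf, iteratedFDerivWithin_congr_set (t := univ) (eventuallyEq_univ.2 hs),
    iteratedFDerivWithin_univ, iteratedFDeriv_two_apply]
  rfl

/-- Along a continuity path the forms `convexForm` vary continuously, uniformly on
`closure R × V`. -/
theorem IsContinuityPath.eventually_abs_convexForm_sub_le [CompactSpace V]
    (hV : IsComplexAffine n V) {ω : ConstantMetric n V} (S : ConstantTensor n V) {R : Set ℂ}
    (hRo : IsOpen R) {ε : ℝ} {F : ℂ → V → ℝ} {Ψ : ℝ → ℂ → V → ℝ}
    (hΨ : IsContinuityPath R ω ε F Ψ) {c : ℝ} (hc : 0 < c) {σ₀ : ℝ} (hσ₀ : σ₀ ∈ Icc (0 : ℝ) 1) :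
    ∀ᶠ σ in 𝓝[Icc (0 : ℝ) 1] σ₀, ∀ τ ∈ closure R, ∀ e ∈ atlas (Fin n → ℂ) V, ∀ z ∈ e.target,
      ∀ ξ, |convexForm ω S (Ψ σ τ) e z ξ - convexForm ω S (Ψ σ₀ τ) e z ξ| ≤
        c * metricForm ω e ξ := by
  obtain ⟨t, K, hKc, hKt, ht⟩ := exists_finite_compact_cover (n := n) (V := V)
  have hlocal : ∀ x ∈ t, ∀ᶠ σ in 𝓝[Icc (0 : ℝ) 1] σ₀, ∀ τ ∈ closure R, ∀ z ∈ K x, ∀ ξ,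
      |convexForm ω S (Ψ σ τ) (chartAt (Fin n → ℂ) x) z ξ -
        convexForm ω S (Ψ σ₀ τ) (chartAt (Fin n → ℂ) x) z ξ| ≤
        c * metricForm ω (chartAt (Fin n → ℂ) x) ξ := by
    intro x _
    set e := chartAt (Fin n → ℂ) x
    have he : e ∈ atlas (Fin n → ℂ) V := chart_mem_atlas _ x
    obtain ⟨k, hk, hcoer⟩ := exists_metricForm_coercive ω he
    have h1 := Metric.tendstoUniformlyOn_iff.1
      (hΨ.continuous σ₀ hσ₀ e he (K x) (hKt x) (hKc x) 2 le_rfl) (c * k) (mul_pos hc hk)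
    filter_upwards [h1, self_mem_nhdsWithin] with σ hσ hσI τ hτ z hz ξ
    have hcont : ∀ s ∈ Icc (0 : ℝ) 1,
        ContinuousOn (fun τ => convexForm ω S (Ψ s τ) e z ξ) (closure R) := by
      intro s hs
      have h2 := continuousOn_hess_slice e.open_target
        ((hΨ.contDiff s hs e he).of_le (by norm_num))
      have h3 : ContinuousOn (fun τ => hess (fun w => inChart (Ψ s) e (τ, w)) z ξ ξ)
          (closure R) := h2.comp (f := fun τ => ((τ, z), ξ)) (by fun_prop)
            fun τ hτ => ⟨⟨hτ, hKt x hz⟩, mem_univ _⟩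
      exact continuousOn_const.add (h3.const_smul (1 / 2 : ℝ))
    -- The derivatives within closure R × V are compared with the slice Hessian only over the open
    -- set R; continuity carries the estimate to the closure.
    refine le_on_closure (s := R) (f := fun τ => |convexForm ω S (Ψ σ τ) e z ξ -
      convexForm ω S (Ψ σ₀ τ) e z ξ|) (g := fun _ => c * metricForm ω e ξ) ?_
      ((hcont σ hσI).sub (hcont σ₀ hσ₀)).abs continuousOn_const hτ
    intro τ hτ
    have hnR : R ×ˢ e.target ∈ 𝓝 (τ, z) :=
      (hRo.prod e.open_target).mem_nhds ⟨hτ, hKt x hz⟩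
    have hval : ∀ s ∈ Icc (0 : ℝ) 1, hess (fun w => Ψ s τ (e.symm w)) z ξ ξ =
        iteratedFDerivWithin ℝ 2 (inChart (Ψ s) e) (closure R ×ˢ e.target) (τ, z)
          (fun _ => ((0, ξ) : ℂ × (Fin n → ℂ))) := fun s hs =>
      hess_slice_eq_iteratedFDerivWithin (f := inChart (Ψ s) e)
        (mem_of_superset hnR (prod_mono_left subset_closure))
        (((((hΨ.solution s hs).contDiff e he)).contDiffAt hnR).of_le (by norm_num)) ξ
    have h2 := hσ (τ, z) ⟨subset_closure hτ, hz⟩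
    rw [dist_comm, dist_eq_norm] at h2
    set D := iteratedFDerivWithin ℝ 2 (inChart (Ψ σ) e) (closure R ×ˢ e.target) (τ, z) -
      iteratedFDerivWithin ℝ 2 (inChart (Ψ σ₀) e) (closure R ×ˢ e.target) (τ, z) with hD
    have h3 : convexForm ω S (Ψ σ τ) e z ξ - convexForm ω S (Ψ σ₀ τ) e z ξ =
        1 / 2 * D (fun _ => ((0, ξ) : ℂ × (Fin n → ℂ))) := by
      rw [convexForm, convexForm, hval σ hσI, hval σ₀ hσ₀, hD,
        sub_apply]
      ring
    have h4 : |D (fun _ => ((0, ξ) : ℂ × (Fin n → ℂ)))| ≤ ‖D‖ * ‖ξ‖ ^ 2 := by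
      have := D.le_opNorm (fun _ => ((0, ξ) : ℂ × (Fin n → ℂ)))
      simpa [Prod.norm_def] using this
    have h5 : ‖D‖ * ‖ξ‖ ^ 2 ≤ c * k * ‖ξ‖ ^ 2 :=
      mul_le_mul_of_nonneg_right h2.le (sq_nonneg _)
    have h6 := mul_le_mul_of_nonneg_left (hcoer ξ) hc.le
    have h7 := abs_nonneg (D (fun _ => ((0, ξ) : ℂ × (Fin n → ℂ))))
    show |convexForm ω S (Ψ σ τ) e z ξ - convexForm ω S (Ψ σ₀ τ) e z ξ| ≤ c * metricForm ω e ξ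
    rw [h3, abs_mul, abs_of_pos (by norm_num : (0 : ℝ) < 1 / 2)]
    linarith
  filter_upwards [(Finset.eventually_all t).2 hlocal, self_mem_nhdsWithin] with σ hσ hσI
  intro τ hτ e he z hz ξ
  obtain ⟨x, hxt, hx, hxK⟩ := ht (e.symm z)
  obtain ⟨J, hJ1, -, hJ3⟩ := exists_chart_change hV ω S he (chart_mem_atlas (Fin n → ℂ) x)
    (e.map_target hz) hx
  have hcd : ∀ s ∈ Icc (0 : ℝ) 1,
      ContDiffAt ℝ 2 (fun w => Ψ s τ ((chartAt (Fin n → ℂ) x).symm w))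
        (chartAt (Fin n → ℂ) x (e.symm z)) := fun s hs =>
    (((hΨ.contDiff s hs _ (chart_mem_atlas _ x)).of_le (by norm_num)).slice hτ).contDiffAt
      ((chartAt (Fin n → ℂ) x).open_target.mem_nhds ((chartAt (Fin n → ℂ) x).map_source hx))
  have h1 := hJ3 _ (hcd σ hσI) ξ
  have h2 := hJ3 _ (hcd σ₀ hσ₀) ξ
  have h3 : metricForm ω e ξ = metricForm ω (chartAt (Fin n → ℂ) x) (J ξ) := hJ1 ξ
  rw [e.right_inv hz] at h1 h2
  rw [h1, h2, h3]
  exact hσ x hxt τ hτ _ hxK (J ξ)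

/-- The form is affine in `φ`, so for boundary values σF with σ ∈ [0,1] it is a convex combination
of two positive forms, with a lower bound uniform in σ. -/
theorem convexForm_const_mul (ω : ConstantMetric n V) (S : ConstantTensor n V) {φ : V → ℝ}
    {e : OpenPartialHomeomorph V (Fin n → ℂ)} {z : Fin n → ℂ}
    (hφ : ContDiffAt ℝ 2 (fun w => φ (e.symm w)) z) (s : ℝ) (ξ : Fin n → ℂ) :
    convexForm ω S (fun x => s * φ x) e z ξ =
      (1 - s) * constForm ω S e ξ + s * convexForm ω S φ e z ξ := by
  have h1 : fderiv ℝ (fun w => s * φ (e.symm w)) =ᶠ[𝓝 z]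
      fun w => s • fderiv ℝ (fun w => φ (e.symm w)) w := by
    filter_upwards [hφ.eventually (by simp)] with w hw
    exact fderiv_const_mul (hw.differentiableAt (by norm_num)) s
  have h2 : DifferentiableAt ℝ (fderiv ℝ (fun w => φ (e.symm w))) z :=
    (hφ.fderiv_right (m := 1) (by norm_num)).differentiableAt (by norm_num)
  have h3 : hess (fun w => s * φ (e.symm w)) z ξ ξ = s * hess (fun w => φ (e.symm w)) z ξ ξ := by
    rw [hess, h1.fderiv_eq, fderiv_fun_const_smul h2]
    rfl
  rw [convexForm, convexForm, h3]
  ring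

theorem convexForm_of_const (ω : ConstantMetric n V) (S : ConstantTensor n V) {φ : V → ℝ}
    (hφ : ∀ x y, φ x = φ y) (e : OpenPartialHomeomorph V (Fin n → ℂ)) (z ξ : Fin n → ℂ) :
    convexForm ω S φ e z ξ = constForm ω S e ξ := by
  have h : (fun w => φ (e.symm w)) = fun _ => φ (e.symm z) := funext fun w => hφ _ _
  have h1 : fderiv ℝ (fun _ : Fin n → ℂ => φ (e.symm z)) = fun _ => 0 := by
    ext1 w
    simp
  rw [convexForm, h, hess, h1]
  simp

/-- A form `convexForm` which is positive over a compact set of parameters is bounded below by a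
multiple of the metric. -/
theorem exists_pos_mul_metricForm_le [CompactSpace V] (hV : IsComplexAffine n V)
    (ω : ConstantMetric n V) (S : ConstantTensor n V) {T : Set ℂ} (hT : IsCompact T)
    {Φ : ℂ → V → ℝ}
    (hΦ : ∀ e ∈ atlas (Fin n → ℂ) V, ContDiffOn ℝ 2 (inChart Φ e) (T ×ˢ e.target))
    (hpos : ∀ τ ∈ T, ∀ e ∈ atlas (Fin n → ℂ) V, ∀ z ∈ e.target, ∀ ξ, ξ ≠ 0 →
      0 < convexForm ω S (Φ τ) e z ξ) :
    ∃ c > 0, ∀ τ ∈ T, ∀ e ∈ atlas (Fin n → ℂ) V, ∀ z ∈ e.target, ∀ ξ,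
      c * metricForm ω e ξ ≤ convexForm ω S (Φ τ) e z ξ := by
  by_cases hne : ∃ τ ∈ T, ∃ e ∈ atlas (Fin n → ℂ) V, ∃ z ∈ e.target, ∃ ξ, metricForm ω e ξ = 1
  · obtain ⟨τ, hτ, e, he, z, hz, ξ, hξ, hmin⟩ :=
      exists_min_convexForm hV ω S hT hΦ (w := fun _ => 0) continuous_const hne
    have hξ0 : ξ ≠ 0 := by
      rintro rfl
      simp [metricForm, hForm] at hξ
    refine ⟨_, hpos τ hτ e he z hz ξ hξ0, fun τ' hτ' e' he' z' hz' =>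
      convexForm_ge_of_unit ω S he' fun ξ' hξ' => ?_⟩
    simpa using hmin τ' hτ' e' he' z' hz' ξ' hξ'
  · refine ⟨1, one_pos, fun τ hτ e he z hz => convexForm_ge_of_unit ω S he fun ξ hξ => ?_⟩
    exact absurd ⟨τ, hτ, e, he, z, hz, ξ, hξ⟩ hne

end Path

theorem frontier_nonempty_of_isBounded {R : Set ℂ} (hRn : R.Nonempty)
    (hRb : Bornology.IsBounded R) : (frontier R).Nonempty := by
  rw [nonempty_iff_ne_empty]
  intro h
  have h1 : IsClopen R := isClopen_iff_frontier_eq_empty.2 h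
  rw [h1.eq_univ hRn] at hRb
  exact NormedSpace.unbounded_univ ℝ ℂ hRb

/-! ### The continuity method and the conclusion. -/

section Continuity

variable {m : ℕ} {V : Type*} [TopologicalSpace V] [ChartedSpace (Fin (m + 1) → ℂ) V]

/-- The method of continuity: the end point of a continuity path is convex in the directions of
`V`. -/
theorem IsContinuityPath.convexForm_pos [CompactSpace V] (hV : IsComplexAffine (m + 1) V)
    {ω : ConstantMetric (m + 1) V} {S : ConstantTensor (m + 1) V} {R : Set ℂ} (hRo : IsOpen R)
    (hRn : R.Nonempty) (hRb : Bornology.IsBounded R) {ε : ℝ} (hε : 0 < ε) {F : ℂ → V → ℝ}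
    (hF : ∀ τ ∈ frontier R, StrictlySOmegaConvex ω S (F τ)) {Ψ : ℝ → ℂ → V → ℝ}
    (hΨ : IsContinuityPath R ω ε F Ψ) :
    ∀ τ ∈ closure R, ∀ e ∈ atlas (Fin (m + 1) → ℂ) V, ∀ z ∈ e.target, ∀ ξ, ξ ≠ 0 →
      0 < convexForm ω S (Ψ 1 τ) e z ξ := by
  obtain ⟨τ₀, hτ₀⟩ := frontier_nonempty_of_isBounded hRn hRb
  have h0I : (0 : ℝ) ∈ Icc (0 : ℝ) 1 := by simp
  have h1I : (1 : ℝ) ∈ Icc (0 : ℝ) 1 := by simp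
  have hcd : ∀ s ∈ Icc (0 : ℝ) 1, ∀ e ∈ atlas (Fin (m + 1) → ℂ) V,
      ContDiffOn ℝ 2 (inChart (Ψ s) e) (closure R ×ˢ e.target) := fun s hs e he =>
    (hΨ.contDiff s hs e he).of_le (by norm_num)
  have hconst : ∀ e ∈ atlas (Fin (m + 1) → ℂ) V, ∀ z ∈ e.target, ∀ ξ, ξ ≠ 0 →
      0 < constForm ω S e ξ := fun e he z hz ξ hξ =>
    constForm_pos_of_strictlyConvex hV ω S (hF τ₀ hτ₀) he hz hξ
  have hfr : IsCompact (frontier R) :=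
    hRb.isCompact_closure.of_isClosed_subset isClosed_frontier frontier_subset_closure
  have hb1 : ∀ τ ∈ frontier R, Ψ 1 τ = F τ := fun τ hτ => funext fun x => by
    rw [(hΨ.solution 1 h1I).boundary τ hτ x, one_mul]
  obtain ⟨c₁, hc₁, hle₁⟩ := exists_pos_mul_metricForm_le hV ω S hfr (Φ := Ψ 1)
    (fun e he => (hcd 1 h1I e he).mono (prod_mono_left frontier_subset_closure))
    (fun τ hτ e he z hz ξ hξ => by
      rw [hb1 τ hτ]
      exact ((strictlySOmegaConvex_iff ω S _).1 (hF τ hτ)).2 e he z hz ξ hξ)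
  obtain ⟨c₂, hc₂, hle₂⟩ := exists_pos_mul_metricForm_le hV ω S hfr (Φ := fun _ _ => 0)
    (fun e he => contDiffOn_const)
    (fun τ hτ e he z hz ξ hξ => by
      rw [convexForm_of_const ω S fun _ _ => rfl]
      exact hconst e he z hz ξ hξ)
  set c := min c₁ c₂
  have hc : 0 < c := lt_min hc₁ hc₂
  have hbdry : ∀ s ∈ Icc (0 : ℝ) 1, ∀ τ ∈ frontier R, ∀ e ∈ atlas (Fin (m + 1) → ℂ) V,
      ∀ z ∈ e.target, ∀ ξ, c * metricForm ω e ξ ≤ convexForm ω S (Ψ s τ) e z ξ := by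
    intro s hs τ hτ e he z hz
    refine convexForm_ge_of_unit ω S he fun ξ hξ => ?_
    have h1 : Ψ s τ = fun x => s * F τ x := funext fun x => (hΨ.solution s hs).boundary τ hτ x
    have h2 := hle₁ τ hτ e he z hz ξ
    have h3 := hle₂ τ hτ e he z hz ξ
    rw [convexForm_of_const ω S (fun _ _ => rfl), hξ, mul_one] at h3
    rw [hb1 τ hτ, hξ, mul_one] at h2
    rw [h1, convexForm_const_mul ω S
      (((hF τ hτ).contDiff e he).contDiffAt (e.open_target.mem_nhds hz))]
    have h4 := mul_le_mul_of_nonneg_left ((min_le_right c₁ c₂).trans h3) (sub_nonneg.2 hs.2)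
    have h5 := mul_le_mul_of_nonneg_left ((min_le_left c₁ c₂).trans h2) hs.1
    linarith
  let P : ℝ → Prop := fun s => ∀ τ ∈ closure R, ∀ e ∈ atlas (Fin (m + 1) → ℂ) V,
    ∀ z ∈ e.target, ∀ ξ, ξ ≠ 0 → 0 < convexForm ω S (Ψ s τ) e z ξ
  -- Mere positivity improves to the bound with the fixed constant `c` from the boundary. This gap
  -- makes positivity both open and closed along the path.
  have hP : ∀ s ∈ Icc (0 : ℝ) 1, P s → ∀ τ ∈ closure R, ∀ e ∈ atlas (Fin (m + 1) → ℂ) V,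
      ∀ z ∈ e.target, ∀ ξ, c * metricForm ω e ξ ≤ convexForm ω S (Ψ s τ) e z ξ := fun s hs hPs =>
    convexForm_ge_of_boundary hV ω S hRo hRb hε (hΨ.solution s hs) (hcd s hs) hPs (hbdry s hs)
  have hP0 : P 0 := by
    intro τ hτ e he z hz ξ hξ
    have h1 := (hΨ.solution 0 h0I).le_of_zero_boundary hRo hRb hε (fun τ _ x y => by simp) τ hτ
    rw [convexForm_of_const ω S fun x y => le_antisymm (h1 x y) (h1 y x)]
    exact hconst e he z hz ξ hξ
  -- For `s'` near `s` the forms differ by at most half of `c` times the metric, so positivity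
  -- passes from `s` to `s'` and back; connectedness carries it from 0 to 1.
  refine (isPreconnected_Icc (a := (0 : ℝ)) (b := 1)).induction₂' (fun s s' => P s → P s')
    ?_ (fun _ _ _ _ _ _ h h' => h' ∘ h) h0I h1I hP0
  intro s hs
  filter_upwards [hΨ.eventually_abs_convexForm_sub_le hV S hRo (half_pos hc) hs,
    self_mem_nhdsWithin] with s' hs' hs'I
  refine ⟨fun h τ hτ e he z hz ξ hξ => ?_, fun h τ hτ e he z hz ξ hξ => ?_⟩
  · have h1 := hP s hs h τ hτ e he z hz ξ
    have h2 := neg_le_of_abs_le (hs' τ hτ e he z hz ξ)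
    have h3 := mul_pos hc (metricForm_pos ω he hξ)
    linarith
  · have h1 := hP s' hs'I h τ hτ e he z hz ξ
    have h2 := le_of_abs_le (hs' τ hτ e he z hz ξ)
    have h3 := mul_pos hc (metricForm_pos ω he hξ)
    linarith

end Continuity

/-- Two applications of the comparison principle give Φ = Ψ 1 over closure R. This also provides the
regularity of Φ(τ,·) for τ in the frontier, where a solution is only assumed continuous. -/
theorem IsPerturbedSolution.strictlySOmegaConvex {n : ℕ} {V : Type*} [TopologicalSpace V]
    [CompactSpace V] [ChartedSpace (Fin n → ℂ) V] (hV : IsComplexAffine n V)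
    (ω : ConstantMetric n V) (S : ConstantTensor n V) {R : Set ℂ} (hRo : IsOpen R)
    (hRn : R.Nonempty) (hRb : Bornology.IsBounded R) {ε : ℝ} (hε : 0 < ε) {F : ℂ → V → ℝ}
    (hF : ∀ τ ∈ frontier R, StrictlySOmegaConvex ω S (F τ)) {Ψ : ℝ → ℂ → V → ℝ}
    (hΨ : IsContinuityPath R ω ε F Ψ) {Φ : ℂ → V → ℝ} (hΦ : IsPerturbedSolution R ω ε F Φ)
    {τ : ℂ} (hτ : τ ∈ closure R) : StrictlySOmegaConvex ω S (Φ τ) := by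
  rw [strictlySOmegaConvex_iff]
  cases n with
  -- In dimension zero there are no nonzero vectors; the determinant identities need at least one
  -- direction along V.
  | zero =>
    refine ⟨fun e he => ?_, fun e he z hz ξ hξ => absurd (Subsingleton.elim ξ 0) hξ⟩
    have h : (fun z => Φ τ (e.symm z)) = fun _ => Φ τ (e.symm 0) :=
      funext fun z => by rw [Subsingleton.elim z 0]
    rw [h]
    exact contDiffOn_const
  | succ m =>
    have h1I : (1 : ℝ) ∈ Icc (0 : ℝ) 1 := by simp
    have h1 : Φ τ = Ψ 1 τ := funext fun x => le_antisymm
      (hΦ.le hRo hRb hε (hΨ.solution 1 h1I) (fun τ _ x => by simp) τ hτ x)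
      ((hΨ.solution 1 h1I).le hRo hRb hε hΦ (fun τ _ x => by simp) τ hτ x)
    rw [h1]
    exact ⟨fun e he => ((hΨ.contDiff 1 h1I e he).of_le (by norm_num)).slice hτ,
      hΨ.convexForm_pos hV hRo hRn hRb hε hF τ hτ⟩

end

theorem mainTheorem5 {n : ℕ} {V : Type*} [TopologicalSpace V] [T2Space V] [CompactSpace V]
    [ChartedSpace (Fin n → ℂ) V] (hV : IsComplexAffine n V)
    (ω : ConstantMetric n V) (S : ConstantTensor n V)
    (R : Set ℂ) (hR : IsSmoothBoundedDomain R)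
    (ε : ℝ) (hε : 0 < ε)
    (F : ℂ → V → ℝ)
    (hF : ∀ e ∈ atlas (Fin n → ℂ) V, ContDiffOn ℝ 2 (inChart F e) (frontier R ×ˢ e.target))
    (hFconvex : ∀ τ ∈ frontier R, StrictlySOmegaConvex ω S (F τ))
    (hpath : ∃ Ψ : ℝ → ℂ → V → ℝ, IsContinuityPath R ω ε F Ψ)
    (Φ : ℂ → V → ℝ) (hΦ : IsPerturbedSolution R ω ε F Φ) :
    (∀ τ ∈ closure R, StrictlySOmegaConvex ω S (Φ τ)) ∧
      ∀ τ ∈ closure R, ∀ x : V, maxEigenvalueK ω S (Φ τ) x < 1 := by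
  obtain ⟨Ψ, hΨ⟩ := hpath
  have h : ∀ τ ∈ closure R, StrictlySOmegaConvex ω S (Φ τ) := fun τ hτ =>
    hΦ.strictlySOmegaConvex hV ω S hR.isOpen hR.isConnected.nonempty hR.isBounded hε hFconvex hΨ hτ
  exact ⟨h, fun τ hτ x => (h τ hτ).eigenvalue_lt _ (chart_mem_atlas _ x) _ (mem_chart_target _ x)⟩
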